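/- Let $\mathcal{C}$ be the split Cayley algebra over $\mathbb{R}$ (the $8$-dimensional composition algebra whose norm form has signature $(4,4)$), and let $G_{2(2)}$ be the connected group of automorphisms of $\mathcal{C}$, that is, the identity component of the Lie group $\operatorname{Aut}(\mathcal{C})$. Let $\mathrm{SO}_0(3,4)$ be the identity component of the group of real $7\times 7$ matrices of determinant $1$ that preserve a quadratic form of signature $(3,4)$, and let $\widetilde{\mathrm{SO}}_0(3,4)$ be its universal covering group. Let $G$ be a connected topological group with a continuous surjective homomorphism $\pi : G \to G_{2(2)}$ that is a covering map (for instance $G = G_{2(2)}$ with $\pi = \mathrm{id}$, or $G$ the universal covering group of $G_{2(2)}$). Then for every non-trivial continuous homomorphism $\rho_1 : G \to \widetilde{\mathrm{SO}}_0(3,4)$, the centralizer $$Z = \{\, z \in \widetilde{\mathrm{SO}}_0(3,4) : z\,\rho_1(g) = \rho_1(g)\,z \ \text{ for all } g \in G \,\}$$ of the image $\rho_1(G)$ is a finite subgroup of $\widetilde{\mathrm{SO}}_0(3,4)$. -/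

import Mathlib

open scoped Matrix unitInterval

noncomputable section

/-! ### The group `G₂₍₂₎` -/

/-- The underlying real vector space of the split Cayley algebra, in the model of Zorn's vector
matrices: `(a, b, u, v)` stands for the vector matrix with diagonal entries `a, b : ℝ` and
off-diagonal entries `u, v : ℝ³` (upper right and lower left).
(The componentwise product that a product type carries is not used.) -/
abbrev SplitCayley : Type := ℝ × ℝ × (Fin 3 → ℝ) × (Fin 3 → ℝ)

/-- The product of the split Cayley algebra (Zorn's product of vector matrices):
`(a, b, u, v) (a', b', u', v')` is
`(a a' + u ⬝ v', b b' + v ⬝ u', a u' + b' u - v × v', a' v + b v' + u × u')`.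
Its unit is `(1, 1, 0, 0)`; see `SplitCayley.normForm_mul` for its norm. -/
def SplitCayley.mul : SplitCayley → SplitCayley → SplitCayley
  | (a, b, u, v), (a', b', u', v') =>
    (a * a' + u ⬝ᵥ v', b * b' + v ⬝ᵥ u',
      a • u' + b' • u - v ⨯₃ v', a' • v + b • v' + u ⨯₃ u')

/-- The norm form of the split Cayley algebra, a quadratic form of signature `(4, 4)`. -/
def SplitCayley.normForm : SplitCayley → ℝ
  | (a, b, u, v) => a * b - u ⬝ᵥ v

/-- The norm form is multiplicative, so that this is a composition algebra. -/
theorem SplitCayley.normForm_mul (x y : SplitCayley) :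
    SplitCayley.normForm (SplitCayley.mul x y) =
      SplitCayley.normForm x * SplitCayley.normForm y := by
  obtain ⟨a, b, u, v⟩ := x
  obtain ⟨a', b', u', v'⟩ := y
  simp [SplitCayley.normForm, SplitCayley.mul, cross_apply, dotProduct, Fin.sum_univ_three,
    Matrix.vecHead, Matrix.vecTail]
  ring

/-- The group of automorphisms of the split Cayley algebra, as a group of invertible
(continuous) linear maps with the usual topology. -/
def SplitCayley.automorphismGroup : Subgroup (SplitCayley →L[ℝ] SplitCayley)ˣ where
  carrier := {φ | ∀ x y : SplitCayley,
    φ.1 (SplitCayley.mul x y) = SplitCayley.mul (φ.1 x) (φ.1 y)}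
  one_mem' := fun _ _ => rfl
  mul_mem' := by
    intro φ ψ hφ hψ x y
    change φ.1 (ψ.1 _) = SplitCayley.mul (φ.1 (ψ.1 x)) (φ.1 (ψ.1 y))
    rw [hψ x y, hφ]
  inv_mem' := by
    intro φ hφ x y
    have h1 : ∀ z, φ.1 (φ⁻¹.1 z) = z := fun z =>
      congrArg (fun f : SplitCayley →L[ℝ] SplitCayley => f z) φ.mul_inv
    have h2 : ∀ z, φ⁻¹.1 (φ.1 z) = z := fun z =>
      congrArg (fun f : SplitCayley →L[ℝ] SplitCayley => f z) φ.inv_mul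
    rw [← h2 (SplitCayley.mul (φ⁻¹.1 x) (φ⁻¹.1 y)), hφ, h1, h1]

/-- `G₂₍₂₎`: the connected group of automorphisms of the split Cayley algebra over `ℝ`. -/
abbrev G22 : Type := Subgroup.connectedComponentOfOne SplitCayley.automorphismGroup

/-! ### The group `SO₀(3,4)` -/

/-- `SO(3,4)`: real matrices of determinant `1` that preserve the form
`x₁² + x₂² + x₃² - y₁² - y₂² - y₃² - y₄²`. -/
def SO34 : Subgroup (Matrix.SpecialLinearGroup (Fin 3 ⊕ Fin 4) ℝ) where
  carrier := {A | A.1.transpose * LieAlgebra.Orthogonal.indefiniteDiagonal (Fin 3) (Fin 4) ℝ * A.1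
    = LieAlgebra.Orthogonal.indefiniteDiagonal (Fin 3) (Fin 4) ℝ}
  one_mem' := by simp
  mul_mem' := by
    intro A B hA hB
    simp only [Set.mem_ofPred_eq] at hA hB ⊢
    rw [Matrix.SpecialLinearGroup.coe_mul, Matrix.transpose_mul]
    calc _ = B.1.transpose * (A.1.transpose *
          LieAlgebra.Orthogonal.indefiniteDiagonal (Fin 3) (Fin 4) ℝ * A.1) * B.1 := by
          simp only [Matrix.mul_assoc]
      _ = _ := by rw [hA, hB]
  inv_mem' := by
    intro A hA
    simp only [Set.mem_ofPred_eq] at hA ⊢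
    have h : A.1 * (A⁻¹).1 = 1 := by
      rw [← Matrix.SpecialLinearGroup.coe_mul, mul_inv_cancel, Matrix.SpecialLinearGroup.coe_one]
    have h' : (A⁻¹).1.transpose * A.1.transpose = 1 := by
      rw [← Matrix.transpose_mul, h, Matrix.transpose_one]
    calc _ = (A⁻¹).1.transpose * (A.1.transpose *
          LieAlgebra.Orthogonal.indefiniteDiagonal (Fin 3) (Fin 4) ℝ * A.1) * (A⁻¹).1 := by
          rw [hA]
      _ = ((A⁻¹).1.transpose * A.1.transpose) *
          LieAlgebra.Orthogonal.indefiniteDiagonal (Fin 3) (Fin 4) ℝ * (A.1 * (A⁻¹).1) := by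
          simp only [Matrix.mul_assoc]
      _ = _ := by rw [h, h', Matrix.one_mul, Matrix.mul_one]

/-- `SO₀(3,4)`: the identity component of `SO(3,4)`. -/
abbrev SO34Zero : Type := Subgroup.connectedComponentOfOne SO34

/-! ### The universal covering group -/

section UniversalCover

instance continuousPaths_isTopologicalGroup (G : Type*) [TopologicalSpace G] [Group G]
    [IsTopologicalGroup G] : IsTopologicalGroup C(I, G) where
  continuous_inv := ContinuousMap.continuous_postcomp (⟨(·⁻¹), continuous_inv⟩ : C(G, G))

/-- The topological group (pointwise product, compact-open topology) of continuous paths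
`[0,1] → G` that start at `1`. -/
def basedPaths (G : Type*) [TopologicalSpace G] [Group G] [IsTopologicalGroup G] :
    Subgroup C(I, G) where
  carrier := {γ | γ 0 = 1}
  one_mem' := rfl
  mul_mem' := by
    intro a b ha hb
    simp only [Set.mem_ofPred_eq] at ha hb
    simp [ha, hb]
  inv_mem' := by
    intro a ha
    simp only [Set.mem_ofPred_eq] at ha
    simp [ha]

/-- The paths from `1` that are homotopic, with fixed endpoints, to the constant path `1`
(in particular they are loops). -/
def nullhomotopicLoops (G : Type*) [TopologicalSpace G] [Group G] [IsTopologicalGroup G] :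
    Subgroup (basedPaths G) where
  carrier := {γ | ContinuousMap.HomotopicRel γ.1 1 {0, 1}}
  one_mem' := ContinuousMap.HomotopicRel.refl _
  mul_mem' := by
    rintro a b ⟨F⟩ ⟨H⟩
    exact ⟨{  toContinuousMap := F.toContinuousMap * H.toContinuousMap
              map_zero_left := fun x => by simp
              map_one_left := fun x => by simp
              prop' := fun t x hx => by
                have h1 := F.prop' t x hx
                have h2 := H.prop' t x hx
                simp_all }⟩
  inv_mem' := by
    rintro a ⟨F⟩
    exact ⟨{  toContinuousMap := F.toContinuousMap⁻¹
              map_zero_left := fun x => by simp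
              map_one_left := fun x => by simp
              prop' := fun t x hx => by
                have h1 := F.prop' t x hx
                simp_all }⟩

instance nullhomotopicLoops_normal (G : Type*) [TopologicalSpace G] [Group G]
    [IsTopologicalGroup G] : (nullhomotopicLoops G).Normal where
  conj_mem := by
    rintro a ⟨F⟩ g
    exact ⟨{  toContinuousMap := (g.1.comp ⟨Prod.snd, continuous_snd⟩) * F.toContinuousMap *
                (g.1.comp ⟨Prod.snd, continuous_snd⟩)⁻¹
              map_zero_left := fun x => by simp
              map_one_left := fun x => by simp
              prop' := fun t x hx => by
                have h1 := F.prop' t x hx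
                simp_all }⟩

/-- The universal covering group of `G` (for `G` a connected Lie group): homotopy classes, with
fixed endpoints, of paths that start at `1`, with the pointwise product and the quotient
topology.  The covering map is `[γ] ↦ γ 1`; its kernel is the fundamental group of `G`. -/
abbrev UniversalCoveringGroup (G : Type*) [TopologicalSpace G] [Group G]
    [IsTopologicalGroup G] : Type _ :=
  basedPaths G ⧸ nullhomotopicLoops G

instance universalCoveringGroup_isTopologicalGroup (G : Type*) [TopologicalSpace G] [Group G]
    [IsTopologicalGroup G] : IsTopologicalGroup (UniversalCoveringGroup G) :=
  QuotientGroup.instIsTopologicalGroup (nullhomotopicLoops G)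

end UniversalCover

end

/-!
# Centralizers of homomorphisms from coverings of `G₂₍₂₎` to the universal cover of `SO₀(3,4)`

Let `p` be the covering homomorphism of the universal covering group of `SO₀(3,4)`.  The centralizer
of `ρ₁(G)` is finite for two reasons: `p` has finite kernel, and `p` maps the centralizer into the
scalar matrices, that is, into `{1, -1}`, because `p ∘ ρ₁` acts irreducibly on `ℂ⁷`.

*Finite kernel* (`finite_ker_universalCoveringHom`).  A loop in `O(3,4)` is deformed until it fixes
one basis vector after another.  A deformation of the path `s ↦ γ(s) eᵢ` within its quadric lifts to
a deformation of the loop `γ`, because a product of two reflections that depends continuously on `a`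
and `b` takes `a` to `b` (`exists_homotopic_of_move`).  Only two loops of rotations remain, one in a
plane of each sign, and each of them matters only modulo two turns, since a rotation of the plane
through a third direction reverses it.  So there are at most four homotopy classes
(`exists_homotopic_parity`).

*Root subgroups.*  The automorphism group of the split Cayley algebra contains `SL₃(ℝ)` and two
families of unipotent elements `uAut w` and `lAut w` with `w : ℝ³`.  Explicit one-parameter subgroups
among them satisfy the relations of the root subgroups and the torus of a split group of type `G₂`
(`SplitCayley.autPinning`).  Their parameter spaces are simply connected and the relations have
connected parameter spaces, so that subgroups and relations lift to `G`
(`SplitCayley.exists_lift_autPinning`).  Every automorphism near `1` is a product of small elements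
of these families: two unipotent factors bring the image of the idempotent `(1, 0, 0, 0)` back, and
its stabiliser is `SL₃(ℝ)`.  Hence the lifts generate the connected group `G`
(`SplitCayley.eq_top_of_pinning_mem`).

*Irreducibility.*  Continuous one-parameter groups of operators on `ℂ⁷` are differentiable, and the
relations differentiate to those of the Chevalley generators of the Lie algebra of type `G₂`
(`G2Pinning.rep`).  By the theory of weights such operators vanish on a space of dimension at most
six.  If an operator `z` commutes with all of them and is no scalar, then an eigenspace of `z` and
the range of `z - λ` both have dimension at most six, and the operators vanish on both, hence
altogether (`G2Rep.exists_eq_smul_of_commute`).  If the operators do vanish, then `p ∘ ρ₁` is trivial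
on the generators of `G`, which `ρ₁` therefore maps to the finite kernel of `p`; as the generators
lie in divisible one-parameter groups, `ρ₁` is trivial (`eq_one_of_coveringAction_eq_one`), contrary
to the hypothesis.
-/


/-! ### Representations of dimension at most six -/

/-- First coordinates of the positive coroots of `G₂`, in the basis of the two simple coroots of
its subsystem `A₂` of long roots.  The first three indices are the long positive roots. -/
def g2Coroot₁ : Fin 6 → ℤ := ![1, 0, 1, 2, -1, 1]

/-- Second coordinates of the positive coroots of `G₂`; see `g2Coroot₁`. -/
def g2Coroot₂ : Fin 6 → ℤ := ![0, 1, 1, 1, 1, 2]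

/-- The values of the positive roots of `G₂` on the first simple coroot of `A₂`. -/
def g2Root₁ : Fin 6 → ℤ := ![2, -1, 1, 1, -1, 0]

/-- The values of the positive roots of `G₂` on the second simple coroot of `A₂`. -/
def g2Root₂ : Fin 6 → ℤ := ![-1, 2, 1, 0, 1, 1]

/-- Operators on `V` that satisfy the relations of the Chevalley generators of the Lie algebra
of type `G₂` within each root `SL₂` and between the root vectors and the torus.  The commutator
relations between root vectors of independent roots are not recorded. -/
structure G2Rep (V : Type*) [AddCommGroup V] [Module ℂ V] where
  /-- The positive root vectors. -/
  E : Fin 6 → Module.End ℂ V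
  /-- The negative root vectors. -/
  F : Fin 6 → Module.End ℂ V
  /-- The first basis vector of the torus. -/
  H₁ : Module.End ℂ V
  /-- The second basis vector of the torus. -/
  H₂ : Module.End ℂ V
  comm : H₁ * H₂ = H₂ * H₁
  EF : ∀ k, E k * F k - F k * E k = (g2Coroot₁ k : ℂ) • H₁ + (g2Coroot₂ k : ℂ) • H₂
  HE₁ : ∀ k, H₁ * E k - E k * H₁ = (g2Root₁ k : ℂ) • E k
  HE₂ : ∀ k, H₂ * E k - E k * H₂ = (g2Root₂ k : ℂ) • E k
  HF₁ : ∀ k, H₁ * F k - F k * H₁ = -(g2Root₁ k : ℂ) • F k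
  HF₂ : ∀ k, H₂ * F k - F k * H₂ = -(g2Root₂ k : ℂ) • F k

theorem g2_root_coroot (k : Fin 6) :
    g2Coroot₁ k * g2Root₁ k + g2Coroot₂ k * g2Root₂ k = 2 := by
  fin_cases k <;> rfl

theorem g2_height_pos (k : Fin 6) : 0 < 2 * g2Root₁ k + 3 * g2Root₂ k := by
  fin_cases k <;> decide

/-- In a finite dimensional representation of `𝔰𝔩₂`, a vector killed by the raising operator has
a natural number as its weight. -/
theorem exists_nat_of_sl2 {V : Type*} [AddCommGroup V] [Module ℂ V] [FiniteDimensional ℂ V]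
    {h e f : Module.End ℂ V} (hef : e * f - f * e = h) (hhe : h * e - e * h = (2 : ℂ) • e)
    (hhf : h * f - f * h = -(2 : ℂ) • f) {v : V} (hv : v ≠ 0) {c : ℂ} (hc : h v = c • v)
    (hev : e v = 0) : ∃ n : ℕ, c = n := by
  let : LieRing (Module.End ℂ V) := LieRing.ofAssociativeRing
  by_cases h0 : h = 0
  · refine ⟨0, ?_⟩
    rw [h0, LinearMap.zero_apply] at hc
    simpa using (smul_eq_zero.1 hc.symm).resolve_right hv
  · have t : IsSl2Triple h e f :=
      { h_ne_zero := h0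
        lie_e_f := by rw [Ring.lie_def, hef]
        lie_h_e_nsmul := by rw [Ring.lie_def, hhe, ofNat_smul_eq_nsmul]
        lie_h_f_nsmul := by rw [Ring.lie_def, hhf, neg_smul, ofNat_smul_eq_nsmul] }
    have P : t.HasPrimitiveVectorWith v c :=
      { ne_zero := hv
        lie_h := by simpa using hc
        lie_e := by simpa using hev }
    exact P.exists_nat

theorem neg_commutator {A : Type*} [Ring A] [Algebra ℂ A] {h e : A} {a : ℂ}
    (he : h * e - e * h = a • e) : -h * e - e * -h = -a • e := by
  rw [neg_smul, ← he, neg_mul, mul_neg]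
  abel

namespace G2Rep

variable {V : Type*} [AddCommGroup V] [Module ℂ V] (ρ : G2Rep V)

/-- The operators with the roles of positive and negative roots exchanged. -/
def swap : G2Rep V where
  E := ρ.F
  F := ρ.E
  H₁ := -ρ.H₁
  H₂ := -ρ.H₂
  comm := by simp [ρ.comm]
  EF k := by
    have := ρ.EF k
    simp only [smul_neg, ← neg_add, ← this, neg_sub]
  HE₁ k := by simpa using neg_commutator (ρ.HF₁ k)
  HE₂ k := by simpa using neg_commutator (ρ.HF₂ k)
  HF₁ k := neg_commutator (ρ.HE₁ k)
  HF₂ k := neg_commutator (ρ.HE₂ k)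

/-- The coroot operator of the root `k`. -/
def H (k : Fin 6) : Module.End ℂ V :=
  (g2Coroot₁ k : ℂ) • ρ.H₁ + (g2Coroot₂ k : ℂ) • ρ.H₂

theorem H_E (k : Fin 6) : ρ.H k * ρ.E k - ρ.E k * ρ.H k = (2 : ℂ) • ρ.E k := by
  have h1 := ρ.HE₁ k
  have h2 := ρ.HE₂ k
  have h3 : ((g2Coroot₁ k : ℂ) * g2Root₁ k + g2Coroot₂ k * g2Root₂ k) = 2 := by
    exact_mod_cast g2_root_coroot k
  rw [H, ← h3, add_smul, mul_smul, mul_smul, ← h1, ← h2]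
  simp only [add_mul, mul_add, smul_mul_assoc, mul_smul_comm, smul_sub]
  abel

theorem H_F (k : Fin 6) : ρ.H k * ρ.F k - ρ.F k * ρ.H k = -(2 : ℂ) • ρ.F k := by
  have h1 := ρ.HF₁ k
  have h2 := ρ.HF₂ k
  have h3 : -(2 : ℂ) = ((g2Coroot₁ k : ℂ) * -g2Root₁ k + g2Coroot₂ k * -g2Root₂ k) := by
    have : ((g2Coroot₁ k : ℂ) * g2Root₁ k + g2Coroot₂ k * g2Root₂ k) = 2 := by
      exact_mod_cast g2_root_coroot k
    linear_combination this
  rw [H, h3, add_smul, mul_smul, mul_smul, ← h1, ← h2]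
  simp only [add_mul, mul_add, smul_mul_assoc, mul_smul_comm, smul_sub]
  abel

/-- If all the root vectors multiply to zero pairwise within each `SL₂`, they vanish. -/
theorem eq_zero_of_mul_eq_zero (k : Fin 6) (hEF : ρ.E k * ρ.F k = 0)
    (hFE : ρ.F k * ρ.E k = 0) : ρ.H k = 0 ∧ ρ.E k = 0 ∧ ρ.F k = 0 := by
  have h0 : ρ.H k = 0 := by
    have := ρ.EF k
    rw [hEF, hFE, sub_zero] at this
    exact this.symm
  have h1 := ρ.H_E k
  have h2 := ρ.H_F k
  rw [h0] at h1 h2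
  refine ⟨h0, ?_, ?_⟩
  · simpa using h1.symm
  · simpa using h2.symm

/-- `(m, n)` is a weight: the torus has a common eigenvector with eigenvalues `m` and `n`. -/
def IsWeight (m n : ℤ) : Prop :=
  ∃ v : V, v ≠ 0 ∧ ρ.H₁ v = (m : ℂ) • v ∧ ρ.H₂ v = (n : ℂ) • v

theorem H_apply {v : V} {m n : ℂ} (h₁ : ρ.H₁ v = m • v) (h₂ : ρ.H₂ v = n • v) (k : Fin 6) :
    ρ.H k v = (g2Coroot₁ k * m + g2Coroot₂ k * n : ℂ) • v := by
  simp only [H, LinearMap.add_apply, LinearMap.smul_apply, h₁, h₂, smul_smul, add_smul]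

theorem H_E_apply {h e : Module.End ℂ V} {a m : ℂ} (hh : h * e - e * h = a • e) {v : V}
    (hv : h v = m • v) : h (e v) = (m + a) • e v := by
  have := LinearMap.congr_fun hh v
  simp only [LinearMap.sub_apply, Module.End.mul_apply, LinearMap.smul_apply, hv, map_smul] at this
  rw [add_smul, ← this]
  abel

/-- A weight whose pairing with a positive coroot is positive can be lowered by the root. -/
theorem IsWeight.sub_root [FiniteDimensional ℂ V] {m n : ℤ} (h : ρ.IsWeight m n) (k : Fin 6)
    (hk : 0 < g2Coroot₁ k * m + g2Coroot₂ k * n) :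
    ρ.IsWeight (m - g2Root₁ k) (n - g2Root₂ k) := by
  obtain ⟨v, hv, h₁, h₂⟩ := h
  refine ⟨ρ.F k v, fun h0 => ?_, ?_, ?_⟩
  · have key := exists_nat_of_sl2 (h := -ρ.H k) (e := ρ.F k) (f := ρ.E k)
      (by rw [H, ← ρ.EF k]; abel)
      (by simpa using neg_commutator (ρ.H_F k))
      (neg_commutator (ρ.H_E k))
      hv (c := -(g2Coroot₁ k * m + g2Coroot₂ k * n : ℂ))
      (by rw [LinearMap.neg_apply, ρ.H_apply h₁ h₂, neg_smul]) h0
    obtain ⟨N, hN⟩ := key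
    have : -(g2Coroot₁ k * m + g2Coroot₂ k * n) = (N : ℤ) := by exact_mod_cast hN
    omega
  · rw [H_E_apply (ρ.HF₁ k) h₁]; push_cast; rw [sub_eq_add_neg]
  · rw [H_E_apply (ρ.HF₂ k) h₂]; push_cast; rw [sub_eq_add_neg]

/-- Distinct weights have independent weight vectors, so there are at most `dim V` of them. -/
theorem card_weights_le [FiniteDimensional ℂ V] (s : Finset (ℤ × ℤ))
    (hs : ∀ p ∈ s, ρ.IsWeight p.1 p.2) : s.card ≤ Module.finrank ℂ V := by
  choose v hv h₁ h₂ using hs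
  -- `H₁ + i H₂` separates the weights.
  have hinj : Function.Injective (fun p : s => ((p.1.1 : ℂ) + p.1.2 * Complex.I)) := by
    rintro ⟨p, hp⟩ ⟨q, hq⟩ h
    have e1 := congrArg Complex.re h
    have e2 := congrArg Complex.im h
    simp at e1 e2
    exact Subtype.ext (Prod.ext e1 e2)
  have li := Module.End.eigenvectors_linearIndependent' (ρ.H₁ + Complex.I • ρ.H₂)
    (fun p : s => ((p.1.1 : ℂ) + p.1.2 * Complex.I)) hinj (fun p => v p.1 p.2) (fun p => by
      rw [Module.End.hasEigenvector_iff, Module.End.mem_eigenspace_iff]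
      refine ⟨?_, hv _ _⟩
      rw [LinearMap.add_apply, LinearMap.smul_apply, h₁, h₂, smul_smul, ← add_smul, mul_comm])
  simpa using li.fintype_card_le_finrank

/-- The height operator: every positive root vector strictly raises its eigenvalues. -/
def T : Module.End ℂ V := (2 : ℂ) • ρ.H₁ + (3 : ℂ) • ρ.H₂

theorem T_E (k : Fin 6) : ρ.T * ρ.E k - ρ.E k * ρ.T =
    ((2 * g2Root₁ k + 3 * g2Root₂ k : ℤ) : ℂ) • ρ.E k := by
  have h1 := ρ.HE₁ k
  have h2 := ρ.HE₂ k
  push_cast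
  rw [T, add_smul, mul_smul, mul_smul, ← h1, ← h2]
  simp only [add_mul, mul_add, smul_mul_assoc, mul_smul_comm, smul_sub]
  abel

/-- The height operator has an eigenvalue of nonzero real part as soon as one positive root vector
does not vanish: an eigenvalue on the range of `E k` and the one just below it are both
eigenvalues, and their real parts differ. -/
theorem exists_T_eigenvalue [FiniteDimensional ℂ V] {k : Fin 6} (hE : ρ.E k ≠ 0) :
    ∃ μ : ℂ, ρ.T.HasEigenvalue μ ∧ μ.re ≠ 0 := by
  set d : ℤ := 2 * g2Root₁ k + 3 * g2Root₂ k with hd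
  have hdpos : 0 < d := g2_height_pos k
  have hTE := ρ.T_E k
  rw [← hd] at hTE
  have hTEa : ∀ x, ρ.T (ρ.E k x) = ρ.E k (ρ.T x) + (d : ℂ) • ρ.E k x := fun x => by
    have := LinearMap.congr_fun hTE x
    simp only [LinearMap.sub_apply, Module.End.mul_apply, LinearMap.smul_apply] at this
    rw [← this]; abel
  have hinv : ∀ y ∈ LinearMap.range (ρ.E k), ρ.T y ∈ LinearMap.range (ρ.E k) := by
    rintro _ ⟨x, rfl⟩
    exact ⟨ρ.T x + (d : ℂ) • x, by rw [hTEa, map_add, map_smul]⟩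
  have : Nontrivial (LinearMap.range (ρ.E k)) := by
    rw [Submodule.nontrivial_iff_ne_bot]
    exact fun h => hE (LinearMap.range_eq_bot.1 h)
  obtain ⟨μ, hμ⟩ := Module.End.exists_eigenvalue (ρ.T.restrict hinv)
  obtain ⟨⟨y, x, hxy⟩, hy⟩ := hμ.exists_hasEigenvector
  have hy0 : y ≠ 0 := fun h => hy.2 (Subtype.ext h)
  have hy1 : ρ.T y = μ • y := congrArg Subtype.val hy.apply_eq_smul
  have hμT : ρ.T.HasEigenvalue μ :=
    Module.End.hasEigenvalue_of_hasEigenvector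
      ⟨Module.End.mem_eigenspace_iff.2 hy1, hy0⟩
  by_cases hre : μ.re = 0
  swap
  · exact ⟨μ, hμT, hre⟩
  refine ⟨μ - d, ?_, by simp [hre, hdpos.ne']⟩
  -- `T + d - μ` preserves `ker (E k)`; were it injective on `V`, it would be onto there.
  set S : Module.End ℂ V := ρ.T - algebraMap ℂ (Module.End ℂ V) (μ - d) with hS
  have hSa : ∀ z, S z = ρ.T z - (μ - d) • z := fun z => by
    rw [hS, LinearMap.sub_apply, Module.algebraMap_end_apply]
  have hSE : ∀ z, ρ.E k (S z) = ρ.T (ρ.E k z) - μ • ρ.E k z := fun z => by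
    rw [hSa, map_sub, map_smul, hTEa, sub_smul]; abel
  by_contra hne
  have hinj : Function.Injective S := by
    rw [← LinearMap.ker_eq_bot]
    have : ρ.T.eigenspace (μ - d) = ⊥ := by
      rwa [Module.End.hasEigenvalue_iff, not_not] at hne
    rwa [Module.End.eigenspace_def] at this
  have hker : ∀ z ∈ LinearMap.ker (ρ.E k), S z ∈ LinearMap.ker (ρ.E k) := fun z hz => by
    rw [LinearMap.mem_ker] at hz ⊢
    rw [hSE, hz, map_zero, smul_zero, sub_zero]
  have hinj' : Function.Injective (S.restrict hker) := fun a b hab =>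
    Subtype.ext (hinj (congrArg Subtype.val hab))
  have hsurj := LinearMap.injective_iff_surjective.1 hinj'
  have hSx : S x ∈ LinearMap.ker (ρ.E k) := by
    rw [LinearMap.mem_ker, hSE, hxy, hy1, sub_self]
  obtain ⟨⟨x', hx'⟩, hxx⟩ := hsurj ⟨S x, hSx⟩
  have : x' = x := hinj (congrArg Subtype.val hxx)
  rw [this, LinearMap.mem_ker, hxy] at hx'
  exact hy0 hx'

/-- An eigenvalue of the height operator of positive real part leads to a highest weight, and the
highest weight `(m, n)` is dominant and nonzero. -/
theorem exists_dominant_weight [FiniteDimensional ℂ V] {μ : ℂ} (hμ : ρ.T.HasEigenvalue μ)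
    (hre : 0 < μ.re) : ∃ m n : ℤ, ρ.IsWeight m n ∧ 0 ≤ m ∧ m ≤ n ∧ 0 < n := by
  have hfin : {μ | ρ.T.HasEigenvalue μ}.Finite := ρ.T.finite_hasEigenvalue
  obtain ⟨ν, hν, hmax⟩ := hfin.exists_maximalFor Complex.re _ ⟨μ, hμ⟩
  have hν' : 0 < ν.re := by
    rcases le_total ν.re μ.re with h | h
    · exact hre.trans_le (hmax hμ h)
    · exact hre.trans_le h
  have hTH : Commute ρ.T ρ.H₁ := by
    change ρ.T * ρ.H₁ = ρ.H₁ * ρ.T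
    rw [T, add_mul, mul_add, smul_mul_assoc, smul_mul_assoc, mul_smul_comm, mul_smul_comm,
      ρ.comm]
  have hinv : ∀ y ∈ ρ.T.eigenspace ν, ρ.H₁ y ∈ ρ.T.eigenspace ν := fun y hy => by
    rw [Module.End.mem_eigenspace_iff] at hy ⊢
    rw [← Module.End.mul_apply, hTH.eq, Module.End.mul_apply, hy, map_smul]
  have : Nontrivial (ρ.T.eigenspace ν) := by
    rw [Submodule.nontrivial_iff_ne_bot]
    exact hν
  obtain ⟨m, hm⟩ := Module.End.exists_eigenvalue (ρ.H₁.restrict hinv)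
  obtain ⟨⟨v, hv⟩, hvm⟩ := hm.exists_hasEigenvector
  have hv0 : v ≠ 0 := fun h => hvm.2 (Subtype.ext h)
  have h₁ : ρ.H₁ v = m • v := congrArg Subtype.val hvm.apply_eq_smul
  rw [Module.End.mem_eigenspace_iff] at hv
  have h₂ : ρ.H₂ v = ((ν - 2 * m) / 3) • v := by
    have h3 : (3 : ℂ) • ρ.H₂ v = (ν - 2 * m) • v := by
      rw [T, LinearMap.add_apply, LinearMap.smul_apply, LinearMap.smul_apply, h₁] at hv
      rw [sub_smul, ← hv, mul_smul]; abel
    rw [div_eq_inv_mul, mul_smul, ← h3, smul_smul, inv_mul_cancel₀ (by norm_num), one_smul]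
  set n : ℂ := (ν - 2 * m) / 3 with hn
  have hE : ∀ k, ρ.E k v = 0 := fun k => by
    by_contra h0
    have h := H_E_apply (ρ.T_E k) hv
    have h2 : ρ.T.HasEigenvalue (ν + ((2 * g2Root₁ k + 3 * g2Root₂ k : ℤ) : ℂ)) :=
      Module.End.hasEigenvalue_of_hasEigenvector ⟨Module.End.mem_eigenspace_iff.2 h, h0⟩
    have h3 : (0 : ℝ) < ((2 * g2Root₁ k + 3 * g2Root₂ k : ℤ) : ℝ) := by
      exact_mod_cast g2_height_pos k
    have h4 := hmax h2 (by rw [Complex.add_re, Complex.intCast_re]; linarith)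
    simp only [Complex.add_re, Complex.intCast_re] at h4
    linarith
  have hnat : ∀ k, ∃ N : ℕ, (g2Coroot₁ k * m + g2Coroot₂ k * n : ℂ) = N := fun k =>
    exists_nat_of_sl2 (ρ.EF k) (ρ.H_E k) (ρ.H_F k) hv0 (ρ.H_apply h₁ h₂ k) (hE k)
  obtain ⟨a, ha⟩ := hnat 0
  obtain ⟨b, hb⟩ := hnat 1
  obtain ⟨c, hc⟩ := hnat 4
  simp [g2Coroot₁, g2Coroot₂] at ha hb hc
  have hcb : c + a = b := by
    rw [ha, hb] at hc
    have : (b : ℂ) = c + a := by rw [← hc]; ring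
    exact_mod_cast this.symm
  refine ⟨a, b, ⟨v, hv0, by simpa [ha] using h₁, by simpa [hb] using h₂⟩, by omega, by omega, ?_⟩
  by_contra hb0
  have hb00 : b = 0 := by omega
  have ha00 : a = 0 := by omega
  rw [hb00] at hb; rw [ha00] at ha
  rw [ha, hb] at hn
  have : ν = 0 := by
    simpa using hn.symm
  rw [this] at hν'
  simp at hν'

/-- A nonzero dominant weight has at least seven weights below it. -/
theorem seven_le_finrank_of_dominant [FiniteDimensional ℂ V] {m n : ℤ} (h : ρ.IsWeight m n)
    (hm : 0 ≤ m) (hmn : m ≤ n) (hn : 0 < n) : 7 ≤ Module.finrank ℂ V := by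
  have step := fun {a b : ℤ} (h : ρ.IsWeight a b) (k : Fin 6) => h.sub_root ρ k
  have w1 := step h 1 (by simp [g2Coroot₁, g2Coroot₂]; omega)
  have w2 := step h 2 (by simp [g2Coroot₁, g2Coroot₂]; omega)
  have w3 := step h 3 (by simp [g2Coroot₁, g2Coroot₂]; omega)
  have w5 := step h 5 (by simp [g2Coroot₁, g2Coroot₂]; omega)
  simp only [g2Root₁, g2Root₂] at w1 w2 w3 w5
  simp at w1 w2 w3 w5
  rcases hm.lt_or_eq with hm0 | hm0
  · have w0 := step h 0 (by simp [g2Coroot₁, g2Coroot₂]; omega)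
    simp [g2Root₁, g2Root₂] at w0
    rcases hmn.lt_or_eq with hlt | heq
    · have w4 := step h 4 (by simp [g2Coroot₁, g2Coroot₂]; omega)
      simp [g2Root₁, g2Root₂] at w4
      refine (Nat.le_of_eq ?_).trans (ρ.card_weights_le {(m, n), (m - 2, n + 1), (m + 1, n - 2),
        (m - 1, n - 1), (m - 1, n), (m + 1, n - 1), (m, n - 1)} ?_)
      · repeat rw [Finset.card_insert_of_notMem (by
          simp only [Finset.mem_insert, Finset.mem_singleton, Prod.mk.injEq]; omega)]
        rw [Finset.card_singleton]
      · simp only [Finset.mem_insert, Finset.mem_singleton]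
        rintro p (rfl | rfl | rfl | rfl | rfl | rfl | rfl) <;> assumption
    · -- a multiple of the highest long root
      have w6 := step w0 5 (by simp [g2Coroot₁, g2Coroot₂]; omega)
      simp [g2Root₁, g2Root₂] at w6
      refine (Nat.le_of_eq ?_).trans (ρ.card_weights_le {(m, n), (m - 2, n + 1), (m + 1, n - 2),
        (m - 1, n - 1), (m - 1, n), (m, n - 1), (m - 2, n)} ?_)
      · repeat rw [Finset.card_insert_of_notMem (by
          simp only [Finset.mem_insert, Finset.mem_singleton, Prod.mk.injEq]; omega)]
        rw [Finset.card_singleton]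
      · simp only [Finset.mem_insert, Finset.mem_singleton]
        rintro p (rfl | rfl | rfl | rfl | rfl | rfl | rfl) <;> assumption
  · -- a multiple of the highest short root
    have w4 := step h 4 (by simp [g2Coroot₁, g2Coroot₂]; omega)
    have w6 := step w2 4 (by simp [g2Coroot₁, g2Coroot₂]; omega)
    simp [g2Root₁, g2Root₂] at w4 w6
    refine (Nat.le_of_eq ?_).trans (ρ.card_weights_le {(m, n), (m + 1, n - 2),
    (m - 1, n - 1), (m - 1, n), (m + 1, n - 1), (m, n - 1), (m, n - 1 - 1)} ?_)
    · repeat rw [Finset.card_insert_of_notMem (by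
        simp only [Finset.mem_insert, Finset.mem_singleton, Prod.mk.injEq]; omega)]
      rw [Finset.card_singleton]
    · simp only [Finset.mem_insert, Finset.mem_singleton]
      rintro p (rfl | rfl | rfl | rfl | rfl | rfl | rfl) <;> assumption

/-- The root vectors vanish in dimension less than seven. -/
theorem eq_zero_of_finrank_lt [FiniteDimensional ℂ V] (h : Module.finrank ℂ V < 7) (k : Fin 6) :
    ρ.E k = 0 ∧ ρ.F k = 0 := by
  have hpos : ∀ τ : G2Rep V, ∀ μ : ℂ, τ.T.HasEigenvalue μ → ¬ 0 < μ.re := fun τ μ hμ hre => by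
    obtain ⟨m, n, hw, hm, hmn, hn⟩ := τ.exists_dominant_weight hμ hre
    exact (τ.seven_le_finrank_of_dominant hw hm hmn hn).not_gt h
  have hE : ρ.E k = 0 := by
    by_contra hE
    obtain ⟨μ, hμ, hre⟩ := ρ.exists_T_eigenvalue hE
    rcases hre.lt_or_gt with hlt | hgt
    · -- negative eigenvalues become positive after exchanging positive and negative roots
      refine hpos ρ.swap (-μ) ?_ (by simpa using hlt)
      obtain ⟨v, hv⟩ := hμ.exists_hasEigenvector
      refine Module.End.hasEigenvalue_of_hasEigenvector (x := v)
        ⟨Module.End.mem_eigenspace_iff.2 ?_, hv.2⟩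
      have hT : ρ.swap.T = -ρ.T := by
        simp only [T, swap, smul_neg, neg_add]
      rw [hT, LinearMap.neg_apply, hv.apply_eq_smul, neg_smul]
    · exact hpos ρ μ hμ hgt
  exact (ρ.eq_zero_of_mul_eq_zero k (by rw [hE, zero_mul]) (by rw [hE, mul_zero])).2

/-- The operators induced on an invariant subspace. -/
def restrict (W : Submodule ℂ V) (hE : ∀ k, ∀ x ∈ W, ρ.E k x ∈ W)
    (hF : ∀ k, ∀ x ∈ W, ρ.F k x ∈ W) (h₁ : ∀ x ∈ W, ρ.H₁ x ∈ W) (h₂ : ∀ x ∈ W, ρ.H₂ x ∈ W) :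
    G2Rep W where
  E k := (ρ.E k).restrict (hE k)
  F k := (ρ.F k).restrict (hF k)
  H₁ := ρ.H₁.restrict h₁
  H₂ := ρ.H₂.restrict h₂
  comm := LinearMap.ext fun x => Subtype.ext (LinearMap.congr_fun ρ.comm x)
  EF k := LinearMap.ext fun x => Subtype.ext (LinearMap.congr_fun (ρ.EF k) x)
  HE₁ k := LinearMap.ext fun x => Subtype.ext (LinearMap.congr_fun (ρ.HE₁ k) x)
  HE₂ k := LinearMap.ext fun x => Subtype.ext (LinearMap.congr_fun (ρ.HE₂ k) x)
  HF₁ k := LinearMap.ext fun x => Subtype.ext (LinearMap.congr_fun (ρ.HF₁ k) x)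
  HF₂ k := LinearMap.ext fun x => Subtype.ext (LinearMap.congr_fun (ρ.HF₂ k) x)

/-- Schur's lemma in dimension seven: an operator that commutes with a nontrivial representation
is a scalar.  Otherwise an eigenspace `W` and the range of `z - λ` both have dimension at most six,
so that the root vectors vanish on both, whence all their products vanish. -/
theorem exists_eq_smul_of_commute [FiniteDimensional ℂ V] (hV : Module.finrank ℂ V = 7)
    (hne : ∃ k, ¬ (ρ.H k = 0 ∧ ρ.E k = 0 ∧ ρ.F k = 0)) (z : Module.End ℂ V)
    (hE : ∀ k, Commute z (ρ.E k)) (hF : ∀ k, Commute z (ρ.F k))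
    (h₁ : Commute z ρ.H₁) (h₂ : Commute z ρ.H₂) :
    ∃ c : ℂ, z = algebraMap ℂ (Module.End ℂ V) c := by
  have : Nontrivial V := Module.nontrivial_of_finrank_pos (R := ℂ) (by omega)
  obtain ⟨c, hc⟩ := Module.End.exists_eigenvalue z
  set S : Module.End ℂ V := z - algebraMap ℂ (Module.End ℂ V) c with hS
  refine ⟨c, ?_⟩
  by_contra hzc
  have hS0 : S ≠ 0 := fun h => hzc (sub_eq_zero.1 h)
  have hcomm : ∀ y : Module.End ℂ V, Commute z y → ∀ x, S (y x) = y (S x) := fun y hy x => by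
    have : Commute S y := hy.sub_left (Algebra.commutes c y)
    exact LinearMap.congr_fun this.eq x
  have hker : ∀ y : Module.End ℂ V, Commute z y → ∀ x ∈ LinearMap.ker S, y x ∈ LinearMap.ker S :=
    fun y hy x hx => by rw [LinearMap.mem_ker] at hx ⊢; rw [hcomm y hy, hx, map_zero]
  have hran : ∀ y : Module.End ℂ V, Commute z y →
      ∀ x ∈ LinearMap.range S, y x ∈ LinearMap.range S := by
    rintro y hy _ ⟨x, rfl⟩
    exact ⟨y x, hcomm y hy x⟩
  have hdim := LinearMap.finrank_range_add_finrank_ker S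
  have hk : 0 < Module.finrank ℂ (LinearMap.ker S) := by
    rw [Module.finrank_pos_iff, Submodule.nontrivial_iff_ne_bot]
    exact (Module.End.eigenspace_def (f := z) (μ := c)) ▸ hc
  have hr : 0 < Module.finrank ℂ (LinearMap.range S) := by
    rw [Module.finrank_pos_iff, Submodule.nontrivial_iff_ne_bot]
    exact fun h => hS0 (LinearMap.range_eq_bot.1 h)
  let ρK := ρ.restrict (LinearMap.ker S) (fun k => hker _ (hE k)) (fun k => hker _ (hF k))
    (hker _ h₁) (hker _ h₂)
  let ρR := ρ.restrict (LinearMap.range S) (fun k => hran _ (hE k)) (fun k => hran _ (hF k))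
    (hran _ h₁) (hran _ h₂)
  obtain ⟨k, hk0⟩ := hne
  have hK := ρK.eq_zero_of_finrank_lt (by omega) k
  have hR := ρR.eq_zero_of_finrank_lt (by omega) k
  have hKE : ∀ x ∈ LinearMap.ker S, ρ.E k x = 0 := fun x hx =>
    congrArg Subtype.val (LinearMap.congr_fun hK.1 ⟨x, hx⟩)
  have hKF : ∀ x ∈ LinearMap.ker S, ρ.F k x = 0 := fun x hx =>
    congrArg Subtype.val (LinearMap.congr_fun hK.2 ⟨x, hx⟩)
  have hRE : ∀ x, ρ.E k (S x) = 0 := fun x =>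
    congrArg Subtype.val (LinearMap.congr_fun hR.1 ⟨S x, ⟨x, rfl⟩⟩)
  have hRF : ∀ x, ρ.F k (S x) = 0 := fun x =>
    congrArg Subtype.val (LinearMap.congr_fun hR.2 ⟨S x, ⟨x, rfl⟩⟩)
  refine hk0 (ρ.eq_zero_of_mul_eq_zero k ?_ ?_)
  · exact LinearMap.ext fun x => hKE _ (by rw [LinearMap.mem_ker, hcomm _ (hF k), hRF])
  · exact LinearMap.ext fun x => hKF _ (by rw [LinearMap.mem_ker, hcomm _ (hE k), hRE])

end G2Rep

/-! ### Loops in `O(3,4)` -/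

/-- The matrix of the quadratic form of signature `(3,4)`. -/
abbrev J34 : Matrix (Fin 3 ⊕ Fin 4) (Fin 3 ⊕ Fin 4) ℝ :=
  LieAlgebra.Orthogonal.indefiniteDiagonal (Fin 3) (Fin 4) ℝ

/-- The group `O(3,4)`, as a set of matrices. -/
def O34 : Set (Matrix (Fin 3 ⊕ Fin 4) (Fin 3 ⊕ Fin 4) ℝ) := {A | A.transpose * J34 * A = J34}

/-- The bilinear form of signature `(3,4)`. -/
noncomputable def form34 : LinearMap.BilinForm ℝ (Fin 3 ⊕ Fin 4 → ℝ) := Matrix.toBilin' J34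

/-- The value of the form of signature `(3,4)` on the basis vectors. -/
def sgn34 : Fin 3 ⊕ Fin 4 → ℝ := Sum.elim (fun _ => 1) (fun _ => -1)

theorem form34_apply (x y : Fin 3 ⊕ Fin 4 → ℝ) : form34 x y = ∑ i, sgn34 i * (x i * y i) := by
  rw [form34, Matrix.toBilin'_apply', dotProduct]
  refine Finset.sum_congr rfl fun i _ => ?_
  rw [J34, LieAlgebra.Orthogonal.indefiniteDiagonal, Matrix.mulVec_diagonal]
  simp only [sgn34]; ring

theorem form34_comm (x y : Fin 3 ⊕ Fin 4 → ℝ) : form34 x y = form34 y x := by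
  simp only [form34_apply, mul_comm]

theorem form34_single (x : Fin 3 ⊕ Fin 4 → ℝ) (i : Fin 3 ⊕ Fin 4) :
    form34 x (Pi.single i 1) = sgn34 i * x i := by
  rw [form34_apply, Finset.sum_eq_single i]
  · simp
  · intro b _ hb; simp [hb]
  · simp

theorem sgn34_sq (i : Fin 3 ⊕ Fin 4) : sgn34 i * sgn34 i = 1 := by
  rcases i with i | i <;> simp [sgn34]

theorem sgn34_ne_zero (i : Fin 3 ⊕ Fin 4) : sgn34 i ≠ 0 := fun h => by
  have := sgn34_sq i
  simp [h] at this

theorem form34_single_single (i : Fin 3 ⊕ Fin 4) :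
    form34 (Pi.single i 1) (Pi.single i 1) = sgn34 i := by
  rw [form34_single]; simp

theorem mem_O34_iff (A : Matrix (Fin 3 ⊕ Fin 4) (Fin 3 ⊕ Fin 4) ℝ) :
    A ∈ O34 ↔ ∀ x y, form34 (A *ᵥ x) (A *ᵥ y) = form34 x y := by
  have key : ∀ x y, form34 (A *ᵥ x) (A *ᵥ y) = Matrix.toBilin' (A.transpose * J34 * A) x y := by
    intro x y
    rw [form34, Matrix.toBilin'_apply', Matrix.toBilin'_apply', Matrix.mulVec_mulVec,
      Matrix.dotProduct_mulVec, ← Matrix.vecMul_transpose, Matrix.vecMul_vecMul,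
      ← Matrix.dotProduct_mulVec, Matrix.mul_assoc]
  constructor
  · intro h x y
    have h' : A.transpose * J34 * A = J34 := h
    rw [key, h', form34]
  · intro h
    apply Matrix.toBilin'.injective
    exact LinearMap.ext₂ fun x y => by rw [← key, h, form34]

theorem mul_mem_O34 {A B : Matrix (Fin 3 ⊕ Fin 4) (Fin 3 ⊕ Fin 4) ℝ} (hA : A ∈ O34)
    (hB : B ∈ O34) : A * B ∈ O34 := by
  rw [mem_O34_iff] at *
  intro x y
  rw [← Matrix.mulVec_mulVec, ← Matrix.mulVec_mulVec, hA, hB]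

theorem toMatrix'_mem_O34 {f : (Fin 3 ⊕ Fin 4 → ℝ) →ₗ[ℝ] (Fin 3 ⊕ Fin 4 → ℝ)}
    (hf : ∀ x y, form34 (f x) (f y) = form34 x y) : LinearMap.toMatrix' f ∈ O34 := by
  rw [mem_O34_iff]
  intro x y
  rw [LinearMap.toMatrix'_mulVec, LinearMap.toMatrix'_mulVec, hf]

/-- The predicate that a continuous family of matrices is a loop at `1` in `O(3,4)`. -/
def IsO34Loop (γ : C(I, Matrix (Fin 3 ⊕ Fin 4) (Fin 3 ⊕ Fin 4) ℝ)) : Prop :=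
  (∀ s, γ s ∈ O34) ∧ γ 0 = 1 ∧ γ 1 = 1

/-- Homotopy of loops at `1` in `O(3,4)`. -/
def O34Homotopic (γ γ' : C(I, Matrix (Fin 3 ⊕ Fin 4) (Fin 3 ⊕ Fin 4) ℝ)) : Prop :=
  ContinuousMap.HomotopicWith γ γ' IsO34Loop

theorem O34Homotopic.of {γ γ' : C(I, Matrix (Fin 3 ⊕ Fin 4) (Fin 3 ⊕ Fin 4) ℝ)}
    (F : I × I → Matrix (Fin 3 ⊕ Fin 4) (Fin 3 ⊕ Fin 4) ℝ) (hF : Continuous F)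
    (h0 : ∀ s, F (0, s) = γ s) (h1 : ∀ s, F (1, s) = γ' s) (hmem : ∀ p, F p ∈ O34)
    (hs : ∀ t, F (t, 0) = 1 ∧ F (t, 1) = 1) : O34Homotopic γ γ' :=
  ⟨{ toFun := F
     continuous_toFun := hF
     map_zero_left := h0
     map_one_left := h1
     prop' := fun t => ⟨fun s => hmem (t, s), (hs t).1, (hs t).2⟩ }⟩

theorem O34Homotopic.mul {a b c d : C(I, Matrix (Fin 3 ⊕ Fin 4) (Fin 3 ⊕ Fin 4) ℝ)}
    (h : O34Homotopic a b) (h' : O34Homotopic c d) : O34Homotopic (a * c) (b * d) := by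
  obtain ⟨F⟩ := h
  obtain ⟨F'⟩ := h'
  refine O34Homotopic.of (fun p => F p * F' p) (F.continuous.matrix_mul F'.continuous)
    (fun s => by simp) (fun s => by simp) (fun p => ?_) (fun t => ?_)
  · exact mul_mem_O34 ((F.prop p.1).1 p.2) ((F'.prop p.1).1 p.2)
  · have h1 := (F.prop t).2
    have h2 := (F'.prop t).2
    constructor
    · have e1 := h1.1; have e2 := h2.1
      change F (t, 0) = 1 at e1; change F' (t, 0) = 1 at e2
      rw [e1, e2, one_mul]
    · have e1 := h1.2; have e2 := h2.2
      change F (t, 1) = 1 at e1; change F' (t, 1) = 1 at e2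
      rw [e1, e2, one_mul]

/-- For `a` and `b` with `form34 a a = form34 b b = q`, the isometry of `ℝ⁷` that takes `a` to `b`
and fixes the vectors orthogonal to both: the product of the reflections in `a` and `a + b`. -/
noncomputable def twoReflections (q : ℝ) (a b : Fin 3 ⊕ Fin 4 → ℝ) :
    (Fin 3 ⊕ Fin 4 → ℝ) →ₗ[ℝ] (Fin 3 ⊕ Fin 4 → ℝ) :=
  LinearMap.id - ((q + form34 a b)⁻¹ • form34 (a + b)).smulRight (a + b)
    + ((2 / q) • form34 a).smulRight b

theorem twoReflections_apply (q : ℝ) (a b x : Fin 3 ⊕ Fin 4 → ℝ) : twoReflections q a b x =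
    x - ((q + form34 a b)⁻¹ * (form34 a x + form34 b x)) • (a + b)
      + (2 / q * form34 a x) • b := by
  simp [twoReflections, mul_add]

section TwoReflections

variable {q : ℝ} {a b : Fin 3 ⊕ Fin 4 → ℝ}

theorem form34_twoReflections (hq : q ≠ 0) (ha : form34 a a = q) (hb : form34 b b = q)
    (hab : q + form34 a b ≠ 0) (x y : Fin 3 ⊕ Fin 4 → ℝ) :
    form34 (twoReflections q a b x) (twoReflections q a b y) = form34 x y := by
  simp only [twoReflections_apply, map_add, map_sub, map_smul, LinearMap.add_apply,
    LinearMap.sub_apply, LinearMap.smul_apply, smul_eq_mul, form34_comm x a, form34_comm x b,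
    form34_comm b a, ha, hb]
  field_simp
  ring

theorem twoReflections_self (hq : q ≠ 0) (ha : form34 a a = q) : twoReflections q a a = 1 := by
  refine LinearMap.ext fun x => ?_
  rw [twoReflections_apply, ha, ← two_smul ℝ a, smul_smul, Module.End.one_apply, sub_add,
    ← sub_smul]
  have : (q + q)⁻¹ * (form34 a x + form34 a x) * 2 - 2 / q * form34 a x = 0 := by
    field_simp; ring
  rw [this, zero_smul, sub_zero]

theorem twoReflections_left (hq : q ≠ 0) (ha : form34 a a = q) (hab : q + form34 a b ≠ 0) :
    twoReflections q a b a = b := by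
  rw [twoReflections_apply, ha, form34_comm b a, inv_mul_cancel₀ hab, div_mul_cancel₀ _ hq,
    one_smul, two_smul]
  abel

theorem twoReflections_fix {x : Fin 3 ⊕ Fin 4 → ℝ} (h1 : form34 a x = 0) (h2 : form34 b x = 0) :
    twoReflections q a b x = x := by
  rw [twoReflections_apply, h1, h2]; simp

end TwoReflections

theorem continuous_form34 {X : Type*} [TopologicalSpace X] {f g : X → (Fin 3 ⊕ Fin 4 → ℝ)}
    (hf : Continuous f) (hg : Continuous g) : Continuous fun x => form34 (f x) (g x) := by
  simp only [form34_apply]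
  fun_prop

theorem continuous_twoReflections {X : Type*} [TopologicalSpace X] {q : ℝ}
    {a b : X → (Fin 3 ⊕ Fin 4 → ℝ)} (ha : Continuous a) (hb : Continuous b)
    (hab : ∀ x, q + form34 (a x) (b x) ≠ 0) :
    Continuous fun x => LinearMap.toMatrix' (twoReflections q (a x) (b x)) := by
  refine continuous_matrix fun i j => ?_
  simp only [LinearMap.toMatrix'_apply, twoReflections_apply]
  have h1 : Continuous fun x => (q + form34 (a x) (b x))⁻¹ :=
    (continuous_const.add (continuous_form34 ha hb)).inv₀ hab
  have h2 := fun y : Fin 3 ⊕ Fin 4 → ℝ => continuous_form34 ha (continuous_const (y := y))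
  have h3 := fun y : Fin 3 ⊕ Fin 4 → ℝ => continuous_form34 hb (continuous_const (y := y))
  refine (continuous_apply i).comp ((continuous_const.sub ((h1.mul ((h2 _).add (h3 _))).smul
    (ha.add hb))).add ((continuous_const.mul (h2 _)).smul hb))

/-- A homotopy of the orbit path `s ↦ γ(s) eᵢ` within its quadric lifts to a homotopy of the loop
`γ`, provided that no vector becomes opposite to its initial position.  Basis vectors that stay
orthogonal to the orbit path remain fixed. -/
theorem exists_homotopic_of_move {γ : C(I, Matrix (Fin 3 ⊕ Fin 4) (Fin 3 ⊕ Fin 4) ℝ)}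
    (hγ : IsO34Loop γ) (i : Fin 3 ⊕ Fin 4) (v : I × I → (Fin 3 ⊕ Fin 4 → ℝ)) (hv : Continuous v)
    (hv0 : ∀ s, v (0, s) = γ s *ᵥ Pi.single i 1) (hvq : ∀ p, form34 (v p) (v p) = sgn34 i)
    (hne : ∀ t s, sgn34 i + form34 (v (0, s)) (v (t, s)) ≠ 0)
    (hends : ∀ t, v (t, 0) = Pi.single i 1 ∧ v (t, 1) = Pi.single i 1) :
    ∃ γ', IsO34Loop γ' ∧ O34Homotopic γ γ' ∧ (∀ s, γ' s *ᵥ Pi.single i 1 = v (1, s)) ∧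
      ∀ j, j ≠ i → (∀ s, γ s *ᵥ Pi.single j 1 = Pi.single j 1) → (∀ s, v (1, s) j = 0) →
        ∀ s, γ' s *ᵥ Pi.single j 1 = Pi.single j 1 := by
  have hq := sgn34_ne_zero i
  have hv0c : Continuous fun p : I × I => v (0, p.2) := by fun_prop
  set F : I × I → Matrix (Fin 3 ⊕ Fin 4) (Fin 3 ⊕ Fin 4) ℝ := fun p =>
    LinearMap.toMatrix' (twoReflections (sgn34 i) (v (0, p.2)) (v p)) * γ p.2 with hF
  have hFc : Continuous F :=
    (continuous_twoReflections hv0c hv fun p => hne p.1 p.2).matrix_mul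
      (γ.continuous.comp continuous_snd)
  have hmem : ∀ p, F p ∈ O34 := fun p => mul_mem_O34
    (toMatrix'_mem_O34 (form34_twoReflections hq (hvq _) (hvq _) (hne _ _))) (hγ.1 _)
  have hends' : ∀ t, F (t, 0) = 1 ∧ F (t, 1) = 1 := fun t => by
    simp only [hF, (hends t).1, (hends 0).1, (hends t).2, (hends 0).2, hγ.2.1, hγ.2.2,
      twoReflections_self hq (form34_single_single i), LinearMap.toMatrix'_one, mul_one, and_self]
  refine ⟨⟨fun s => F (1, s), by fun_prop⟩, ⟨fun s => hmem _, (hends' 1).1, (hends' 1).2⟩,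
    O34Homotopic.of F hFc (fun s => ?_) (fun s => rfl) hmem hends', fun s => ?_, ?_⟩
  · simp only [hF, twoReflections_self hq (hvq _), LinearMap.toMatrix'_one, one_mul]
  · simp only [hF, ContinuousMap.coe_mk]
    rw [← Matrix.mulVec_mulVec, ← hv0, LinearMap.toMatrix'_mulVec,
      twoReflections_left hq (hvq _) (hne _ _)]
  · intro j hj hfix hvj s
    simp only [hF, ContinuousMap.coe_mk]
    rw [← Matrix.mulVec_mulVec, hfix, LinearMap.toMatrix'_mulVec]
    refine twoReflections_fix ?_ ?_
    · rw [hv0]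
      conv_lhs => rw [← hfix s]
      rw [(mem_O34_iff _).1 (hγ.1 s), form34_single]
      simp [hj]
    · rw [form34_single, hvj, mul_zero]

/-- If `γ` fixes `eⱼ`, the orbit of any other basis vector stays orthogonal to `eⱼ`. -/
theorem mulVec_single_apply_eq_zero {A : Matrix (Fin 3 ⊕ Fin 4) (Fin 3 ⊕ Fin 4) ℝ} (hA : A ∈ O34)
    {i j : Fin 3 ⊕ Fin 4} (hij : j ≠ i) (hfix : A *ᵥ Pi.single j 1 = Pi.single j 1) :
    (A *ᵥ Pi.single i 1) j = 0 := by
  have h := (mem_O34_iff _).1 hA (Pi.single i 1) (Pi.single j 1)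
  rw [hfix, form34_single, form34_single] at h
  have := mul_left_cancel₀ (sgn34_ne_zero j) h
  rw [this]; simp [hij]

theorem form34_self (x : Fin 3 ⊕ Fin 4 → ℝ) :
    form34 x x = ∑ j, x (Sum.inl j) ^ 2 - ∑ j, x (Sum.inr j) ^ 2 := by
  rw [form34_apply, Fintype.sum_sum_type]
  simp [sgn34, sq, sub_eq_add_neg]

/-- The orbit path of a positive basis vector can be moved into the positive coordinate subspace:
scale down its negative part, and correct the length of its positive part. -/
theorem exists_homotopic_boost {γ : C(I, Matrix (Fin 3 ⊕ Fin 4) (Fin 3 ⊕ Fin 4) ℝ)}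
    (hγ : IsO34Loop γ) (i : Fin 3) :
    ∃ γ', IsO34Loop γ' ∧ O34Homotopic γ γ' ∧
      (∀ s j, (γ' s *ᵥ Pi.single (Sum.inl i) 1) (Sum.inr j) = 0) ∧
      ∀ j, j ≠ Sum.inl i → (∀ s, γ s *ᵥ Pi.single j 1 = Pi.single j 1) →
        ∀ s, γ' s *ᵥ Pi.single j 1 = Pi.single j 1 := by
  set w : I → (Fin 3 ⊕ Fin 4 → ℝ) := fun s => γ s *ᵥ Pi.single (Sum.inl i) 1 with hw
  have hwc : Continuous w := γ.continuous.matrix_mulVec continuous_const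
  have hwq : ∀ s, form34 (w s) (w s) = 1 := fun s => by
    rw [hw, (mem_O34_iff _).1 (hγ.1 s), form34_single_single]; rfl
  set Y : I → ℝ := fun s => ∑ j, w s (Sum.inr j) ^ 2 with hY
  have hYc : Continuous Y := by fun_prop
  have hY0 : ∀ s, 0 ≤ Y s := fun s => Finset.sum_nonneg fun j _ => sq_nonneg _
  have hX : ∀ s, ∑ j, w s (Sum.inl j) ^ 2 = 1 + Y s := fun s => by
    have := hwq s
    rw [form34_self] at this
    linarith
  set c : I × I → ℝ := fun p => √(1 + (1 - (p.1 : ℝ)) ^ 2 * Y p.2) / √(1 + Y p.2) with hc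
  have hpos : ∀ s, 0 < √(1 + Y s) := fun s => Real.sqrt_pos.2 (by linarith [hY0 s])
  have hcc : Continuous c := by
    refine Continuous.div (by fun_prop) (by fun_prop) fun p => (hpos _).ne'
  have hcsq : ∀ p, c p ^ 2 * (1 + Y p.2) = 1 + (1 - (p.1 : ℝ)) ^ 2 * Y p.2 := fun p => by
    have h1 : (0 : ℝ) ≤ 1 + (1 - (p.1 : ℝ)) ^ 2 * Y p.2 := by have := hY0 p.2; positivity
    have h2 : (0 : ℝ) < 1 + Y p.2 := by have := hY0 p.2; positivity
    simp only [hc]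
    rw [div_pow, Real.sq_sqrt h1, Real.sq_sqrt h2.le, div_mul_cancel₀ _ h2.ne']
  have hc0 : ∀ p, 0 ≤ c p := fun p => by positivity
  set v : I × I → (Fin 3 ⊕ Fin 4 → ℝ) := fun p =>
    Sum.elim (fun j => c p * w p.2 (Sum.inl j)) (fun j => (1 - (p.1 : ℝ)) * w p.2 (Sum.inr j))
    with hv
  have hvc : Continuous v := by
    refine continuous_pi fun j => ?_
    rcases j with j | j <;> simp only [hv, Sum.elim_inl, Sum.elim_inr] <;> fun_prop
  have hends : ∀ s, w s = Pi.single (Sum.inl i) 1 → ∀ t, v (t, s) = Pi.single (Sum.inl i) 1 := by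
    intro s hs t
    have hYs : Y s = 0 := by simp [hY, hs]
    have hct : c (t, s) = 1 := by simp [hc, hYs]
    funext j
    rcases j with j | j <;> simp [hv, hct, hs]
  have p1 : ∀ s, v (0, s) = γ s *ᵥ Pi.single (Sum.inl i) 1 := fun s => by
    change v (0, s) = w s
    have hct : c (0, s) = 1 := by simp [hc, (hpos s).ne']
    funext j
    rcases j with j | j <;> simp [hv, hct]
  have p2 : ∀ p, form34 (v p) (v p) = sgn34 (Sum.inl i) := fun p => by
    rw [form34_self]
    simp only [hv, Sum.elim_inl, Sum.elim_inr, mul_pow, ← Finset.mul_sum, hX]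
    rw [hcsq]
    simp [hY, sgn34]
  have p3 : ∀ t s, sgn34 (Sum.inl i) + form34 (v (0, s)) (v (t, s)) ≠ 0 := fun t s => by
    apply ne_of_gt
    have hct : c (0, s) = 1 := by simp [hc, (hpos s).ne']
    have e : form34 (v (0, s)) (v (t, s)) = c (t, s) * (1 + Y s) - (1 - (t : ℝ)) * Y s := by
      rw [form34_apply, Fintype.sum_sum_type, ← hX]
      simp only [hv, hct, sgn34, Sum.elim_inl, Sum.elim_inr, hY, Finset.mul_sum,
        sub_eq_add_neg, ← Finset.sum_neg_distrib]
      congr 1 <;> refine Finset.sum_congr rfl fun j _ => ?_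
      · ring
      · simp only [Set.Icc.coe_zero]; ring
    have hsg : sgn34 (Sum.inl i) = 1 := rfl
    rw [e, hsg]
    have ht0 : (0 : ℝ) ≤ t := t.2.1
    have ht1 : (t : ℝ) ≤ 1 := t.2.2
    have hYs := hY0 s
    have h5 := hcsq (t, s)
    -- `(c (1 + Y))² = (1 + Y)(1 + (1-t)² Y) ≥ ((1-t) Y)²`
    have h6 : (1 - (t : ℝ)) * Y s ≤ c (t, s) * (1 + Y s) := by
      apply (sq_le_sq₀ (mul_nonneg (by linarith) hYs) (mul_nonneg (hc0 _) (by linarith))).1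
      have : (c (t, s) * (1 + Y s)) ^ 2 = (1 + (1 - (t : ℝ)) ^ 2 * Y s) * (1 + Y s) := by
        rw [← h5]; ring
      rw [this]
      nlinarith [mul_nonneg (sq_nonneg (1 - (t : ℝ))) hYs]
    linarith
  obtain ⟨γ', h1, h2, h3, h4⟩ := exists_homotopic_of_move hγ (Sum.inl i) v hvc p1 p2 p3
    (fun t => ⟨hends 0 (by simp only [hw, hγ.2.1, Matrix.one_mulVec]) t,
      hends 1 (by simp only [hw, hγ.2.2, Matrix.one_mulVec]) t⟩)
  refine ⟨γ', h1, h2, fun s j => ?_, fun j hj hfix => h4 j hj hfix fun s => ?_⟩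
  · rw [h3]; simp [hv]
  · have : w s j = 0 := mulVec_single_apply_eq_zero (hγ.1 s) hj (hfix s)
    rcases j with j | j <;> simp [hv, this]

/-- Two real functions on the unit interval that vanish at the end points can be perturbed so as
to have no common zero in the interior: the first becomes a polynomial, and the second one moves
off zero at the finitely many roots of that polynomial. -/
theorem exists_perturbation_no_common_zero (f g : C(I, ℝ)) (hf : f 0 = 0 ∧ f 1 = 0)
    (hg : g 0 = 0 ∧ g 1 = 0) {ε : ℝ} (hε : 0 < ε) :
    ∃ f' g' : C(I, ℝ), (∀ s, |f' s - f s| < ε) ∧ (∀ s, |g' s - g s| < ε) ∧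
      (f' 0 = 0 ∧ f' 1 = 0) ∧ (g' 0 = 0 ∧ g' 1 = 0) ∧
      ∀ s, s ≠ 0 → s ≠ 1 → f' s ≠ 0 ∨ g' s ≠ 0 := by
  obtain ⟨p, hp0, hp, hpe⟩ : ∃ p : Polynomial ℝ, p ≠ 0 ∧ (∀ s : I, |p.eval (s : ℝ) - f s| < ε) ∧
      (p.eval 0 = 0 ∧ p.eval 1 = 0) := by
    obtain ⟨q, hq⟩ := exists_polynomial_near_continuousMap 0 1 f (ε / 4) (by positivity)
    have hq' : ∀ s : I, |q.eval (s : ℝ) - f s| < ε / 4 := fun s => by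
      have := (ContinuousMap.norm_lt_iff _ (by positivity)).1 hq s
      simpa using this
    -- correct the values at the end points by a linear polynomial
    set r : Polynomial ℝ := q - Polynomial.C (q.eval 0) * (1 - Polynomial.X)
      - Polynomial.C (q.eval 1) * Polynomial.X with hr
    have hre : ∀ s : I, |r.eval (s : ℝ) - f s| < ε / 2 := fun s => by
      have h0 := hq' 0
      have h1 := hq' 1
      have hs := hq' s
      rw [hf.1] at h0
      rw [hf.2] at h1
      simp only [Set.Icc.coe_zero, Set.Icc.coe_one, sub_zero] at h0 h1
      have s0 : (0 : ℝ) ≤ s := s.2.1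
      have s1 : (s : ℝ) ≤ 1 := s.2.2
      simp only [hr, Polynomial.eval_sub, Polynomial.eval_mul, Polynomial.eval_C,
        Polynomial.eval_one, Polynomial.eval_X]
      rw [abs_lt] at *
      constructor <;> nlinarith
    have hr0 : r.eval 0 = 0 := by simp [hr]
    have hr1 : r.eval 1 = 0 := by simp [hr]
    by_cases hz : r = 0
    · refine ⟨Polynomial.C (ε / 4) * (Polynomial.X * (1 - Polynomial.X)), ?_, fun s => ?_, by simp⟩
      · intro h
        have := congrArg (Polynomial.eval (1 / 2 : ℝ)) h
        simp at this
        norm_num at this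
        linarith
      · have hs := hre s
        rw [hz, Polynomial.eval_zero] at hs
        have s0 : (0 : ℝ) ≤ s := s.2.1
        have s1 : (s : ℝ) ≤ 1 := s.2.2
        simp only [Polynomial.eval_mul, Polynomial.eval_C, Polynomial.eval_sub,
          Polynomial.eval_one, Polynomial.eval_X]
        rw [abs_lt] at *
        have h1 : 0 ≤ (s : ℝ) * (1 - s) := mul_nonneg s0 (by linarith)
        have h2 : (s : ℝ) * (1 - s) ≤ 1 := by nlinarith
        constructor <;> nlinarith
    · exact ⟨r, hz, fun s => (hre s).trans (by linarith), hr0, hr1⟩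
  -- choose `a` small with `g s ≠ a s (1 - s)` at the roots `s` of `p`
  obtain ⟨a, ha, ha'⟩ : ∃ a ∈ Set.Ioo (0 : ℝ) ε, a ∉
      (fun s : I => g s / ((s : ℝ) * (1 - s))) '' {s : I | (s : ℝ) ∈ p.rootSet ℝ} := by
    have hfin : ((fun s : I => g s / ((s : ℝ) * (1 - s))) ''
        {s : I | (s : ℝ) ∈ p.rootSet ℝ}).Finite :=
      ((p.rootSet_finite ℝ).preimage Subtype.val_injective.injOn).image _
    exact ((Set.Ioo_infinite hε).sdiff hfin).nonempty
  refine ⟨⟨fun s => p.eval (s : ℝ), by fun_prop⟩, ⟨fun s => g s - a * (s * (1 - s)), by fun_prop⟩,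
    hp, fun s => ?_, by simpa using hpe, by simp [hg.1, hg.2], fun s h0 h1 => ?_⟩
  · have s0 : (0 : ℝ) ≤ s := s.2.1
    have s1 : (s : ℝ) ≤ 1 := s.2.2
    have e1 : 0 ≤ (s : ℝ) * (1 - s) := mul_nonneg s0 (by linarith)
    have e2 : (s : ℝ) * (1 - s) ≤ 1 := by nlinarith
    have ha0 := ha.1
    simp only [ContinuousMap.coe_mk]
    rw [sub_sub_cancel_left, abs_neg, abs_of_nonneg (by positivity)]
    calc a * (s * (1 - s)) ≤ a * 1 := by gcongr
      _ < ε := by rw [mul_one]; exact ha.2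
  · by_contra! hcon
    simp only [ContinuousMap.coe_mk] at hcon
    apply ha'
    refine ⟨s, ?_, ?_⟩
    · simp [Polynomial.mem_rootSet, hp0, hcon.1]
    · have s0 : (s : ℝ) ≠ 0 := fun h => h0 (Subtype.ext h)
      have s1 : 1 - (s : ℝ) ≠ 0 := fun h => h1 (Subtype.ext (by rw [Set.Icc.coe_one]; linarith))
      have := hcon.2
      simp only
      field_simp
      linarith

theorem form34_of_support {i : Fin 3 ⊕ Fin 4} {x : Fin 3 ⊕ Fin 4 → ℝ}
    (hx : ∀ l, sgn34 l ≠ sgn34 i → x l = 0) (y : Fin 3 ⊕ Fin 4 → ℝ) :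
    form34 x y = sgn34 i * (x ⬝ᵥ y) := by
  rw [form34_apply, dotProduct, Finset.mul_sum]
  refine Finset.sum_congr rfl fun l _ => ?_
  by_cases h : sgn34 l = sgn34 i
  · rw [h]
  · rw [hx l h]; simp

/-- If the orbit path `v` of `eᵢ` lies in a definite coordinate subspace, it can be moved along
the radial projection of straight line segments that do not meet the rays opposite to `v`. -/
theorem exists_homotopic_of_segment {γ : C(I, Matrix (Fin 3 ⊕ Fin 4) (Fin 3 ⊕ Fin 4) ℝ)}
    (hγ : IsO34Loop γ) (i : Fin 3 ⊕ Fin 4)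
    (hsupp : ∀ s l, sgn34 l ≠ sgn34 i → (γ s *ᵥ Pi.single i 1) l = 0)
    (u : I → (Fin 3 ⊕ Fin 4 → ℝ)) (hu : Continuous u)
    (husupp : ∀ s l, sgn34 l ≠ sgn34 i → u s l = 0)
    (hends : u 0 = Pi.single i 1 ∧ u 1 = Pi.single i 1)
    (hline : ∀ t s : I, ∀ x, x = (1 - (t : ℝ)) • (γ s *ᵥ Pi.single i 1) + (t : ℝ) • u s →
      0 < (γ s *ᵥ Pi.single i 1) ⬝ᵥ x + √(x ⬝ᵥ x)) :
    ∃ γ', IsO34Loop γ' ∧ O34Homotopic γ γ' ∧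
      (∀ s, γ' s *ᵥ Pi.single i 1 = (√(u s ⬝ᵥ u s))⁻¹ • u s) ∧
      ∀ j, j ≠ i → (∀ s, γ s *ᵥ Pi.single j 1 = Pi.single j 1) → (∀ s, u s j = 0) →
        ∀ s, γ' s *ᵥ Pi.single j 1 = Pi.single j 1 := by
  set w : I → (Fin 3 ⊕ Fin 4 → ℝ) := fun s => γ s *ᵥ Pi.single i 1 with hw
  have hwc : Continuous w := γ.continuous.matrix_mulVec continuous_const
  have hws : ∀ s, w s ⬝ᵥ w s = 1 := fun s => by
    have h := (mem_O34_iff _).1 (hγ.1 s) (Pi.single i 1) (Pi.single i 1)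
    rw [form34_of_support (hsupp s), form34_single_single] at h
    exact mul_left_cancel₀ (sgn34_ne_zero i) (h.trans (mul_one _).symm)
  set x : I × I → (Fin 3 ⊕ Fin 4 → ℝ) := fun p => (1 - (p.1 : ℝ)) • w p.2 + (p.1 : ℝ) • u p.2
    with hx
  have hxc : Continuous x := by fun_prop
  have hxs : ∀ p l, sgn34 l ≠ sgn34 i → x p l = 0 := fun p l hl => by
    simp only [hx, Pi.add_apply, Pi.smul_apply]
    rw [show w p.2 l = 0 from hsupp p.2 l hl, husupp p.2 l hl]; simp
  have hpos : ∀ p, 0 < √(x p ⬝ᵥ x p) := fun p => by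
    rw [Real.sqrt_pos]
    refine lt_of_le_of_ne (Finset.sum_nonneg fun l _ => mul_self_nonneg _) fun h => ?_
    have hx0 : x p = 0 := dotProduct_self_eq_zero.1 h.symm
    have := hline p.1 p.2 _ rfl
    change 0 < w p.2 ⬝ᵥ x p + √(x p ⬝ᵥ x p) at this
    rw [hx0] at this
    simp at this
  have hdotc : ∀ {f g : I × I → (Fin 3 ⊕ Fin 4 → ℝ)}, Continuous f → Continuous g →
      Continuous fun p => f p ⬝ᵥ g p := fun hf hg => hf.dotProduct hg
  set v : I × I → (Fin 3 ⊕ Fin 4 → ℝ) := fun p => (√(x p ⬝ᵥ x p))⁻¹ • x p with hv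
  have hvc : Continuous v := by
    have h : Continuous fun p => (√(x p ⬝ᵥ x p))⁻¹ :=
      (Real.continuous_sqrt.comp (hdotc hxc hxc)).inv₀ fun p => (hpos p).ne'
    exact h.smul hxc
  have hx0 : ∀ s, x (0, s) = w s := fun s => by simp [hx]
  have hv0 : ∀ s, v (0, s) = w s := fun s => by simp only [hv, hx0, hws]; simp
  have hx1 : ∀ s, x (1, s) = u s := fun s => by simp [hx]
  have hendx : ∀ s, w s = Pi.single i 1 → u s = Pi.single i 1 →
      ∀ t, v (t, s) = Pi.single i 1 := fun s h1 h2 t => by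
    have : x (t, s) = Pi.single i 1 := by
      simp only [hx, h1, h2]
      rw [← add_smul, sub_add_cancel, one_smul]
    simp only [hv, this]
    simp
  obtain ⟨γ', h1, h2, h3, h4⟩ := exists_homotopic_of_move hγ i v hvc hv0
    (fun p => by
      have : ∀ l, sgn34 l ≠ sgn34 i → v p l = 0 := fun l hl => by
        simp [hv, hxs p l hl]
      rw [form34_of_support this]
      simp only [hv, smul_dotProduct, dotProduct_smul, smul_eq_mul]
      have h2 := Real.mul_self_sqrt (Real.sqrt_pos.1 (hpos p)).le
      have h3 := (hpos p).ne'
      have : (√(x p ⬝ᵥ x p))⁻¹ * ((√(x p ⬝ᵥ x p))⁻¹ * (x p ⬝ᵥ x p)) = 1 := by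
        nth_rewrite 3 [← h2]
        field_simp
      rw [this, mul_one])
    (fun t s => by
      rw [hv0, form34_of_support (hsupp s)]
      have h := hline t s _ rfl
      change 0 < w s ⬝ᵥ x (t, s) + √(x (t, s) ⬝ᵥ x (t, s)) at h
      have e : sgn34 i + sgn34 i * (w s ⬝ᵥ v (t, s)) = sgn34 i * ((√(x (t, s) ⬝ᵥ x (t, s)))⁻¹ *
          (w s ⬝ᵥ x (t, s) + √(x (t, s) ⬝ᵥ x (t, s)))) := by
        simp only [hv, dotProduct_smul, smul_eq_mul]
        have h3 := (hpos (t, s)).ne'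
        field_simp
        ring
      rw [e]
      exact mul_ne_zero (sgn34_ne_zero i) (mul_ne_zero (inv_ne_zero (hpos (t, s)).ne') h.ne'))
    (fun t => ⟨hendx 0 (by simp only [hw, hγ.2.1, Matrix.one_mulVec]) hends.1 t,
      hendx 1 (by simp only [hw, hγ.2.2, Matrix.one_mulVec]) hends.2 t⟩)
  refine ⟨γ', h1, h2, fun s => ?_, fun j hj hfix huj => h4 j hj hfix fun s => ?_⟩
  · rw [h3]; simp only [hv, hx1]
  · simp only [hv, hx1, Pi.smul_apply, huj, smul_zero]

/-- A loop whose `eᵢ`-orbit lies in a definite coordinate subspace that contains two further basis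
vectors `eⱼ`, `eₖ` is homotopic to a loop that fixes `eᵢ`: the orbit path can be perturbed so as to
avoid `-eᵢ`, and is then contracted along great circles. -/
theorem exists_homotopic_fix {γ : C(I, Matrix (Fin 3 ⊕ Fin 4) (Fin 3 ⊕ Fin 4) ℝ)}
    (hγ : IsO34Loop γ) (i j k : Fin 3 ⊕ Fin 4) (hij : i ≠ j) (hik : i ≠ k) (hjk : j ≠ k)
    (hj : sgn34 j = sgn34 i) (hk : sgn34 k = sgn34 i)
    (hsupp : ∀ s l, sgn34 l ≠ sgn34 i → (γ s *ᵥ Pi.single i 1) l = 0) :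
    ∃ γ', IsO34Loop γ' ∧ O34Homotopic γ γ' ∧ (∀ s, γ' s *ᵥ Pi.single i 1 = Pi.single i 1) ∧
      ∀ l, l ≠ i → l ≠ j → l ≠ k → (∀ s, γ s *ᵥ Pi.single l 1 = Pi.single l 1) →
        ∀ s, γ' s *ᵥ Pi.single l 1 = Pi.single l 1 := by
  set w : I → (Fin 3 ⊕ Fin 4 → ℝ) := fun s => γ s *ᵥ Pi.single i 1 with hw
  have hwc : Continuous w := γ.continuous.matrix_mulVec continuous_const
  have hw0 : w 0 = Pi.single i 1 := by simp only [hw, hγ.2.1, Matrix.one_mulVec]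
  have hw1 : w 1 = Pi.single i 1 := by simp only [hw, hγ.2.2, Matrix.one_mulVec]
  have hws : ∀ s, w s ⬝ᵥ w s = 1 := fun s => by
    have h := (mem_O34_iff _).1 (hγ.1 s) (Pi.single i 1) (Pi.single i 1)
    rw [form34_of_support (hsupp s), form34_single_single] at h
    exact mul_left_cancel₀ (sgn34_ne_zero i) (h.trans (mul_one _).symm)
  have hle : ∀ s l, |w s l| ≤ 1 := fun s l => by
    rw [← sq_le_one_iff_abs_le_one, ← hws s, sq]
    exact Finset.single_le_sum (f := fun l => w s l * w s l) (fun l _ => mul_self_nonneg _)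
      (Finset.mem_univ l)
  obtain ⟨f, g, hf, hg, hf0, hg0, hfg⟩ := exists_perturbation_no_common_zero
    ⟨fun s => w s j, by fun_prop⟩ ⟨fun s => w s k, by fun_prop⟩
    (by simp [hw0, hw1, hij.symm]) (by simp [hw0, hw1, hik.symm]) (ε := 1 / 4) (by norm_num)
  simp only [ContinuousMap.coe_mk] at hf hg
  set u : I → (Fin 3 ⊕ Fin 4 → ℝ) := fun s =>
    w s + (f s - w s j) • Pi.single j 1 + (g s - w s k) • Pi.single k 1 with hu
  have huc : Continuous u := by fun_prop
  have huj : ∀ s, u s j = f s := fun s => by simp [hu, hjk]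
  have huk : ∀ s, u s k = g s := fun s => by simp [hu, hjk.symm]
  have hul : ∀ s l, l ≠ j → l ≠ k → u s l = w s l := fun s l h1 h2 => by simp [hu, h1, h2]
  have hu0 : u 0 = Pi.single i 1 := by simp [hu, hw0, hf0.1, hg0.1, hij.symm, hik.symm]
  have hu1 : u 1 = Pi.single i 1 := by simp [hu, hw1, hf0.2, hg0.2, hij.symm, hik.symm]
  have hus : ∀ s l, sgn34 l ≠ sgn34 i → u s l = 0 := fun s l hl => by
    rw [hul s l (fun h => hl (h ▸ hj)) (fun h => hl (h ▸ hk))]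
    exact hsupp s l hl
  have hwu : ∀ s, 0 < w s ⬝ᵥ u s := fun s => by
    have e : w s ⬝ᵥ u s = 1 + (f s - w s j) * w s j + (g s - w s k) * w s k := by
      simp only [hu, dotProduct_add, dotProduct_smul, hws, dotProduct_single, smul_eq_mul, mul_one]
    have b1 : |(f s - w s j) * w s j| ≤ 1 / 4 * 1 := by
      rw [abs_mul]; exact mul_le_mul (hf s).le (hle s j) (abs_nonneg _) (by norm_num)
    have b2 : |(g s - w s k) * w s k| ≤ 1 / 4 * 1 := by
      rw [abs_mul]; exact mul_le_mul (hg s).le (hle s k) (abs_nonneg _) (by norm_num)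
    rw [e]
    linarith [neg_abs_le ((f s - w s j) * w s j), neg_abs_le ((g s - w s k) * w s k)]
  obtain ⟨γ₁, h1, h2, h3, h4⟩ := exists_homotopic_of_segment hγ i hsupp u huc hus ⟨hu0, hu1⟩
    (fun t s x hx => by
      have e : w s ⬝ᵥ x = (1 - (t : ℝ)) + t * (w s ⬝ᵥ u s) := by
        rw [hx, dotProduct_add, dotProduct_smul, dotProduct_smul, hws]; simp
      have ht0 : (0 : ℝ) ≤ t := t.2.1
      have ht1 : (t : ℝ) ≤ 1 := t.2.2
      have := hwu s
      have : 0 < w s ⬝ᵥ x := by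
        rw [e]
        rcases ht1.lt_or_eq with h | h
        · have := mul_nonneg ht0 this.le
          linarith
        · rw [h]; linarith
      have := Real.sqrt_nonneg (x ⬝ᵥ x)
      linarith)
  have hupos : ∀ s, 0 < √(u s ⬝ᵥ u s) := fun s => by
    rw [Real.sqrt_pos]
    refine lt_of_le_of_ne (Finset.sum_nonneg fun l _ => mul_self_nonneg _) fun h => ?_
    have hx0 : u s = 0 := dotProduct_self_eq_zero.1 h.symm
    have := hwu s
    rw [hx0] at this
    simp at this
  set c : I → ℝ := fun s => (γ₁ s *ᵥ Pi.single i 1) i with hc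
  have hsupp₁ : ∀ s l, sgn34 l ≠ sgn34 i → (γ₁ s *ᵥ Pi.single i 1) l = 0 := fun s l hl => by
    rw [h3]; simp [hus s l hl]
  have hws₁ : ∀ s, (γ₁ s *ᵥ Pi.single i 1) ⬝ᵥ (γ₁ s *ᵥ Pi.single i 1) = 1 := fun s => by
    have h := (mem_O34_iff _).1 (h1.1 s) (Pi.single i 1) (Pi.single i 1)
    rw [form34_of_support (hsupp₁ s), form34_single_single] at h
    exact mul_left_cancel₀ (sgn34_ne_zero i) (h.trans (mul_one _).symm)
  -- the perturbed path stays away from `-eᵢ`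
  have hcgt : ∀ s, -1 < c s := fun s => by
    by_cases hs : s = 0 ∨ s = 1
    · have : c s = 1 := by
        rcases hs with rfl | rfl
        · simp only [hc, h1.2.1, Matrix.one_mulVec, Pi.single_eq_same]
        · simp only [hc, h1.2.2, Matrix.one_mulVec, Pi.single_eq_same]
      rw [this]; norm_num
    · push Not at hs
      have hne := hfg s hs.1 hs.2
      have hsum : c s ^ 2 + (γ₁ s *ᵥ Pi.single i 1) j ^ 2 + (γ₁ s *ᵥ Pi.single i 1) k ^ 2 ≤ 1 := by
        have h6 := hws₁ s
        rw [dotProduct] at h6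
        have := Finset.sum_le_sum_of_subset_of_nonneg (s := {i, j, k})
          (f := fun l => (γ₁ s *ᵥ Pi.single i 1) l * (γ₁ s *ᵥ Pi.single i 1) l)
          (Finset.subset_univ _) (fun l _ _ => mul_self_nonneg _)
        rw [Finset.sum_insert (by simp [hij, hik]), Finset.sum_insert (by simp [hjk]),
          Finset.sum_singleton] at this
        rw [h6] at this
        simp only [hc]
        linarith
      have hinv := inv_pos.2 (hupos s)
      have hpos : 0 < (γ₁ s *ᵥ Pi.single i 1) j ^ 2 + (γ₁ s *ᵥ Pi.single i 1) k ^ 2 := by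
        rw [h3]
        simp only [Pi.smul_apply, smul_eq_mul, huj, huk]
        rcases hne with h | h <;> positivity
      nlinarith
  have hcle : ∀ s, c s ≤ 1 := fun s => by
    have := Finset.single_le_sum (f := fun l => (γ₁ s *ᵥ Pi.single i 1) l *
      (γ₁ s *ᵥ Pi.single i 1) l) (fun l _ => mul_self_nonneg _) (Finset.mem_univ i)
    have h5 := hws₁ s
    rw [dotProduct] at h5
    rw [h5] at this
    change c s * c s ≤ 1 at this
    nlinarith
  obtain ⟨γ₂, k1, k2, k3, k4⟩ := exists_homotopic_of_segment h1 i hsupp₁ (fun _ => Pi.single i 1)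
    continuous_const (fun s l hl => by
      rw [Pi.single_apply, if_neg]
      rintro rfl
      exact hl rfl) ⟨rfl, rfl⟩
    (fun t s x hx => by
      have e : (γ₁ s *ᵥ Pi.single i 1) ⬝ᵥ x = (1 - (t : ℝ)) + t * c s := by
        rw [hx, dotProduct_add, dotProduct_smul, dotProduct_smul, hws₁, dotProduct_single]
        simp [hc]
      have e2 : x ⬝ᵥ x = ((1 - (t : ℝ)) + t * c s) ^ 2 + t ^ 2 * (1 - c s ^ 2) := by
        rw [← e]
        nth_rewrite 1 [hx]
        rw [add_dotProduct, smul_dotProduct, smul_dotProduct, e, hx, single_dotProduct]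
        simp only [Pi.add_apply, Pi.smul_apply, Pi.single_eq_same, smul_eq_mul]
        change (1 - (t : ℝ)) * (1 - ↑t + ↑t * c s) + ↑t * (1 * ((1 - ↑t) * c s + ↑t * 1)) = _
        ring
      have ht0 : (0 : ℝ) ≤ t := t.2.1
      have ht1 : (t : ℝ) ≤ 1 := t.2.2
      have hc1 := hcgt s
      have hc2 := hcle s
      rw [e]
      set A := (1 - (t : ℝ)) + t * c s with hA
      rcases lt_or_ge 0 A with hA0 | hA0
      · have := Real.sqrt_nonneg (x ⬝ᵥ x)
        linarith
      · have htpos : 0 < (t : ℝ) := by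
          refine lt_of_le_of_ne ht0 fun h => ?_
          rw [hA, ← h] at hA0
          norm_num at hA0
        have hclt : c s < 1 := by
          refine lt_of_le_of_ne hc2 fun h => ?_
          rw [hA, h] at hA0
          norm_num at hA0
        have : -A < √(x ⬝ᵥ x) := by
          apply Real.lt_sqrt_of_sq_lt
          rw [e2, neg_sq]
          have : 0 < (t : ℝ) ^ 2 * (1 - c s ^ 2) := mul_pos (by positivity) (by nlinarith)
          linarith
        linarith)
  refine ⟨γ₂, k1, h2.trans k2, fun s => ?_, fun l hli hlj hlk hfix => ?_⟩
  · rw [k3]; simp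
  · refine k4 l hli (h4 l hli hfix fun s => ?_) fun s => by simp [hli]
    rw [hul s l hlj hlk]
    exact mulVec_single_apply_eq_zero (hγ.1 s) hli (hfix s)

/-- The rotation by the angle `θ` in the coordinate plane of `eᵢ` and `eⱼ`. -/
noncomputable def planeRotation (i j : Fin 3 ⊕ Fin 4) (θ : ℝ) :
    (Fin 3 ⊕ Fin 4 → ℝ) →ₗ[ℝ] (Fin 3 ⊕ Fin 4 → ℝ) :=
  LinearMap.id
    + ((Real.cos θ - 1) • LinearMap.proj i - Real.sin θ • LinearMap.proj j :
        (Fin 3 ⊕ Fin 4 → ℝ) →ₗ[ℝ] ℝ).smulRight (Pi.single i 1)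
    + (Real.sin θ • LinearMap.proj i + (Real.cos θ - 1) • LinearMap.proj j :
        (Fin 3 ⊕ Fin 4 → ℝ) →ₗ[ℝ] ℝ).smulRight (Pi.single j 1)

theorem planeRotation_apply (i j : Fin 3 ⊕ Fin 4) (θ : ℝ) (x : Fin 3 ⊕ Fin 4 → ℝ) :
    planeRotation i j θ x = x + ((Real.cos θ - 1) * x i - Real.sin θ * x j) • Pi.single i 1
      + (Real.sin θ * x i + (Real.cos θ - 1) * x j) • Pi.single j 1 := by
  simp [planeRotation]

section PlaneRotation

variable {i j : Fin 3 ⊕ Fin 4}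

theorem planeRotation_apply_left (hij : i ≠ j) (θ : ℝ) (x : Fin 3 ⊕ Fin 4 → ℝ) :
    planeRotation i j θ x i = Real.cos θ * x i - Real.sin θ * x j := by
  simp [planeRotation_apply, hij]; ring

theorem planeRotation_apply_right (hij : i ≠ j) (θ : ℝ) (x : Fin 3 ⊕ Fin 4 → ℝ) :
    planeRotation i j θ x j = Real.sin θ * x i + Real.cos θ * x j := by
  simp [planeRotation_apply, hij.symm]; ring

theorem planeRotation_apply_of_ne {l : Fin 3 ⊕ Fin 4} (hi : l ≠ i) (hj : l ≠ j) (θ : ℝ)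
    (x : Fin 3 ⊕ Fin 4 → ℝ) : planeRotation i j θ x l = x l := by
  simp [planeRotation_apply, hi, hj]

theorem planeRotation_zero : planeRotation i j 0 = LinearMap.id := by
  ext x l; simp [planeRotation_apply]

theorem planeRotation_comp (hij : i ≠ j) (θ θ' : ℝ) :
    planeRotation i j θ ∘ₗ planeRotation i j θ' = planeRotation i j (θ + θ') := by
  refine LinearMap.ext fun x => funext fun l => ?_
  rw [LinearMap.comp_apply]
  by_cases hi : l = i
  · subst hi
    simp only [planeRotation_apply_left hij, planeRotation_apply_right hij, Real.cos_add,
      Real.sin_add]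
    ring
  · by_cases hj : l = j
    · subst hj
      simp only [planeRotation_apply_left hij, planeRotation_apply_right hij, Real.cos_add,
        Real.sin_add]
      ring
    · simp only [planeRotation_apply_of_ne hi hj]

theorem form34_planeRotation (hij : i ≠ j) (hs : sgn34 j = sgn34 i) (θ : ℝ)
    (x y : Fin 3 ⊕ Fin 4 → ℝ) :
    form34 (planeRotation i j θ x) (planeRotation i j θ y) = form34 x y := by
  have h1 : form34 (Pi.single i 1) (Pi.single j 1) = 0 := by
    rw [form34_single]; simp [hij.symm]
  have h2 : form34 (Pi.single j 1) (Pi.single i 1) = 0 := by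
    rw [form34_single]; simp [hij]
  simp only [planeRotation_apply, map_add, map_smul, LinearMap.add_apply, LinearMap.smul_apply,
    smul_eq_mul, form34_comm (Pi.single i 1) y, form34_comm (Pi.single j 1) y, form34_single, hs]
  simp only [Pi.single_eq_same, Pi.single_eq_of_ne hij, Pi.single_eq_of_ne hij.symm]
  linear_combination sgn34 i * (x i * y i + x j * y j) * Real.cos_sq_add_sin_sq θ

/-- Turning the second axis of a rotation plane over reverses the rotation. -/
theorem planeRotation_conj {k : Fin 3 ⊕ Fin 4} (hij : i ≠ j) (hik : i ≠ k) (hjk : j ≠ k) (θ : ℝ) :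
    planeRotation j k Real.pi ∘ₗ planeRotation i j θ ∘ₗ planeRotation j k (-Real.pi) =
      planeRotation i j (-θ) := by
  refine LinearMap.ext fun x => funext fun l => ?_
  simp only [LinearMap.comp_apply]
  have hx : ∀ y : Fin 3 ⊕ Fin 4 → ℝ, planeRotation j k Real.pi y j = -y j ∧
      planeRotation j k Real.pi y k = -y k := fun y => by
    rw [planeRotation_apply_left hjk, planeRotation_apply_right hjk]; simp
  have hx' : ∀ y : Fin 3 ⊕ Fin 4 → ℝ, planeRotation j k (-Real.pi) y j = -y j ∧
      planeRotation j k (-Real.pi) y k = -y k := fun y => by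
    rw [planeRotation_apply_left hjk, planeRotation_apply_right hjk]; simp
  by_cases hi : l = i
  · subst hi
    rw [planeRotation_apply_of_ne hij hik, planeRotation_apply_left hij,
      planeRotation_apply_left hij, planeRotation_apply_of_ne hij hik, (hx' x).1]
    simp
  · by_cases hj : l = j
    · subst hj
      rw [(hx _).1, planeRotation_apply_right hij, planeRotation_apply_right hij,
        planeRotation_apply_of_ne hij hik, (hx' x).1]
      simp; ring
    · by_cases hk : l = k
      · subst hk
        rw [(hx _).2, planeRotation_apply_of_ne hi hj, (hx' x).2, planeRotation_apply_of_ne hi hj,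
          neg_neg]
      · rw [planeRotation_apply_of_ne hj hk, planeRotation_apply_of_ne hi hj,
          planeRotation_apply_of_ne hj hk, planeRotation_apply_of_ne hi hj]

/-- The matrix of a rotation in a coordinate plane. -/
noncomputable def rotationMatrix (i j : Fin 3 ⊕ Fin 4) (θ : ℝ) :
    Matrix (Fin 3 ⊕ Fin 4) (Fin 3 ⊕ Fin 4) ℝ :=
  LinearMap.toMatrix' (planeRotation i j θ)

theorem rotationMatrix_mulVec (θ : ℝ) (x : Fin 3 ⊕ Fin 4 → ℝ) :
    rotationMatrix i j θ *ᵥ x = planeRotation i j θ x :=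
  LinearMap.toMatrix'_mulVec _ _

theorem rotationMatrix_mul (hij : i ≠ j) (θ θ' : ℝ) :
    rotationMatrix i j θ * rotationMatrix i j θ' = rotationMatrix i j (θ + θ') := by
  rw [rotationMatrix, rotationMatrix, ← LinearMap.toMatrix'_comp, planeRotation_comp hij]
  rfl

theorem rotationMatrix_zero : rotationMatrix i j 0 = 1 := by
  rw [rotationMatrix, planeRotation_zero, LinearMap.toMatrix'_id]

theorem rotationMatrix_two_pi_mul_int (n : ℤ) : rotationMatrix i j (2 * Real.pi * n) = 1 := by
  have h1 : Real.cos (2 * Real.pi * n) = 1 := by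
    rw [mul_comm]; exact Real.cos_int_mul_two_pi n
  have h2 : Real.sin (2 * Real.pi * n) = 0 := by
    have := Real.sin_int_mul_pi (2 * n)
    push_cast at this
    rw [← this]; ring_nf
  have : planeRotation i j (2 * Real.pi * n) = LinearMap.id := by
    refine LinearMap.ext fun x => ?_
    rw [planeRotation_apply, h1, h2]; simp
  rw [rotationMatrix, this, LinearMap.toMatrix'_id]

theorem rotationMatrix_mem_O34 (hij : i ≠ j) (hs : sgn34 j = sgn34 i) (θ : ℝ) :
    rotationMatrix i j θ ∈ O34 :=
  toMatrix'_mem_O34 (form34_planeRotation hij hs θ)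

theorem continuous_rotationMatrix : Continuous (rotationMatrix i j) := by
  refine continuous_matrix fun a b => ?_
  simp only [rotationMatrix, LinearMap.toMatrix'_apply, planeRotation_apply, Pi.add_apply,
    Pi.smul_apply, smul_eq_mul]
  fun_prop

theorem sgn34_inl {i j : Fin 3} : sgn34 (Sum.inl i) = sgn34 (Sum.inl j) := rfl

/-- The loop of rotations that turns `n` times in a coordinate plane. -/
noncomputable def rotationLoop (i j : Fin 3 ⊕ Fin 4) (n : ℤ) :
    C(I, Matrix (Fin 3 ⊕ Fin 4) (Fin 3 ⊕ Fin 4) ℝ) :=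
  ⟨fun s => rotationMatrix i j (2 * Real.pi * n * s), continuous_rotationMatrix.comp (by fun_prop)⟩

theorem isO34Loop_rotationLoop (hij : i ≠ j) (hs : sgn34 j = sgn34 i) (n : ℤ) :
    IsO34Loop (rotationLoop i j n) := by
  refine ⟨fun s => rotationMatrix_mem_O34 hij hs _, ?_, ?_⟩
  · simp [rotationLoop, rotationMatrix_zero]
  · simp [rotationLoop, rotationMatrix_two_pi_mul_int]

theorem rotationLoop_mul (hij : i ≠ j) (m n : ℤ) :
    rotationLoop i j m * rotationLoop i j n = rotationLoop i j (m + n) := by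
  refine ContinuousMap.ext fun s => ?_
  simp only [rotationLoop, ContinuousMap.mul_apply, ContinuousMap.coe_mk, rotationMatrix_mul hij]
  congr 1
  push_cast; ring

/-- Conjugation by rotations that turn the second axis over deforms a loop of rotations into the
reverse loop. -/
theorem rotationLoop_homotopic_neg {k : Fin 3 ⊕ Fin 4} (hij : i ≠ j) (hik : i ≠ k) (hjk : j ≠ k)
    (hj : sgn34 j = sgn34 i) (hk : sgn34 k = sgn34 j) (n : ℤ) :
    O34Homotopic (rotationLoop i j n) (rotationLoop i j (-n)) := by
  refine O34Homotopic.of (fun p => rotationMatrix j k (Real.pi * p.1) * (rotationLoop i j n p.2 *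
    rotationMatrix j k (-(Real.pi * p.1)))) ?_ (fun s => ?_) (fun s => ?_) (fun p => ?_)
    (fun t => ?_)
  · exact (continuous_rotationMatrix.comp (by fun_prop)).matrix_mul
      (((rotationLoop i j n).continuous.comp continuous_snd).matrix_mul
        (continuous_rotationMatrix.comp (by fun_prop)))
  · simp [rotationMatrix_zero]
  · simp only [rotationLoop, ContinuousMap.coe_mk, Set.Icc.coe_one, mul_one]
    rw [rotationMatrix, rotationMatrix, rotationMatrix, ← LinearMap.toMatrix'_comp,
      ← LinearMap.toMatrix'_comp, planeRotation_conj hij hik hjk, rotationMatrix]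
    congr 2
    push_cast; ring
  · exact mul_mem_O34 (rotationMatrix_mem_O34 hjk hk _)
      (mul_mem_O34 ((isO34Loop_rotationLoop hij hj n).1 _) (rotationMatrix_mem_O34 hjk hk _))
  · rw [(isO34Loop_rotationLoop hij hj n).2.1, (isO34Loop_rotationLoop hij hj n).2.2, one_mul,
      rotationMatrix_mul hjk, add_neg_cancel, rotationMatrix_zero]
    exact ⟨rfl, rfl⟩

theorem O34Homotopic.refl {γ : C(I, Matrix (Fin 3 ⊕ Fin 4) (Fin 3 ⊕ Fin 4) ℝ)}
    (h : IsO34Loop γ) : O34Homotopic γ γ :=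
  ContinuousMap.HomotopicWith.refl γ h

theorem O34Homotopic.trans {γ γ' γ'' : C(I, Matrix (Fin 3 ⊕ Fin 4) (Fin 3 ⊕ Fin 4) ℝ)}
    (h : O34Homotopic γ γ') (h' : O34Homotopic γ' γ'') : O34Homotopic γ γ'' :=
  ContinuousMap.HomotopicWith.trans h h'

theorem O34Homotopic.symm {γ γ' : C(I, Matrix (Fin 3 ⊕ Fin 4) (Fin 3 ⊕ Fin 4) ℝ)}
    (h : O34Homotopic γ γ') : O34Homotopic γ' γ :=
  ContinuousMap.HomotopicWith.symm h

/-- The homotopy class of a loop of rotations depends only on the parity of the number of turns. -/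
theorem rotationLoop_homotopic_emod_two {k : Fin 3 ⊕ Fin 4} (hij : i ≠ j) (hik : i ≠ k)
    (hjk : j ≠ k) (hj : sgn34 j = sgn34 i) (hk : sgn34 k = sgn34 j) (n : ℤ) :
    O34Homotopic (rotationLoop i j n) (rotationLoop i j (n % 2)) := by
  have h1 := O34Homotopic.refl (isO34Loop_rotationLoop hij hj (n % 2 + n / 2))
  have h2 := h1.mul (rotationLoop_homotopic_neg hij hik hjk hj hk (n / 2))
  rw [rotationLoop_mul hij, rotationLoop_mul hij] at h2
  have e1 : n % 2 + n / 2 + n / 2 = n := by omega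
  have e2 : n % 2 + n / 2 + -(n / 2) = n % 2 := by omega
  rwa [e1, e2] at h2

/-- A loop whose `eᵢ`-orbit lies in the plane of `eᵢ` and `eⱼ` is, up to homotopy, the product of a
loop of rotations of that plane and of a loop that fixes `eᵢ`. -/
theorem exists_homotopic_rotationLoop_mul {γ : C(I, Matrix (Fin 3 ⊕ Fin 4) (Fin 3 ⊕ Fin 4) ℝ)}
    (hγ : IsO34Loop γ) (hij : i ≠ j) (hs : sgn34 j = sgn34 i)
    (hsupp : ∀ s l, l ≠ i → l ≠ j → (γ s *ᵥ Pi.single i 1) l = 0) :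
    ∃ γ' n, IsO34Loop γ' ∧ O34Homotopic γ (rotationLoop i j n * γ') ∧
      (∀ s, γ' s *ᵥ Pi.single i 1 = Pi.single i 1) ∧
      ∀ l, l ≠ i → l ≠ j → (∀ s, γ s *ᵥ Pi.single l 1 = Pi.single l 1) →
        ∀ s, γ' s *ᵥ Pi.single l 1 = Pi.single l 1 := by
  set w : I → (Fin 3 ⊕ Fin 4 → ℝ) := fun s => γ s *ᵥ Pi.single i 1 with hw
  have hwc : Continuous w := γ.continuous.matrix_mulVec continuous_const
  have hw0 : w 0 = Pi.single i 1 := by simp only [hw, hγ.2.1, Matrix.one_mulVec]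
  have hw1 : w 1 = Pi.single i 1 := by simp only [hw, hγ.2.2, Matrix.one_mulVec]
  have hws : ∀ s, w s i ^ 2 + w s j ^ 2 = 1 := fun s => by
    have h := (mem_O34_iff _).1 (hγ.1 s) (Pi.single i 1) (Pi.single i 1)
    rw [form34_of_support (i := i) fun l hl => hsupp s l (fun h => hl (h ▸ rfl))
      (fun h => hl (h ▸ hs)), form34_single_single, dotProduct,
      Finset.sum_eq_add i j hij (fun l _ hl => by rw [hsupp s l hl.1 hl.2, mul_zero])
      (by simp) (by simp)] at h
    have := mul_left_cancel₀ (sgn34_ne_zero i) (h.trans (mul_one _).symm)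
    simp only [hw]
    linarith
  -- lift the orbit path to an angle
  let z : C(I, Circle) := ⟨fun s => ⟨(w s i : ℂ) + w s j * Complex.I, by
      change _ ∈ Metric.sphere (0 : ℂ) 1
      have h : ‖(w s i : ℂ) + w s j * Complex.I‖ ^ 2 = 1 := by
        rw [Complex.sq_norm, Complex.normSq_add_mul_I, hws]
      rw [mem_sphere_zero_iff_norm]
      exact (pow_eq_one_iff_of_nonneg (norm_nonneg _) two_ne_zero).1 h⟩, by
      refine Continuous.subtype_mk ?_ _
      fun_prop⟩
  have hz : ∀ s, ((z s : Circle) : ℂ) = (w s i : ℂ) + w s j * Complex.I := fun s => rfl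
  obtain ⟨θ, hθ, hθ0⟩ := Circle.isCoveringMap_exp.exists_path_lifts z 0 (by
    ext
    rw [hz, hw0]
    simp [hij.symm])
  have hcs : ∀ s, w s i = Real.cos (θ s) ∧ w s j = Real.sin (θ s) := fun s => by
    have h : ((Circle.exp (θ s) : Circle) : ℂ) = (w s i : ℂ) + w s j * Complex.I :=
      congrArg Subtype.val (congrFun hθ s)
    rw [Circle.coe_exp, Complex.exp_mul_I] at h
    have h1 := congrArg Complex.re h
    have h2 := congrArg Complex.im h
    simp [Complex.cos_ofReal_re, Complex.sin_ofReal_re] at h1 h2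
    exact ⟨h1.symm, h2.symm⟩
  obtain ⟨n, hn⟩ : ∃ n : ℤ, θ 1 = 2 * Real.pi * n := by
    have h : Circle.exp (θ 1) = 1 := by
      have h := congrFun hθ 1
      rw [Function.comp_apply] at h
      rw [h]
      ext
      rw [hz, hw1]
      simp [hij.symm]
    obtain ⟨n, hn⟩ := Circle.exp_eq_one.1 h
    exact ⟨n, by rw [hn]; ring⟩
  have hcont : Continuous fun s => rotationMatrix i j (-θ s) * γ s :=
    (continuous_rotationMatrix.comp (by fun_prop)).matrix_mul γ.continuous
  have hloop : IsO34Loop ⟨_, hcont⟩ := by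
    refine ⟨fun s => mul_mem_O34 (rotationMatrix_mem_O34 hij hs _) (hγ.1 s), ?_, ?_⟩
    · simp only [ContinuousMap.coe_mk]
      rw [hθ0, neg_zero, rotationMatrix_zero, hγ.2.1, one_mul]
    · simp only [ContinuousMap.coe_mk]
      rw [hn, ← mul_neg, ← Int.cast_neg, rotationMatrix_two_pi_mul_int, hγ.2.2, one_mul]
  refine ⟨⟨_, hcont⟩, n, hloop, ?_, fun s => ?_, fun l hli hlj hfix s => ?_⟩
  · refine O34Homotopic.of (fun p => rotationMatrix i j ((1 - (p.1 : ℝ)) * θ p.2 +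
      p.1 * (2 * Real.pi * n * p.2)) * (rotationMatrix i j (-θ p.2) * γ p.2)) ?_
      (fun s => ?_) (fun s => ?_) (fun p => ?_) (fun t => ?_)
    · exact (continuous_rotationMatrix.comp (by fun_prop)).matrix_mul
        (hcont.comp continuous_snd)
    · rw [← Matrix.mul_assoc, rotationMatrix_mul hij]
      simp [rotationMatrix_zero]
    · simp [rotationLoop]
    · exact mul_mem_O34 (rotationMatrix_mem_O34 hij hs _) (hloop.1 _)
    · constructor
      · rw [hθ0]
        simp [rotationMatrix_zero, hγ.2.1]
      · have e : (1 - (t : ℝ)) * θ 1 + t * (2 * Real.pi * n * ((1 : I) : ℝ)) =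
            2 * Real.pi * n := by rw [hn, Set.Icc.coe_one]; ring
        rw [e, hn, ← Matrix.mul_assoc, rotationMatrix_mul hij, add_neg_cancel,
          rotationMatrix_zero, hγ.2.2, one_mul]
  · simp only [ContinuousMap.coe_mk]
    rw [← Matrix.mulVec_mulVec, rotationMatrix_mulVec]
    change planeRotation i j (-θ s) (w s) = _
    funext l
    by_cases hi : l = i
    · subst hi
      rw [planeRotation_apply_left hij, (hcs s).1, (hcs s).2, Real.cos_neg, Real.sin_neg,
        Pi.single_eq_same]
      linear_combination Real.cos_sq_add_sin_sq (θ s)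
    · by_cases hj : l = j
      · subst hj
        rw [planeRotation_apply_right hij, (hcs s).1, (hcs s).2, Real.cos_neg, Real.sin_neg,
          Pi.single_eq_of_ne hi]
        ring
      · rw [planeRotation_apply_of_ne hi hj, Pi.single_eq_of_ne hi]
        exact hsupp s l hi hj
  · simp only [ContinuousMap.coe_mk]
    rw [← Matrix.mulVec_mulVec, hfix, rotationMatrix_mulVec, planeRotation_apply,
      Pi.single_eq_of_ne hli.symm, Pi.single_eq_of_ne hlj.symm]
    simp

/-- A loop whose `eᵢ`-orbit lies on the line of `eᵢ` fixes `eᵢ`. -/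
theorem fix_of_support_singleton {γ : C(I, Matrix (Fin 3 ⊕ Fin 4) (Fin 3 ⊕ Fin 4) ℝ)}
    (hγ : IsO34Loop γ) (hsupp : ∀ s l, l ≠ i → (γ s *ᵥ Pi.single i 1) l = 0) (s : I) :
    γ s *ᵥ Pi.single i 1 = Pi.single i 1 := by
  have hwc : Continuous fun s => (γ s *ᵥ Pi.single i 1) i :=
    (continuous_apply i).comp (γ.continuous.matrix_mulVec continuous_const)
  have hsq : ∀ s, (γ s *ᵥ Pi.single i 1) i ^ 2 = 1 := fun s => by
    have h := (mem_O34_iff _).1 (hγ.1 s) (Pi.single i 1) (Pi.single i 1)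
    rw [form34_single_single, form34_apply,
      Finset.sum_eq_single i (fun l _ hl => by rw [hsupp s l hl]; simp) (by simp)] at h
    have := mul_left_cancel₀ (sgn34_ne_zero i) (h.trans (mul_one _).symm)
    rw [sq, this]
  have h1 : (γ s *ᵥ Pi.single i 1) i = 1 := by
    rcases isPreconnected_univ.eq_one_or_eq_neg_one_of_sq_eq hwc.continuousOn
      (fun s _ => hsq s) with h | h
    · exact h (Set.mem_univ s)
    · have := h (Set.mem_univ 0)
      simp only [hγ.2.1, Matrix.one_mulVec, Pi.single_eq_same, Pi.neg_apply, Pi.one_apply] at this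
      norm_num at this
  funext l
  by_cases hl : l = i
  · rw [hl, h1, Pi.single_eq_same]
  · rw [hsupp s l hl, Pi.single_eq_of_ne hl]

end PlaneRotation

/-- Every loop in `O(3,4)` is homotopic to the product of a loop of rotations of a positive
coordinate plane and of a loop that fixes the positive basis vectors.  The basis vectors are fixed
one after the other. -/
theorem exists_homotopic_fix_positive {γ : C(I, Matrix (Fin 3 ⊕ Fin 4) (Fin 3 ⊕ Fin 4) ℝ)}
    (hγ : IsO34Loop γ) : ∃ m : ℤ, ∃ γ', IsO34Loop γ' ∧
      O34Homotopic γ (rotationLoop (Sum.inl 1) (Sum.inl 2) m * γ') ∧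
      ∀ l, ∀ s, γ' s *ᵥ Pi.single (Sum.inl l) 1 = Pi.single (Sum.inl l) 1 := by
  have hz : ∀ {γ : C(I, Matrix (Fin 3 ⊕ Fin 4) (Fin 3 ⊕ Fin 4) ℝ)}, IsO34Loop γ →
      ∀ i j, j ≠ i → (∀ s, γ s *ᵥ Pi.single j 1 = Pi.single j 1) →
      ∀ s, (γ s *ᵥ Pi.single i 1) j = 0 := fun h i j hij hfix s =>
    mulVec_single_apply_eq_zero (h.1 s) hij (hfix s)
  have c3 : ∀ l : Fin 3, l = 0 ∨ l = 1 ∨ l = 2 := by decide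
  obtain ⟨γ₁, l1, h1, z1, -⟩ := exists_homotopic_boost hγ 0
  obtain ⟨γ₂, l2, h2, f20, -⟩ := exists_homotopic_fix l1 (Sum.inl 0) (Sum.inl 1) (Sum.inl 2)
    (by decide) (by decide) (by decide) rfl rfl (by
      rintro s (l | l) hl
      · exact absurd rfl hl
      · exact z1 s l)
  obtain ⟨γ₃, l3, h3, z3, k3⟩ := exists_homotopic_boost l2 1
  have f30 := k3 (Sum.inl 0) (by decide) f20
  obtain ⟨γ₄, m, l4, h4, f41, k4⟩ := exists_homotopic_rotationLoop_mul (i := Sum.inl 1)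
    (j := Sum.inl 2) l3 (by decide) rfl (by
      rintro s (l | l) hl hl'
      · rcases c3 l with rfl | rfl | rfl
        · exact hz l3 _ _ (by decide) f30 s
        · exact absurd rfl hl
        · exact absurd rfl hl'
      · exact z3 s l)
  have f40 := k4 (Sum.inl 0) (by decide) (by decide) f30
  obtain ⟨γ₅, l5, h5, z5, k5⟩ := exists_homotopic_boost l4 2
  have f50 := k5 (Sum.inl 0) (by decide) f40
  have f51 := k5 (Sum.inl 1) (by decide) f41
  have f52 := fix_of_support_singleton (i := Sum.inl 2) l5 (by
    rintro s (l | l) hl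
    · rcases c3 l with rfl | rfl | rfl
      · exact hz l5 _ _ (by decide) f50 s
      · exact hz l5 _ _ (by decide) f51 s
      · exact absurd rfl hl
    · exact z5 s l)
  have f5 : ∀ l, ∀ s, γ₅ s *ᵥ Pi.single (Sum.inl l) 1 = Pi.single (Sum.inl l) 1 := fun l => by
    rcases c3 l with rfl | rfl | rfl
    exacts [f50, f51, f52]
  have hm : IsO34Loop (rotationLoop (Sum.inl 1) (Sum.inl 2) m) :=
    isO34Loop_rotationLoop (i := Sum.inl 1) (j := Sum.inl 2) (by decide) sgn34_inl m
  have h9 := (O34Homotopic.refl hm).mul h5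
  exact ⟨m, γ₅, l5, ((h1.trans h2).trans h3).trans (h4.trans h9), f5⟩

/-- A loop in `O(3,4)` that fixes the positive basis vectors is homotopic to a loop of rotations of
a negative coordinate plane. -/
theorem exists_homotopic_rotationLoop_of_fix {γ : C(I, Matrix (Fin 3 ⊕ Fin 4) (Fin 3 ⊕ Fin 4) ℝ)}
    (hγ : IsO34Loop γ)
    (hfix : ∀ l, ∀ s, γ s *ᵥ Pi.single (Sum.inl l) 1 = Pi.single (Sum.inl l) 1) :
    ∃ n : ℤ, O34Homotopic γ (rotationLoop (Sum.inr 2) (Sum.inr 3) n) := by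
  have hz : ∀ {γ : C(I, Matrix (Fin 3 ⊕ Fin 4) (Fin 3 ⊕ Fin 4) ℝ)}, IsO34Loop γ →
      ∀ i j, j ≠ i → (∀ s, γ s *ᵥ Pi.single j 1 = Pi.single j 1) →
      ∀ s, (γ s *ᵥ Pi.single i 1) j = 0 := fun h i j hij hfix s =>
    mulVec_single_apply_eq_zero (h.1 s) hij (hfix s)
  have c4 : ∀ l : Fin 4, l = 0 ∨ l = 1 ∨ l = 2 ∨ l = 3 := by decide
  obtain ⟨γ₆, l6, h6, f60, k6⟩ := exists_homotopic_fix hγ (Sum.inr 0) (Sum.inr 1) (Sum.inr 2)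
    (by decide) (by decide) (by decide) rfl rfl (by
      rintro s (l | l) hl
      · exact hz hγ _ _ (by simp) (hfix l) s
      · exact absurd rfl hl)
  have f6 : ∀ l, ∀ s, γ₆ s *ᵥ Pi.single (Sum.inl l) 1 = Pi.single (Sum.inl l) 1 := fun l =>
    k6 _ (by simp) (by simp) (by simp) (hfix l)
  obtain ⟨γ₇, l7, h7, f71, k7⟩ := exists_homotopic_fix l6 (Sum.inr 1) (Sum.inr 2) (Sum.inr 3)
    (by decide) (by decide) (by decide) rfl rfl (by
      rintro s (l | l) hl
      · exact hz l6 _ _ (by simp) (f6 l) s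
      · exact absurd rfl hl)
  have f7 : ∀ l, ∀ s, γ₇ s *ᵥ Pi.single (Sum.inl l) 1 = Pi.single (Sum.inl l) 1 := fun l =>
    k7 _ (by simp) (by simp) (by simp) (f6 l)
  have f70 := k7 (Sum.inr 0) (by decide) (by decide) (by decide) f60
  obtain ⟨γ₈, n, l8, h8, f82, k8⟩ := exists_homotopic_rotationLoop_mul (i := Sum.inr 2)
    (j := Sum.inr 3) l7 (by decide) rfl (by
      rintro s (l | l) hl hl'
      · exact hz l7 _ _ (by simp) (f7 l) s
      · rcases c4 l with rfl | rfl | rfl | rfl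
        · exact hz l7 _ _ (by decide) f70 s
        · exact hz l7 _ _ (by decide) f71 s
        · exact absurd rfl hl
        · exact absurd rfl hl')
  have f8 : ∀ l, ∀ s, γ₈ s *ᵥ Pi.single (Sum.inl l) 1 = Pi.single (Sum.inl l) 1 := fun l =>
    k8 _ (by simp) (by simp) (f7 l)
  have f80 := k8 (Sum.inr 0) (by decide) (by decide) f70
  have f81 := k8 (Sum.inr 1) (by decide) (by decide) f71
  have f83 := fix_of_support_singleton (i := Sum.inr 3) l8 (by
    rintro s (l | l) hl
    · exact hz l8 _ _ (by simp) (f8 l) s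
    · rcases c4 l with rfl | rfl | rfl | rfl
      · exact hz l8 _ _ (by decide) f80 s
      · exact hz l8 _ _ (by decide) f81 s
      · exact hz l8 _ _ (by decide) f82 s
      · exact absurd rfl hl)
  have h81 : γ₈ = 1 := ContinuousMap.ext fun s => Matrix.ext_of_mulVec_single fun l => by
    rw [ContinuousMap.one_apply, Matrix.one_mulVec]
    rcases l with l | l
    · exact f8 l s
    · rcases c4 l with rfl | rfl | rfl | rfl
      exacts [f80 s, f81 s, f82 s, f83 s]
  rw [h81, mul_one] at h8
  exact ⟨n, (h6.trans h7).trans h8⟩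

/-- The fundamental group of `O(3,4)` has at most four elements. -/
theorem exists_homotopic_parity {γ : C(I, Matrix (Fin 3 ⊕ Fin 4) (Fin 3 ⊕ Fin 4) ℝ)}
    (hγ : IsO34Loop γ) : ∃ p : Fin 2 × Fin 2, O34Homotopic γ
      (rotationLoop (Sum.inl 1) (Sum.inl 2) (p.1 : ℕ) *
        rotationLoop (Sum.inr 2) (Sum.inr 3) (p.2 : ℕ)) := by
  obtain ⟨m, γ', hγ', h1, hfix⟩ := exists_homotopic_fix_positive hγ
  obtain ⟨n, h2⟩ := exists_homotopic_rotationLoop_of_fix hγ' hfix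
  have hm := rotationLoop_homotopic_emod_two (i := Sum.inl 1) (j := Sum.inl 2) (k := Sum.inl 0)
    (by decide) (by decide) (by decide) rfl rfl m
  have hn := rotationLoop_homotopic_emod_two (i := Sum.inr 2) (j := Sum.inr 3) (k := Sum.inr 0)
    (by decide) (by decide) (by decide) rfl rfl n
  have hf : ∀ a : ℤ, ∃ b : Fin 2, a % 2 = (b : ℕ) := fun a => by
    rcases Int.emod_two_eq_zero_or_one a with h | h
    · exact ⟨0, by simpa using h⟩
    · exact ⟨1, by simpa using h⟩
  obtain ⟨a, ha⟩ := hf m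
  obtain ⟨b, hb⟩ := hf n
  rw [ha] at hm
  rw [hb] at hn
  have hl : IsO34Loop (rotationLoop (Sum.inl 1) (Sum.inl 2) m) :=
    isO34Loop_rotationLoop (i := Sum.inl 1) (j := Sum.inl 2) (by decide) sgn34_inl m
  exact ⟨(a, b), (h1.trans ((O34Homotopic.refl hl).mul h2)).trans (hm.mul hn)⟩

/-! ### The universal covering group of `SO₀(3,4)` -/

/-- The covering homomorphism from the universal covering group, `[γ] ↦ γ 1`. -/
def universalCoveringHom (G : Type*) [TopologicalSpace G] [Group G] [IsTopologicalGroup G] :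
    UniversalCoveringGroup G →* G :=
  QuotientGroup.lift (nullhomotopicLoops G)
    { toFun := fun γ => γ.1 1
      map_one' := rfl
      map_mul' := fun _ _ => rfl } (by
    rintro γ ⟨F⟩
    have := F.eq_fst 0 (x := 1) (by simp)
    have h1 := F.prop' 1 1 (by simp)
    simp at h1
    exact h1.symm)

theorem universalCoveringHom_mk {G : Type*} [TopologicalSpace G] [Group G] [IsTopologicalGroup G]
    (γ : basedPaths G) :
    universalCoveringHom G (QuotientGroup.mk' (nullhomotopicLoops G) γ) = γ.1 1 := rfl

theorem continuous_universalCoveringHom (G : Type*) [TopologicalSpace G] [Group G]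
    [IsTopologicalGroup G] : Continuous (universalCoveringHom G) :=
  continuous_quot_lift _ ((continuous_eval_const (1 : I)).comp continuous_subtype_val)

/-- Homotopic based paths represent the same element of the universal covering group. -/
theorem universalCoveringGroup_mk_eq {G : Type*} [TopologicalSpace G] [Group G]
    [IsTopologicalGroup G] {γ γ' : basedPaths G} (F : I × I → G) (hF : Continuous F)
    (h0 : ∀ s, F (0, s) = γ.1 s) (h1 : ∀ s, F (1, s) = γ'.1 s)
    (hs : ∀ t, F (t, 0) = 1 ∧ F (t, 1) = γ'.1 1) :
    QuotientGroup.mk' (nullhomotopicLoops G) γ = QuotientGroup.mk' (nullhomotopicLoops G) γ' := by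
  rw [QuotientGroup.mk'_apply, QuotientGroup.mk'_apply, QuotientGroup.eq]
  have hγ' : γ'.1 0 = 1 := γ'.2
  have hγ : γ.1 0 = 1 := γ.2
  refine ⟨{ toFun := fun p => (F (p.1, p.2))⁻¹ * γ'.1 p.2
            continuous_toFun := by fun_prop
            map_zero_left := fun s => by simp [h0]
            map_one_left := fun s => by simp [h1]
            prop' := ?_ }⟩
  intro t s hs'
  have e1 : F (0, 1) = γ'.1 1 := (hs 0).2
  rw [h0] at e1
  rcases hs' with rfl | hs'
  · simp [(hs t).1, hγ', hγ]
  · rw [Set.mem_singleton_iff] at hs'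
    subst hs'
    simp [(hs t).2, e1]

/-- The matrix of an element of `SO₀(3,4)`. -/
def so34Matrix (A : SO34Zero) : Matrix (Fin 3 ⊕ Fin 4) (Fin 3 ⊕ Fin 4) ℝ := A.1.1.1

theorem continuous_so34Matrix : Continuous so34Matrix := by
  have h1 : Continuous fun A : SO34Zero => A.1 := continuous_subtype_val
  have h2 : Continuous fun A : SO34 => A.1 := continuous_subtype_val
  have h3 : Continuous fun A : Matrix.SpecialLinearGroup (Fin 3 ⊕ Fin 4) ℝ => A.1 :=
    continuous_subtype_val
  exact h3.comp (h2.comp h1)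

theorem so34Matrix_injective : Function.Injective so34Matrix := fun _ _ h =>
  Subtype.ext (Subtype.ext (Subtype.ext h))

/-- A continuous family of matrices in `O(3,4)` over a connected space that meets the identity
lies in `SO₀(3,4)`. -/
theorem exists_lift_so34Zero {X : Type*} [TopologicalSpace X] [PreconnectedSpace X]
    {F : X → Matrix (Fin 3 ⊕ Fin 4) (Fin 3 ⊕ Fin 4) ℝ} (hF : Continuous F)
    (hmem : ∀ x, F x ∈ O34) {x₀ : X} (h0 : F x₀ = 1) :
    ∃ F' : X → SO34Zero, Continuous F' ∧ ∀ x, so34Matrix (F' x) = F x := by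
  have hJ : Matrix.det J34 ≠ 0 := by
    rw [J34, LieAlgebra.Orthogonal.indefiniteDiagonal, Matrix.det_diagonal]
    rw [Fintype.prod_sum_type]
    simp
  have hsq : ∀ x, (F x).det ^ 2 = 1 := fun x => by
    have h : (F x).transpose * J34 * F x = J34 := hmem x
    have h := congrArg Matrix.det h
    rw [Matrix.det_mul, Matrix.det_mul, Matrix.det_transpose] at h
    exact mul_right_cancel₀ hJ (by linear_combination h)
  have hdet : ∀ x, (F x).det = 1 := fun x => by
    rcases isPreconnected_univ.eq_one_or_eq_neg_one_of_sq_eq hF.matrix_det.continuousOn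
      (fun x _ => hsq x) with h | h
    · exact h (Set.mem_univ x)
    · have := h (Set.mem_univ x₀)
      simp only [h0, Matrix.det_one, Pi.neg_apply, Pi.one_apply] at this
      norm_num at this
  let F₁ : X → SO34 := fun x => ⟨⟨F x, hdet x⟩, hmem x⟩
  have hF₁ : Continuous F₁ := (hF.subtype_mk _).subtype_mk _
  have h1 : (1 : SO34) ∈ Set.range F₁ := ⟨x₀, Subtype.ext (Subtype.ext h0)⟩
  have hsub : ∀ x, F₁ x ∈ Subgroup.connectedComponentOfOne SO34 := fun x =>
    (isPreconnected_range hF₁).subset_connectedComponent h1 ⟨x, rfl⟩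
  exact ⟨fun x => ⟨F₁ x, hsub x⟩, hF₁.subtype_mk _, fun x => rfl⟩

/-- The covering homomorphism onto `SO₀(3,4)` has finite kernel. -/
theorem finite_ker_universalCoveringHom :
    Finite (universalCoveringHom SO34Zero).ker := by
  have hrep : ∀ k : (universalCoveringHom SO34Zero).ker, ∃ γ : basedPaths SO34Zero,
      QuotientGroup.mk' (nullhomotopicLoops SO34Zero) γ = k.1 := fun k =>
    QuotientGroup.mk'_surjective _ k.1
  choose γ hγ using hrep
  let M : (universalCoveringHom SO34Zero).ker →
      C(I, Matrix (Fin 3 ⊕ Fin 4) (Fin 3 ⊕ Fin 4) ℝ) := fun k =>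
    ⟨fun s => so34Matrix ((γ k).1 s), continuous_so34Matrix.comp (γ k).1.continuous⟩
  have hγ0 : ∀ k, (γ k).1 0 = 1 := fun k => (γ k).2
  have hγ1 : ∀ k, (γ k).1 1 = 1 := fun k => by
    rw [← universalCoveringHom_mk, hγ]
    exact k.2
  have hM : ∀ k, IsO34Loop (M k) := fun k =>
    ⟨fun s => ((γ k).1 s).1.2, congrArg so34Matrix (hγ0 k), congrArg so34Matrix (hγ1 k)⟩
  choose p hp using fun k => exists_homotopic_parity (hM k)
  refine Finite.of_injective p fun k k' hkk => ?_
  have h := (hp k).trans ((hkk ▸ hp k').symm)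
  obtain ⟨F⟩ := h
  obtain ⟨F', hF', hFF⟩ := exists_lift_so34Zero (F := F) (x₀ := (0, 0)) F.continuous
    (fun x => (F.prop x.1).1 x.2) (by
      rw [F.apply_zero]; exact (hM k).2.1)
  apply Subtype.ext
  rw [← hγ k, ← hγ k']
  refine universalCoveringGroup_mk_eq F' hF' (fun s => ?_) (fun s => ?_) (fun t => ⟨?_, ?_⟩)
  · apply so34Matrix_injective
    rw [hFF, F.apply_zero]; rfl
  · apply so34Matrix_injective
    rw [hFF, F.apply_one]; rfl
  · apply so34Matrix_injective
    rw [hFF]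
    exact (F.prop t).2.1
  · apply so34Matrix_injective
    rw [hFF, hγ1]
    exact (F.prop t).2.2

/-! ### Automorphisms of the split Cayley algebra -/

namespace SplitCayley

theorem mul_def (x y : SplitCayley) : mul x y =
    (x.1 * y.1 + x.2.2.1 ⬝ᵥ y.2.2.2, x.2.1 * y.2.1 + x.2.2.2 ⬝ᵥ y.2.2.1,
      x.1 • y.2.2.1 + y.2.1 • x.2.2.1 - x.2.2.2 ⨯₃ y.2.2.2,
      y.1 • x.2.2.2 + x.2.1 • y.2.2.2 + x.2.2.1 ⨯₃ y.2.2.1) := rfl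

theorem ext_coord {x y : SplitCayley} (h1 : x.1 = y.1) (h2 : x.2.1 = y.2.1)
    (h3 : ∀ i, x.2.2.1 i = y.2.2.1 i) (h4 : ∀ i, x.2.2.2 i = y.2.2.2 i) : x = y :=
  Prod.ext h1 (Prod.ext h2 (Prod.ext (funext h3) (funext h4)))

/-- The automorphism given by a multiplicative linear map with a linear inverse. -/
noncomputable def autOf (f g : SplitCayley →ₗ[ℝ] SplitCayley) (hfg : ∀ x, f (g x) = x)
    (hgf : ∀ x, g (f x) = x) (hf : ∀ x y, f (mul x y) = mul (f x) (f y)) :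
    automorphismGroup :=
  ⟨⟨LinearMap.toContinuousLinearMap f, LinearMap.toContinuousLinearMap g,
    ContinuousLinearMap.ext hfg, ContinuousLinearMap.ext hgf⟩, hf⟩

theorem aut_ext {φ ψ : automorphismGroup} (h : ∀ x, φ.1.1 x = ψ.1.1 x) : φ = ψ :=
  Subtype.ext (Units.ext (ContinuousLinearMap.ext h))

theorem aut_mul_apply (φ ψ : automorphismGroup) (x : SplitCayley) :
    (φ * ψ).1.1 x = φ.1.1 (ψ.1.1 x) := rfl

theorem aut_map_mul (φ : automorphismGroup) (x y : SplitCayley) :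
    φ.1.1 (mul x y) = mul (φ.1.1 x) (φ.1.1 y) := φ.2 x y

theorem continuous_aut {X : Type*} [TopologicalSpace X] {f : X → automorphismGroup}
    (h : ∀ c, Continuous fun x => (f x).1.1 c) (h' : ∀ c, Continuous fun x => (f x)⁻¹.1.1 c) :
    Continuous f := by
  refine Continuous.subtype_mk (f := fun x => (f x).1) ?_ _
  rw [Units.continuous_iff]
  exact ⟨continuous_clm_apply.2 h, continuous_clm_apply.2 h'⟩

theorem continuous_aut_apply (c : SplitCayley) :
    Continuous fun φ : automorphismGroup => φ.1.1 c :=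
  continuous_clm_apply.1 (Units.continuous_val.comp continuous_subtype_val) c

/-- The linear map underlying `uAut`. -/
def uLin (w : Fin 3 → ℝ) : SplitCayley →ₗ[ℝ] SplitCayley where
  toFun x := (x.1 - w ⬝ᵥ x.2.2.2, x.2.1 + w ⬝ᵥ x.2.2.2,
    x.2.2.1 + (x.1 - x.2.1 - w ⬝ᵥ x.2.2.2) • w, x.2.2.2 + w ⨯₃ x.2.2.1)
  map_add' x y := by
    refine ext_coord ?_ ?_ (fun i => ?_) (fun i => ?_) <;> try fin_cases i
    all_goals
      simp [dotProduct, Fin.sum_univ_three, cross_apply, Matrix.vecHead, Matrix.vecTail]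
      ring
  map_smul' c x := by
    refine ext_coord ?_ ?_ (fun i => ?_) (fun i => ?_) <;> try fin_cases i
    all_goals
      simp [dotProduct, Fin.sum_univ_three, cross_apply, Matrix.vecHead, Matrix.vecTail]
      ring

theorem uLin_apply (w : Fin 3 → ℝ) (x : SplitCayley) :
    uLin w x = (x.1 - w ⬝ᵥ x.2.2.2, x.2.1 + w ⬝ᵥ x.2.2.2,
      x.2.2.1 + (x.1 - x.2.1 - w ⬝ᵥ x.2.2.2) • w, x.2.2.2 + w ⨯₃ x.2.2.1) := rfl

theorem uLin_add_smul (s t : ℝ) (w : Fin 3 → ℝ) (x : SplitCayley) :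
    uLin (s • w) (uLin (t • w) x) = uLin ((s + t) • w) x := by
  simp only [uLin_apply]
  refine ext_coord ?_ ?_ (fun i => ?_) (fun i => ?_) <;> try fin_cases i
  all_goals simp [dotProduct, Fin.sum_univ_three, cross_apply, Matrix.vecHead, Matrix.vecTail]; ring

theorem uLin_zero (x : SplitCayley) : uLin 0 x = x := by
  simp [uLin_apply]

theorem uLin_neg (w : Fin 3 → ℝ) (x : SplitCayley) : uLin w (uLin (-w) x) = x := by
  have := uLin_add_smul 1 (-1) w x
  rw [one_smul, neg_one_smul, add_neg_cancel, zero_smul, uLin_zero] at this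
  exact this

theorem uLin_mul (w : Fin 3 → ℝ) (x y : SplitCayley) :
    uLin w (mul x y) = mul (uLin w x) (uLin w y) := by
  simp only [uLin_apply, mul_def]
  refine ext_coord ?_ ?_ (fun i => ?_) (fun i => ?_) <;> try fin_cases i
  all_goals simp [dotProduct, Fin.sum_univ_three, cross_apply, Matrix.vecHead, Matrix.vecTail]; ring

/-- The exponential of the nilpotent derivation of the split Cayley algebra that sends the
idempotent `(1, 0, 0, 0)` to `(0, 0, w, 0)`.  For `w` on a coordinate axis these are the elements
of a short root subgroup. -/
noncomputable def uAut (w : Fin 3 → ℝ) : automorphismGroup :=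
  autOf (uLin w) (uLin (-w)) (uLin_neg w) (fun x => by simpa using uLin_neg (-w) x) (uLin_mul w)

theorem uAut_apply (w : Fin 3 → ℝ) (x : SplitCayley) : (uAut w).1.1 x = uLin w x := rfl

theorem uAut_inv (w : Fin 3 → ℝ) : (uAut w)⁻¹ = uAut (-w) := by
  rw [inv_eq_iff_mul_eq_one]
  exact aut_ext fun x => uLin_neg w x

theorem uAut_zero : uAut 0 = 1 := aut_ext uLin_zero

theorem uAut_add_smul (s t : ℝ) (w : Fin 3 → ℝ) :
    uAut ((s + t) • w) = uAut (s • w) * uAut (t • w) :=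
  aut_ext fun x => (uLin_add_smul s t w x).symm

theorem continuous_cross {X : Type*} [TopologicalSpace X] {f g : X → (Fin 3 → ℝ)}
    (hf : Continuous f) (hg : Continuous g) : Continuous fun x => f x ⨯₃ g x := by
  refine continuous_pi fun i => ?_
  fin_cases i <;> simp [cross_apply] <;> fun_prop

theorem continuous_uLin (c : SplitCayley) : Continuous fun w => uLin w c := by
  simp only [uLin_apply]
  have h1 : Continuous fun w : Fin 3 → ℝ => w ⨯₃ c.2.2.1 :=
    continuous_cross continuous_id continuous_const
  have h2 : Continuous fun w : Fin 3 → ℝ => w ⬝ᵥ c.2.2.2 :=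
    continuous_id.dotProduct continuous_const
  fun_prop

theorem continuous_uAut : Continuous uAut := by
  refine continuous_aut continuous_uLin fun c => ?_
  simp only [uAut_inv]
  exact (continuous_uLin c).comp continuous_neg

/-- The automorphism that exchanges the two idempotents of the diagonal. -/
def flipLin : SplitCayley →ₗ[ℝ] SplitCayley where
  toFun x := (x.2.1, x.1, -x.2.2.2, -x.2.2.1)
  map_add' x y := by
    refine ext_coord ?_ ?_ (fun i => ?_) (fun i => ?_) <;> simp <;> ring
  map_smul' c x := by
    refine ext_coord ?_ ?_ (fun i => ?_) (fun i => ?_) <;> simp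

theorem flipLin_apply (x : SplitCayley) : flipLin x = (x.2.1, x.1, -x.2.2.2, -x.2.2.1) := rfl

theorem flipLin_flipLin (x : SplitCayley) : flipLin (flipLin x) = x := by
  simp [flipLin_apply]

theorem flipLin_mul (x y : SplitCayley) : flipLin (mul x y) = mul (flipLin x) (flipLin y) := by
  simp only [flipLin_apply, mul_def]
  refine ext_coord ?_ ?_ (fun i => ?_) (fun i => ?_) <;> try fin_cases i
  all_goals
    simp [dotProduct, Fin.sum_univ_three, cross_apply, Matrix.vecHead, Matrix.vecTail]
    try ring

/-- The automorphism `(a, b, u, v) ↦ (b, a, -v, -u)`. -/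
noncomputable def flipAut : automorphismGroup :=
  autOf flipLin flipLin flipLin_flipLin flipLin_flipLin flipLin_mul

theorem flipAut_mul_self : flipAut * flipAut = 1 := aut_ext flipLin_flipLin

/-- The unipotent automorphisms opposite to `uAut w`: the exponentials of the derivations that send
`(1, 0, 0, 0)` to `(0, 0, 0, -w)`. -/
noncomputable def lAut (w : Fin 3 → ℝ) : automorphismGroup := flipAut * uAut (-w) * flipAut

theorem lAut_apply (w : Fin 3 → ℝ) (x : SplitCayley) : (lAut w).1.1 x =
    (x.1 + w ⬝ᵥ x.2.2.1, x.2.1 - w ⬝ᵥ x.2.2.1, x.2.2.1 - w ⨯₃ x.2.2.2,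
      x.2.2.2 - (x.1 - x.2.1 + w ⬝ᵥ x.2.2.1) • w) := by
  change flipLin (uLin (-w) (flipLin x)) = _
  simp only [flipLin_apply, uLin_apply]
  refine ext_coord ?_ ?_ (fun i => ?_) (fun i => ?_) <;> try fin_cases i
  all_goals
    simp [dotProduct, Fin.sum_univ_three, cross_apply, Matrix.vecHead, Matrix.vecTail]
    try ring

theorem lAut_zero : lAut 0 = 1 := by
  rw [lAut, neg_zero, uAut_zero, mul_one, flipAut_mul_self]

theorem lAut_add_smul (s t : ℝ) (w : Fin 3 → ℝ) :
    lAut ((s + t) • w) = lAut (s • w) * lAut (t • w) := by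
  have : lAut (s • w) * lAut (t • w) =
      flipAut * (uAut (s • -w) * (flipAut * flipAut) * uAut (t • -w)) * flipAut := by
    simp only [lAut, smul_neg, mul_assoc]
  rw [this, flipAut_mul_self, mul_one, ← uAut_add_smul, smul_neg]
  rfl

theorem lAut_inv (w : Fin 3 → ℝ) : (lAut w)⁻¹ = lAut (-w) := by
  rw [inv_eq_iff_mul_eq_one]
  have := lAut_add_smul 1 (-1) w
  rw [one_smul, neg_one_smul, add_neg_cancel, zero_smul, lAut_zero] at this
  exact this.symm

theorem continuous_lAut : Continuous lAut :=
  (continuous_const.mul (continuous_uAut.comp continuous_neg)).mul continuous_const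

/-- The linear map underlying `sAut`. -/
def sLin (g : Matrix.SpecialLinearGroup (Fin 3) ℝ) : SplitCayley →ₗ[ℝ] SplitCayley where
  toFun x := (x.1, x.2.1, g.1 *ᵥ x.2.2.1, (g⁻¹).1ᵀ *ᵥ x.2.2.2)
  map_add' x y := by simp [Matrix.mulVec_add]
  map_smul' c x := by simp [Matrix.mulVec_smul]

theorem sLin_apply (g : Matrix.SpecialLinearGroup (Fin 3) ℝ) (x : SplitCayley) :
    sLin g x = (x.1, x.2.1, g.1 *ᵥ x.2.2.1, (g⁻¹).1ᵀ *ᵥ x.2.2.2) := rfl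

theorem mulVec_cross_mulVec (A : Matrix (Fin 3) (Fin 3) ℝ) (u v : Fin 3 → ℝ) :
    (A *ᵥ u) ⨯₃ (A *ᵥ v) = A.adjugateᵀ *ᵥ (u ⨯₃ v) := by
  rw [Matrix.adjugate_fin_three]
  funext i
  fin_cases i <;>
  simp [cross_apply, Matrix.mulVec, dotProduct, Fin.sum_univ_three, Matrix.transpose_apply] <;>
  ring

theorem sLin_one (x : SplitCayley) : sLin 1 x = x := by
  simp [sLin_apply]

theorem sLin_sLin (g h : Matrix.SpecialLinearGroup (Fin 3) ℝ) (x : SplitCayley) :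
    sLin g (sLin h x) = sLin (g * h) x := by
  simp only [sLin_apply, mul_inv_rev, Matrix.SpecialLinearGroup.coe_mul, Matrix.mulVec_mulVec,
    Matrix.transpose_mul]

theorem dotProduct_mulVec_inv (g : Matrix.SpecialLinearGroup (Fin 3) ℝ) (u v : Fin 3 → ℝ) :
    (g.1 *ᵥ u) ⬝ᵥ ((g⁻¹).1ᵀ *ᵥ v) = u ⬝ᵥ v := by
  rw [Matrix.mulVec_transpose, dotProduct_comm, ← Matrix.dotProduct_mulVec, Matrix.mulVec_mulVec,
    ← Matrix.SpecialLinearGroup.coe_mul, inv_mul_cancel, Matrix.SpecialLinearGroup.coe_one,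
    Matrix.one_mulVec, dotProduct_comm]

theorem sLin_mul (g : Matrix.SpecialLinearGroup (Fin 3) ℝ) (x y : SplitCayley) :
    sLin g (mul x y) = mul (sLin g x) (sLin g y) := by
  have h1 := fun u v => dotProduct_mulVec_inv g u v
  have h2 : ∀ u v : Fin 3 → ℝ, (g.1 *ᵥ u) ⨯₃ (g.1 *ᵥ v) = (g⁻¹).1ᵀ *ᵥ (u ⨯₃ v) := fun u v => by
    rw [mulVec_cross_mulVec, Matrix.SpecialLinearGroup.coe_inv]
  have h3 : ∀ u v : Fin 3 → ℝ, ((g⁻¹).1ᵀ *ᵥ u) ⨯₃ ((g⁻¹).1ᵀ *ᵥ v) = g.1 *ᵥ (u ⨯₃ v) :=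
    fun u v => by
      rw [mulVec_cross_mulVec, Matrix.adjugate_transpose, Matrix.transpose_transpose,
        ← Matrix.SpecialLinearGroup.coe_inv, inv_inv]
  simp only [sLin_apply, mul_def, h1, h2, h3, Matrix.mulVec_add, Matrix.mulVec_sub,
    Matrix.mulVec_smul, dotProduct_comm _ (g.1 *ᵥ _), dotProduct_comm _ x.2.2.2]

/-- The action of `SL₃(ℝ)` on the split Cayley algebra. -/
noncomputable def sAut : Matrix.SpecialLinearGroup (Fin 3) ℝ →* automorphismGroup where
  toFun g := autOf (sLin g) (sLin g⁻¹) (fun x => by rw [sLin_sLin, mul_inv_cancel, sLin_one])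
    (fun x => by rw [sLin_sLin, inv_mul_cancel, sLin_one]) (sLin_mul g)
  map_one' := aut_ext sLin_one
  map_mul' g h := aut_ext fun x => (sLin_sLin g h x).symm

theorem sAut_apply (g : Matrix.SpecialLinearGroup (Fin 3) ℝ) (x : SplitCayley) :
    (sAut g).1.1 x = (x.1, x.2.1, g.1 *ᵥ x.2.2.1, (g⁻¹).1ᵀ *ᵥ x.2.2.2) := rfl

theorem continuous_sAut : Continuous sAut := by
  have h1 : Continuous fun g : Matrix.SpecialLinearGroup (Fin 3) ℝ => g.1 := continuous_subtype_val
  have h2 : Continuous fun g : Matrix.SpecialLinearGroup (Fin 3) ℝ => (g⁻¹).1 :=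
    h1.comp continuous_inv
  have key : ∀ c, Continuous fun g => sLin g c := fun c => by
    simp only [sLin_apply]
    exact continuous_const.prodMk (continuous_const.prodMk
      ((h1.matrix_mulVec continuous_const).prodMk
        (h2.matrix_transpose.matrix_mulVec continuous_const)))
  refine continuous_aut key fun c => ?_
  simp only [← map_inv]
  exact (key c).comp continuous_inv

theorem sAut_mul_uAut (g : Matrix.SpecialLinearGroup (Fin 3) ℝ) (w : Fin 3 → ℝ) :
    sAut g * uAut w = uAut (g.1 *ᵥ w) * sAut g := by
  refine aut_ext fun x => ?_
  have h2 : ∀ u v : Fin 3 → ℝ, (g.1 *ᵥ u) ⨯₃ (g.1 *ᵥ v) = (g⁻¹).1ᵀ *ᵥ (u ⨯₃ v) := fun u v => by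
    rw [mulVec_cross_mulVec, Matrix.SpecialLinearGroup.coe_inv]
  simp only [aut_mul_apply, sAut_apply, uAut_apply, uLin_apply, dotProduct_mulVec_inv, h2,
    Matrix.mulVec_add, Matrix.mulVec_smul]

theorem flipAut_mul_sAut (g h : Matrix.SpecialLinearGroup (Fin 3) ℝ) (hgh : h.1 = (g⁻¹).1ᵀ) :
    flipAut * sAut g = sAut h * flipAut := by
  have hh : (h⁻¹).1ᵀ = g.1 := by
    rw [Matrix.SpecialLinearGroup.coe_inv, hgh, Matrix.adjugate_transpose,
      Matrix.transpose_transpose, ← Matrix.SpecialLinearGroup.coe_inv, inv_inv]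
  refine aut_ext fun x => ?_
  change flipLin (sLin g x) = sLin h (flipLin x)
  simp only [flipLin_apply, sLin_apply, hh, hgh, Matrix.mulVec_neg]

theorem sAut_mul_lAut (g : Matrix.SpecialLinearGroup (Fin 3) ℝ) (w : Fin 3 → ℝ) :
    sAut g * lAut w = lAut ((g⁻¹).1ᵀ *ᵥ w) * sAut g := by
  set h : Matrix.SpecialLinearGroup (Fin 3) ℝ := ⟨(g⁻¹).1ᵀ, by
    rw [Matrix.det_transpose]; exact (g⁻¹).2⟩ with hh
  have h1 : sAut g * flipAut = flipAut * sAut h := by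
    have e := flipAut_mul_sAut g h rfl
    calc sAut g * flipAut = flipAut * (flipAut * sAut g) * flipAut := by
          rw [← mul_assoc flipAut, flipAut_mul_self, one_mul]
      _ = flipAut * sAut h := by
          rw [e, mul_assoc, mul_assoc, flipAut_mul_self, mul_one]
  have h2 := flipAut_mul_sAut g h rfl
  rw [lAut, lAut, ← mul_assoc, ← mul_assoc, h1, mul_assoc flipAut, sAut_mul_uAut, Matrix.mulVec_neg,
    mul_assoc, mul_assoc, ← h2]
  simp only [mul_assoc, hh]

end SplitCayley

/-! ### Root subgroups of the automorphism group -/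

/-- One-parameter subgroups of a topological group that satisfy the relations of the root subgroups
of a split group of type `G₂`: `pos k` and `neg k` belong to the `k`-th positive root and to its
negative, and `tor` to the torus.  The last relation is the factorisation of
`!![1, t; 0, 1] * !![1, 0; s, 1]` in `SL₂`. -/
structure G2Pinning (Γ : Type*) [Group Γ] [TopologicalSpace Γ] where
  /-- The positive root subgroups. -/
  pos : Fin 6 → ℝ → Γ
  /-- The negative root subgroups. -/
  neg : Fin 6 → ℝ → Γ
  /-- The identity component of the torus: `tor (a, b)` is the exponential of `a` times the first
  plus `b` times the second simple coroot of the subsystem `A₂` of long roots. -/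
  tor : ℝ × ℝ → Γ
  continuous_pos : ∀ k, Continuous (pos k)
  continuous_neg : ∀ k, Continuous (neg k)
  continuous_tor : Continuous tor
  pos_add : ∀ k s t, pos k (s + t) = pos k s * pos k t
  neg_add : ∀ k s t, neg k (s + t) = neg k s * neg k t
  tor_add : ∀ x y, tor (x + y) = tor x * tor y
  tor_mul_pos : ∀ k x t, tor x * pos k t =
    pos k (Real.exp (g2Root₁ k * x.1 + g2Root₂ k * x.2) * t) * tor x
  tor_mul_neg : ∀ k x t, tor x * neg k t =
    neg k (Real.exp (-(g2Root₁ k * x.1 + g2Root₂ k * x.2)) * t) * tor x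
  pos_mul_neg : ∀ k t s, |t| < 1 → |s| < 1 → pos k t * neg k s = neg k (s / (1 + t * s)) *
    tor (g2Coroot₁ k * Real.log (1 + t * s), g2Coroot₂ k * Real.log (1 + t * s)) *
      pos k (t / (1 + t * s))

namespace SplitCayley

/-- The transvection `1 + t E_ij` as an element of `SL₃(ℝ)`. -/
def xSL (i j : Fin 3) (h : i ≠ j) (t : ℝ) : Matrix.SpecialLinearGroup (Fin 3) ℝ :=
  ⟨Matrix.transvection i j t, Matrix.det_transvection_of_ne i j h t⟩

/-- The diagonal matrices of `SL₃(ℝ)` with positive entries: `torSL (a, b)` is the exponential of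
`a` times the first plus `b` times the second simple coroot of `SL₃`. -/
noncomputable def torSL (x : ℝ × ℝ) : Matrix.SpecialLinearGroup (Fin 3) ℝ :=
  ⟨Matrix.diagonal ![Real.exp x.1, Real.exp (x.2 - x.1), Real.exp (-x.2)], by
    rw [Matrix.det_diagonal, Fin.prod_univ_three]
    simp [← Real.exp_add]⟩

theorem xSL_add (i j : Fin 3) (h : i ≠ j) (s t : ℝ) :
    xSL i j h (s + t) = xSL i j h s * xSL i j h t :=
  Subtype.ext (Matrix.transvection_mul_transvection_same i j h s t).symm

theorem continuous_xSL (i j : Fin 3) (h : i ≠ j) : Continuous (xSL i j h) := by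
  refine Continuous.subtype_mk ?_ _
  refine continuous_const.add (continuous_matrix fun a b => ?_)
  simp only [Matrix.single_apply]
  split_ifs
  · exact continuous_id
  · exact continuous_const

theorem torSL_add (x y : ℝ × ℝ) : torSL (x + y) = torSL x * torSL y := by
  refine Subtype.ext ?_
  change Matrix.diagonal _ = Matrix.diagonal _ * Matrix.diagonal _
  rw [Matrix.diagonal_mul_diagonal]
  congr 1
  funext i
  fin_cases i <;> simp [← Real.exp_add] <;> ring

theorem continuous_torSL : Continuous torSL := by
  refine Continuous.subtype_mk (Continuous.matrix_diagonal (continuous_pi fun i => ?_)) _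
  fin_cases i <;> simp <;> fun_prop

theorem torSL_mul_xSL (i j : Fin 3) (h : i ≠ j) (x : ℝ × ℝ) (c t : ℝ)
    (hc : (![x.1, x.2 - x.1, -x.2] : Fin 3 → ℝ) i - (![x.1, x.2 - x.1, -x.2] : Fin 3 → ℝ) j = c) :
    torSL x * xSL i j h t = xSL i j h (Real.exp c * t) * torSL x := by
  refine Subtype.ext ?_
  change Matrix.diagonal _ * (1 + Matrix.single i j t) =
    (1 + Matrix.single i j _) * Matrix.diagonal _
  have e : (![Real.exp x.1, Real.exp (x.2 - x.1), Real.exp (-x.2)] : Fin 3 → ℝ) =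
      fun i => Real.exp ((![x.1, x.2 - x.1, -x.2] : Fin 3 → ℝ) i) := by
    funext i; fin_cases i <;> rfl
  rw [e, mul_add, add_mul, mul_one, one_mul, ← hc, Real.exp_sub]
  congr 1
  ext a b
  rw [Matrix.diagonal_mul, Matrix.mul_diagonal, Matrix.single_apply, Matrix.single_apply]
  split_ifs with hab
  · rw [← hab.1, ← hab.2]
    field_simp
  · simp

theorem torSL_inv (x : ℝ × ℝ) : (torSL x)⁻¹ = torSL (-x) := by
  rw [inv_eq_iff_mul_eq_one, ← torSL_add, add_neg_cancel]
  refine Subtype.ext ?_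
  ext i j
  fin_cases i <;> fin_cases j <;> simp [torSL]

theorem torSL_mulVec (x : ℝ × ℝ) (i : Fin 3) (t : ℝ) : (torSL x).1 *ᵥ (t • Pi.single i 1) =
    (Real.exp ((![x.1, x.2 - x.1, -x.2] : Fin 3 → ℝ) i) * t) • Pi.single i 1 := by
  funext j
  fin_cases i <;> fin_cases j <;> simp [torSL, Matrix.mulVec_diagonal]

theorem torSL_inv_transpose_mulVec (x : ℝ × ℝ) (i : Fin 3) (t : ℝ) :
    ((torSL x)⁻¹).1ᵀ *ᵥ (t • Pi.single i 1) =
    (Real.exp (-(![x.1, x.2 - x.1, -x.2] : Fin 3 → ℝ) i) * t) • Pi.single i 1 := by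
  have : ((torSL (-x)).1)ᵀ = (torSL (-x)).1 := Matrix.diagonal_transpose _
  rw [torSL_inv, this, torSL_mulVec]
  congr 3
  fin_cases i <;> simp; ring

/-- The values of `torSL` on multiples of a coroot. -/
theorem torSL_log (m n : ℤ) {d : ℝ} (hd : 0 < d) :
    (torSL (m * Real.log d, n * Real.log d)).1 =
      Matrix.diagonal ![d ^ m, d ^ (n - m), d ^ (-n)] := by
  have h : ∀ l : ℤ, Real.exp (l * Real.log d) = d ^ l := fun l => by
    rw [mul_comm, ← Real.rpow_def_of_pos hd, Real.rpow_intCast]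
  have h1 := h (n - m)
  have h2 := h (-n)
  push_cast at h1 h2
  change Matrix.diagonal _ = _
  simp only [← h1, ← h2, ← h m, sub_mul, neg_mul]

theorem one_add_mul_pos {s t : ℝ} (ht : |t| < 1) (hs : |s| < 1) : 0 < 1 + t * s := by
  have h : |t * s| < 1 := by
    rw [abs_mul]
    nlinarith [abs_nonneg t, abs_nonneg s]
  linarith [(abs_lt.1 h).1]

/-- The factorisation of a product of opposite transvections.  The integers `m` and `n` are the
coordinates of the coroot. -/
theorem xSL_mul_xSL (i j : Fin 3) (h : i ≠ j) (h' : j ≠ i) (m n : ℤ)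
    (hmn : ∀ d : ℝ, (![d ^ m, d ^ (n - m), d ^ (-n)] : Fin 3 → ℝ) =
      fun l => if l = i then d else if l = j then d⁻¹ else 1) {s t : ℝ} (hd : 0 < 1 + t * s) :
    xSL i j h t * xSL j i h' s = xSL j i h' (s / (1 + t * s)) *
      torSL (m * Real.log (1 + t * s), n * Real.log (1 + t * s)) * xSL i j h (t / (1 + t * s)) := by
  refine Subtype.ext ?_
  change Matrix.transvection i j t * Matrix.transvection j i s =
    Matrix.transvection j i _ * (torSL _).1 * Matrix.transvection i j _
  rw [torSL_log m n hd, hmn]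
  set d := 1 + t * s with hd'
  ext a b
  simp only [Matrix.transvection, Matrix.mul_apply, Fin.sum_univ_three, Matrix.add_apply,
    Matrix.diagonal_apply, Matrix.single_apply, Matrix.one_apply]
  fin_cases i <;> fin_cases j <;> first | exact absurd rfl h | skip
  all_goals
    fin_cases a <;> fin_cases b <;> simp <;> field_simp <;> simp [hd'] <;> ring

end SplitCayley

namespace SplitCayley

theorem torSL_log_inv (m n : ℤ) {d : ℝ} (hd : 0 < d) :
    ((torSL (m * Real.log d, n * Real.log d))⁻¹).1ᵀ =
      Matrix.diagonal fun l => ((![d ^ m, d ^ (n - m), d ^ (-n)] : Fin 3 → ℝ) l)⁻¹ := by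
  have h := torSL_log (-m) (-n) hd
  rw [torSL_inv]
  push_cast at h
  rw [Prod.neg_mk, ← neg_mul, ← neg_mul, h, Matrix.diagonal_transpose]
  congr 1
  funext l
  fin_cases l
  · simp
  · change d ^ (-n - -m) = (d ^ (n - m))⁻¹
    rw [← zpow_neg]
    congr 1
    ring
  · simp

/-- The relation between opposite short root subgroups; `m` and `n` are the coordinates of the
coroot. -/
theorem uAut_mul_lAut (i : Fin 3) (m n : ℤ)
    (hmn : ∀ d : ℝ, d ≠ 0 → (![d ^ m, d ^ (n - m), d ^ (-n)] : Fin 3 → ℝ) =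
      fun l => if l = i then d ^ 2 else d⁻¹) {s t : ℝ} (hd : 0 < 1 + t * s) :
    uAut (t • Pi.single i 1) * lAut (s • Pi.single i 1) =
      lAut ((s / (1 + t * s)) • Pi.single i 1) *
        sAut (torSL (m * Real.log (1 + t * s), n * Real.log (1 + t * s))) *
        uAut ((t / (1 + t * s)) • Pi.single i 1) := by
  refine aut_ext fun x => ?_
  simp only [aut_mul_apply, uAut_apply, lAut_apply, sAut_apply, uLin_apply]
  rw [torSL_log_inv m n hd, torSL_log m n hd, hmn _ hd.ne']
  have hd0 := hd.ne'
  have hd1 : 1 + s * t ≠ 0 := mul_comm t s ▸ hd0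
  refine ext_coord ?_ ?_ (fun j => ?_) (fun j => ?_) <;> fin_cases i <;> try fin_cases j
  all_goals
    simp [dotProduct, Fin.sum_univ_three, cross_apply, Matrix.vecHead, Matrix.vecTail,
      Matrix.mulVec_diagonal, Pi.single_apply]
    try field_simp
    try ring1

/-- The relation `uAut_mul_lAut` for the opposite choice of the positive root. -/
theorem lAut_mul_uAut (i : Fin 3) (m n : ℤ)
    (hmn : ∀ d : ℝ, d ≠ 0 → (![d ^ m, d ^ (n - m), d ^ (-n)] : Fin 3 → ℝ) =
      fun l => if l = i then (d ^ 2)⁻¹ else d) {s t : ℝ} (hd : 0 < 1 + t * s) :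
    lAut (t • Pi.single i 1) * uAut (s • Pi.single i 1) =
      uAut ((s / (1 + t * s)) • Pi.single i 1) *
        sAut (torSL (m * Real.log (1 + t * s), n * Real.log (1 + t * s))) *
        lAut ((t / (1 + t * s)) • Pi.single i 1) := by
  have h := uAut_mul_lAut i (-m) (-n) (fun d hd => ?_) (s := -t) (t := -s)
    (by rw [neg_mul_neg, mul_comm]; exact hd)
  · rw [show 1 + -s * -t = 1 + t * s by ring] at h
    have h' := congrArg (fun z => z⁻¹) h
    simp only [mul_inv_rev, uAut_inv, lAut_inv, ← map_inv, torSL_inv, neg_smul, neg_neg,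
      neg_div, Int.cast_neg, neg_mul, Prod.neg_mk] at h'
    rw [h', mul_assoc]
  · have := congrFun (hmn d⁻¹ (inv_ne_zero hd))
    funext l
    have := this l
    simp only [inv_zpow', inv_pow, inv_inv] at this
    rw [← this]
    congr 3
    ring_nf

/-- The elementary matrices of `SL₃(ℝ)` and the unipotent automorphisms of the split Cayley algebra
satisfy the relations of a split group of type `G₂`. -/
noncomputable def autPinning : G2Pinning automorphismGroup where
  pos := ![fun t => sAut (xSL 0 1 (by decide) t), fun t => sAut (xSL 1 2 (by decide) t),
    fun t => sAut (xSL 0 2 (by decide) t), fun t => uAut (t • Pi.single 0 1),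
    fun t => uAut (t • Pi.single 1 1), fun t => lAut (t • Pi.single 2 1)]
  neg := ![fun t => sAut (xSL 1 0 (by decide) t), fun t => sAut (xSL 2 1 (by decide) t),
    fun t => sAut (xSL 2 0 (by decide) t), fun t => lAut (t • Pi.single 0 1),
    fun t => lAut (t • Pi.single 1 1), fun t => uAut (t • Pi.single 2 1)]
  tor x := sAut (torSL x)
  continuous_pos := by
    have hu : ∀ i : Fin 3, Continuous fun t : ℝ => uAut (t • Pi.single i 1) := fun i =>
      continuous_uAut.comp (by fun_prop)
    have hl : ∀ i : Fin 3, Continuous fun t : ℝ => lAut (t • Pi.single i 1) := fun i =>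
      continuous_lAut.comp (by fun_prop)
    have hx := fun i j h => continuous_sAut.comp (continuous_xSL i j h)
    intro k
    fin_cases k
    · exact hx 0 1 _
    · exact hx 1 2 _
    · exact hx 0 2 _
    · exact hu 0
    · exact hu 1
    · exact hl 2
  continuous_neg := by
    have hu : ∀ i : Fin 3, Continuous fun t : ℝ => uAut (t • Pi.single i 1) := fun i =>
      continuous_uAut.comp (by fun_prop)
    have hl : ∀ i : Fin 3, Continuous fun t : ℝ => lAut (t • Pi.single i 1) := fun i =>
      continuous_lAut.comp (by fun_prop)
    have hx := fun i j h => continuous_sAut.comp (continuous_xSL i j h)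
    intro k
    fin_cases k
    · exact hx 1 0 _
    · exact hx 2 1 _
    · exact hx 2 0 _
    · exact hl 0
    · exact hl 1
    · exact hu 2
  continuous_tor := continuous_sAut.comp continuous_torSL
  pos_add := by
    have hx := fun i j h s t =>
      (congrArg sAut (xSL_add i j h s t)).trans (map_mul sAut (xSL i j h s) (xSL i j h t))
    intro k s t
    fin_cases k
    · exact hx 0 1 _ s t
    · exact hx 1 2 _ s t
    · exact hx 0 2 _ s t
    · exact uAut_add_smul s t _
    · exact uAut_add_smul s t _
    · exact lAut_add_smul s t _
  neg_add := by
    have hx := fun i j h s t =>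
      (congrArg sAut (xSL_add i j h s t)).trans (map_mul sAut (xSL i j h s) (xSL i j h t))
    intro k s t
    fin_cases k
    · exact hx 1 0 _ s t
    · exact hx 2 1 _ s t
    · exact hx 2 0 _ s t
    · exact lAut_add_smul s t _
    · exact lAut_add_smul s t _
    · exact uAut_add_smul s t _
  tor_add x y := by rw [torSL_add, map_mul]
  tor_mul_pos := by
    have hx := fun i j h x c t hc => (map_mul sAut _ _).symm.trans
      ((congrArg sAut (torSL_mul_xSL i j h x c t hc)).trans (map_mul sAut _ _))
    have hu : ∀ (i : Fin 3) (x : ℝ × ℝ) (c t : ℝ), (![x.1, x.2 - x.1, -x.2] : Fin 3 → ℝ) i = c →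
        sAut (torSL x) * uAut (t • Pi.single i 1) =
        uAut ((Real.exp c * t) • Pi.single i 1) * sAut (torSL x) := fun i x c t hc => by
      rw [sAut_mul_uAut, torSL_mulVec, hc]
    have hl : ∀ (i : Fin 3) (x : ℝ × ℝ) (c t : ℝ), -(![x.1, x.2 - x.1, -x.2] : Fin 3 → ℝ) i = c →
        sAut (torSL x) * lAut (t • Pi.single i 1) =
        lAut ((Real.exp c * t) • Pi.single i 1) * sAut (torSL x) := fun i x c t hc => by
      rw [sAut_mul_lAut, torSL_inv_transpose_mulVec, hc]
    intro k x t
    fin_cases k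
    · exact hx 0 1 _ x _ t (by simp [g2Root₁, g2Root₂]; ring)
    · exact hx 1 2 _ x _ t (by simp [g2Root₁, g2Root₂]; ring)
    · exact hx 0 2 _ x _ t (by simp [g2Root₁, g2Root₂])
    · exact hu 0 x _ t (by simp [g2Root₁, g2Root₂])
    · exact hu 1 x _ t (by simp [g2Root₁, g2Root₂]; ring)
    · exact hl 2 x _ t (by simp [g2Root₁, g2Root₂])
  tor_mul_neg := by
    have hx := fun i j h x c t hc => (map_mul sAut _ _).symm.trans
      ((congrArg sAut (torSL_mul_xSL i j h x c t hc)).trans (map_mul sAut _ _))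
    have hu : ∀ (i : Fin 3) (x : ℝ × ℝ) (c t : ℝ), (![x.1, x.2 - x.1, -x.2] : Fin 3 → ℝ) i = c →
        sAut (torSL x) * uAut (t • Pi.single i 1) =
        uAut ((Real.exp c * t) • Pi.single i 1) * sAut (torSL x) := fun i x c t hc => by
      rw [sAut_mul_uAut, torSL_mulVec, hc]
    have hl : ∀ (i : Fin 3) (x : ℝ × ℝ) (c t : ℝ), -(![x.1, x.2 - x.1, -x.2] : Fin 3 → ℝ) i = c →
        sAut (torSL x) * lAut (t • Pi.single i 1) =
        lAut ((Real.exp c * t) • Pi.single i 1) * sAut (torSL x) := fun i x c t hc => by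
      rw [sAut_mul_lAut, torSL_inv_transpose_mulVec, hc]
    intro k x t
    fin_cases k
    · exact hx 1 0 _ x _ t (by simp [g2Root₁, g2Root₂]; ring)
    · exact hx 2 1 _ x _ t (by simp [g2Root₁, g2Root₂]; ring)
    · exact hx 2 0 _ x _ t (by simp [g2Root₁, g2Root₂]; ring)
    · exact hl 0 x _ t (by simp [g2Root₁, g2Root₂])
    · exact hl 1 x _ t (by simp [g2Root₁, g2Root₂]; ring)
    · exact hu 2 x _ t (by simp [g2Root₁, g2Root₂])
  pos_mul_neg := by
    have hx := fun i j h h' m n hmn (t s : ℝ) hd => (map_mul sAut _ _).symm.trans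
      ((congrArg sAut (xSL_mul_xSL i j h h' m n hmn (s := s) (t := t) hd)).trans
        ((map_mul sAut _ _).trans (congrArg (· * _) (map_mul sAut _ _))))
    intro k t s ht hs
    have hd := one_add_mul_pos ht hs
    fin_cases k
    · exact hx 0 1 _ _ 1 0 (fun d => by funext l; fin_cases l <;> simp) t s hd
    · exact hx 1 2 _ _ 0 1 (fun d => by funext l; fin_cases l <;> simp) t s hd
    · exact hx 0 2 _ _ 1 1 (fun d => by funext l; fin_cases l <;> simp) t s hd
    · exact uAut_mul_lAut 0 2 1 (fun d hd => by funext l; fin_cases l <;> simp) hd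
    · exact uAut_mul_lAut 1 (-1) 1 (fun d hd => by funext l; fin_cases l <;> simp) hd
    · exact lAut_mul_uAut 2 1 2 (fun d hd => by funext l; fin_cases l <;> simp) hd

end SplitCayley

/-! ### Generation of the automorphism group near the identity -/

namespace SplitCayley

/-- The idempotent whose stabiliser in the automorphism group is `SL₃(ℝ)`. -/
def idem : SplitCayley := (1, 0, 0, 0)

theorem aut_one_apply (φ : automorphismGroup) : φ.1.1 (1, 1, 0, 0) = (1, 1, 0, 0) := by
  have hl : ∀ x, mul (1, 1, 0, 0) x = x := fun x => by simp [mul_def]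
  have hr : ∀ x, mul x (1, 1, 0, 0) = x := fun x => by simp [mul_def]
  -- the image of the unit is a left unit
  have h : ∀ y, mul (φ.1.1 (1, 1, 0, 0)) y = y := fun y => by
    have hy : φ.1.1 ((φ⁻¹).1.1 y) = y := by
      rw [← aut_mul_apply, mul_inv_cancel]; rfl
    rw [← hy, ← aut_map_mul, hl]
  rw [← hr (φ.1.1 _), h]

/-- The matrix of the map that an automorphism induces on the upper right entries. -/
def uMatrix (φ : automorphismGroup) : Matrix (Fin 3) (Fin 3) ℝ :=
  Matrix.of fun i l => (φ.1.1 (0, 0, Pi.single l 1, 0)).2.2.1 i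

theorem continuous_uMatrix : Continuous uMatrix :=
  continuous_matrix fun i _ =>
    (continuous_apply i).comp (continuous_snd.snd.fst.comp (continuous_aut_apply _))

theorem uMatrix_one : uMatrix 1 = 1 := by
  ext i j
  change (Pi.single j 1 : Fin 3 → ℝ) i = _
  rw [Matrix.one_apply, Pi.single_apply]

/-- An automorphism that fixes `idem` preserves the Peirce decomposition with respect to it, so
that it comes from `SL₃(ℝ)`. -/
theorem eq_sAut_of_fix_idem (φ : automorphismGroup) (h : φ.1.1 idem = idem) :
    ∃ hd : (uMatrix φ).det = 1, φ = sAut ⟨uMatrix φ, hd⟩ := by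
  have hf : φ.1.1 (0, 1, 0, 0) = (0, 1, 0, 0) := by
    have e : ((0, 1, 0, 0) : SplitCayley) = (1, 1, 0, 0) - idem := by simp [idem]
    rw [e, map_sub, aut_one_apply, h]
  -- `(0, 0, u, 0)` are the elements `x` with `idem * x = x` and `x * idem = 0`
  have hU : ∀ u : Fin 3 → ℝ, φ.1.1 (0, 0, u, 0) = (0, 0, uMatrix φ *ᵥ u, 0) := by
    intro u
    have h1 : mul idem (φ.1.1 (0, 0, u, 0)) = φ.1.1 (0, 0, u, 0) := by
      conv_lhs => rw [← h]
      rw [← aut_map_mul]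
      simp [mul_def, idem]
    have h2 : mul (φ.1.1 (0, 0, u, 0)) idem = 0 := by
      conv_lhs => rw [← h]
      rw [← aut_map_mul]
      simp [mul_def, idem]
      exact map_zero φ.1.1
    have h3 : (φ.1.1 (0, 0, u, 0)).2.2.1 = uMatrix φ *ᵥ u := by
      have e : ((0, 0, u, 0) : SplitCayley) =
          ∑ j, u j • ((0, 0, Pi.single j 1, 0) : SplitCayley) := by
        refine ext_coord ?_ ?_ (fun i => ?_) (fun i => ?_) <;>
          simp [Fin.sum_univ_three] <;> fin_cases i <;> simp
      rw [e, map_sum]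
      simp only [map_smul]
      funext i
      simp [Fin.sum_univ_three, uMatrix, Matrix.mulVec, dotProduct, mul_comm]
    rw [mul_def] at h1 h2
    simp [idem, Prod.ext_iff] at h1 h2
    rw [← h3]
    exact Prod.ext h2.1 (Prod.ext h1.1.symm (Prod.ext rfl h1.2.symm))
  obtain ⟨B, hB⟩ : ∃ B : (Fin 3 → ℝ) → (Fin 3 → ℝ), ∀ v, φ.1.1 (0, 0, 0, v) = (0, 0, 0, B v) := by
    refine ⟨fun v => (φ.1.1 (0, 0, 0, v)).2.2.2, fun v => ?_⟩
    have h1 : mul idem (φ.1.1 (0, 0, 0, v)) = 0 := by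
      conv_lhs => rw [← h]
      rw [← aut_map_mul]
      simp [mul_def, idem]
      exact map_zero φ.1.1
    have h2 : mul (φ.1.1 (0, 0, 0, v)) (0, 1, 0, 0) = 0 := by
      conv_lhs => rw [← hf]
      rw [← aut_map_mul]
      simp [mul_def]
      exact map_zero φ.1.1
    rw [mul_def] at h1 h2
    simp [idem, Prod.ext_iff] at h1 h2
    exact Prod.ext h1.1 (Prod.ext h2.1 (Prod.ext h1.2 rfl))
  -- the products of two upper right entries determine the action on the lower left entries
  have hcross : ∀ u u', B (u ⨯₃ u') = (uMatrix φ).adjugateᵀ *ᵥ (u ⨯₃ u') := by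
    intro u u'
    have := aut_map_mul φ (0, 0, u, 0) (0, 0, u', 0)
    rw [hU, hU] at this
    simp [mul_def, hB] at this
    rw [this, mulVec_cross_mulVec]
  have hB' : ∀ v, B v = (uMatrix φ).adjugateᵀ *ᵥ v := by
    have hc : ∀ i : Fin 3, ∃ u u' : Fin 3 → ℝ, (Pi.single i 1 : Fin 3 → ℝ) = u ⨯₃ u' := by
      intro i
      refine ⟨Pi.single (i + 1) 1, Pi.single (i + 2) 1, ?_⟩
      funext j
      fin_cases i <;> fin_cases j <;> simp [cross_apply]
    intro v
    have e : ((0, 0, 0, v) : SplitCayley) =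
        ∑ j, v j • ((0, 0, 0, Pi.single j 1) : SplitCayley) := by
      refine ext_coord ?_ ?_ (fun i => ?_) (fun i => ?_) <;>
        simp [Fin.sum_univ_three] <;> fin_cases i <;> simp
    have e' : v = ∑ j, v j • (Pi.single j 1 : Fin 3 → ℝ) := by
      funext i
      fin_cases i <;> simp [Fin.sum_univ_three]
    have h1 : B v = ∑ j, v j • B (Pi.single j 1) := by
      have := congrArg (fun z : SplitCayley => z.2.2.2) (hB v)
      simp only at this
      rw [← this, e, map_sum]
      simp only [map_smul]
      simp [Fin.sum_univ_three, hB]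
    rw [h1]
    conv_rhs => rw [e', Matrix.mulVec_sum]
    refine Finset.sum_congr rfl fun j _ => ?_
    obtain ⟨u, u', hu⟩ := hc j
    rw [Matrix.mulVec_smul, hu, hcross]
  have hd : (uMatrix φ).det = 1 := by
    have := aut_map_mul φ (0, 0, Pi.single 0 1, 0) (0, 0, 0, Pi.single 0 1)
    rw [hU, hB, hB'] at this
    have e : mul (0, 0, Pi.single 0 1, 0) (0, 0, 0, Pi.single 0 1) = idem := by
      simp [mul_def, idem]
    rw [e, h] at this
    have h1 := congrArg (fun z : SplitCayley => z.1) this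
    simp only [mul_def, idem, zero_mul, zero_add] at h1
    rw [Matrix.mulVec_transpose, dotProduct_comm, ← Matrix.dotProduct_mulVec, Matrix.mulVec_mulVec,
      Matrix.adjugate_mul] at h1
    simpa [Matrix.smul_mulVec] using h1.symm
  refine ⟨hd, aut_ext fun x => ?_⟩
  have e : x = x.1 • idem + x.2.1 • (0, 1, 0, 0) + (0, 0, x.2.2.1, 0) + (0, 0, 0, x.2.2.2) := by
    simp [idem]
  have e2 : φ.1.1 x = x.1 • idem + x.2.1 • (0, 1, 0, 0) + (0, 0, uMatrix φ *ᵥ x.2.2.1, 0)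
      + (0, 0, 0, (uMatrix φ).adjugateᵀ *ᵥ x.2.2.2) := by
    conv_lhs => rw [e]
    rw [map_add, map_add, map_add, map_smul, map_smul, h, hf, hU, hB, hB']
  rw [e2]
  change _ = (x.1, x.2.1, uMatrix φ *ᵥ x.2.2.1, (uMatrix φ).adjugateᵀ *ᵥ x.2.2.2)
  simp [idem]

/-- The orbit of `idem` near `idem`: an explicit product of a lower and an upper unipotent
automorphism takes `idem` to its image under `φ`. -/
theorem lAut_mul_uAut_inv_apply (φ : automorphismGroup) (h0 : (φ.1.1 idem).1 ≠ 0)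
    (h1 : (φ.1.1 idem).1 ≠ (φ.1.1 idem).2.1) :
    (lAut (-(φ.1.1 idem).1⁻¹ • (φ.1.1 idem).2.2.2) * uAut (φ.1.1 idem).2.2.1)⁻¹.1.1
      (φ.1.1 idem) = idem := by
  have hid : mul (φ.1.1 idem) (φ.1.1 idem) = φ.1.1 idem := by
    rw [← aut_map_mul]
    simp [mul_def, idem]
  have key : (lAut (-(φ.1.1 idem).1⁻¹ • (φ.1.1 idem).2.2.2) * uAut (φ.1.1 idem).2.2.1).1.1 idem =
      φ.1.1 idem := by
    generalize φ.1.1 idem = x at *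
    obtain ⟨a, b, u, v⟩ := x
    simp only [mul_def, Prod.ext_iff] at hid
    obtain ⟨ha, hb, -, -⟩ := hid
    simp only [dotProduct_comm v u] at hb
    simp only at h0 h1
    -- an idempotent near `idem` has trace one
    have hab : a + b = 1 := by
      have : (a - b) * (a + b - 1) = 0 := by linear_combination ha - hb
      rcases mul_eq_zero.1 this with h | h
      · exact absurd (sub_eq_zero.1 h) h1
      · linarith
    have huv : u ⬝ᵥ v = a * b := by linear_combination ha - a * hab
    rw [aut_mul_apply, uAut_apply, uLin_apply, lAut_apply]
    have hwu : (-a⁻¹ • v) ⬝ᵥ u = -b := by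
      rw [smul_dotProduct, dotProduct_comm, huv, smul_eq_mul]
      field_simp
    simp only [idem, dotProduct_zero, sub_zero, add_zero, zero_add, one_smul, map_zero, hwu]
    refine ext_coord ?_ ?_ (fun i => ?_) (fun i => ?_)
    · simp; linarith
    · simp
    · simp
    · have : (1 : ℝ) + -b = a := by linarith
      simp only [this]
      simp
      field_simp
  generalize lAut (-(φ.1.1 idem).1⁻¹ • (φ.1.1 idem).2.2.2) * uAut (φ.1.1 idem).2.2.1 = ψ at key ⊢
  rw [← key, ← aut_mul_apply, inv_mul_cancel]
  rfl

/-- The factorisation of a matrix with positive leading minors into a lower unipotent, a diagonal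
and an upper unipotent matrix. -/
theorem xSL_mul_torSL_mul_xSL (g : Matrix.SpecialLinearGroup (Fin 3) ℝ) (h0 : 0 < g.1 0 0)
    (hm : 0 < g.1 0 0 * g.1 1 1 - g.1 0 1 * g.1 1 0) :
    g = xSL 1 0 (by decide) (g.1 1 0 / g.1 0 0) * xSL 2 0 (by decide) (g.1 2 0 / g.1 0 0) *
      xSL 2 1 (by decide) ((g.1 0 0 * g.1 2 1 - g.1 2 0 * g.1 0 1) /
        (g.1 0 0 * g.1 1 1 - g.1 0 1 * g.1 1 0)) *
      torSL (Real.log (g.1 0 0), Real.log (g.1 0 0 * g.1 1 1 - g.1 0 1 * g.1 1 0)) *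
      xSL 1 2 (by decide) ((g.1 0 0 * g.1 1 2 - g.1 1 0 * g.1 0 2) /
        (g.1 0 0 * g.1 1 1 - g.1 0 1 * g.1 1 0)) *
      xSL 0 2 (by decide) (g.1 0 2 / g.1 0 0) * xSL 0 1 (by decide) (g.1 0 1 / g.1 0 0) := by
  have hd := g.2
  rw [Matrix.det_fin_three] at hd
  obtain ⟨A, hA⟩ := g
  simp only at h0 hm hd ⊢
  refine Subtype.ext ?_
  change A = Matrix.transvection _ _ _ * Matrix.transvection _ _ _ * Matrix.transvection _ _ _ *
    Matrix.diagonal _ * Matrix.transvection _ _ _ * Matrix.transvection _ _ _ *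
    Matrix.transvection _ _ _
  simp only [Real.exp_sub, Real.exp_neg, Real.exp_log h0, Real.exp_log hm]
  have hm' := hm.ne'
  have h0' := h0.ne'
  ext i j
  simp only [Matrix.transvection, Matrix.mul_apply, Fin.sum_univ_three, Matrix.add_apply,
    Matrix.diagonal_apply, Matrix.single_apply, Matrix.one_apply]
  generalize hmm : A 0 0 * A 1 1 - A 0 1 * A 1 0 = m at *
  fin_cases i <;> fin_cases j <;> simp <;> field_simp
  · linear_combination hmm
  · ring
  · ring
  · linear_combination A 0 0 * hd - (A 2 2 * A 0 0 - A 2 0 * A 0 2) * hmm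


theorem tendsto_sAut_of_generators {F : Filter automorphismGroup}
    (hF : ∀ {X : Type} {l : Filter X} {a b : X → automorphismGroup}, Filter.Tendsto a l F →
      Filter.Tendsto b l F → Filter.Tendsto (fun x => a x * b x) l F)
    (hpos : ∀ k, Filter.Tendsto (autPinning.pos k) (nhds 0) F)
    (hneg : ∀ k, Filter.Tendsto (autPinning.neg k) (nhds 0) F)
    (htor : Filter.Tendsto autPinning.tor (nhds 0) F) : Filter.Tendsto sAut (nhds 1) F := by
  have hc : ∀ i j, ContinuousAt (fun g : Matrix.SpecialLinearGroup (Fin 3) ℝ => g.1 i j) 1 :=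
    fun i j => (continuous_subtype_val.matrix_elem i j).continuousAt
  have h00 : (1 : Matrix.SpecialLinearGroup (Fin 3) ℝ).1 0 0 = 1 := rfl
  have hm1 : (1 : Matrix.SpecialLinearGroup (Fin 3) ℝ).1 0 0 *
      (1 : Matrix.SpecialLinearGroup (Fin 3) ℝ).1 1 1 -
      (1 : Matrix.SpecialLinearGroup (Fin 3) ℝ).1 0 1 *
      (1 : Matrix.SpecialLinearGroup (Fin 3) ℝ).1 1 0 = 1 := by
    simp [Matrix.SpecialLinearGroup.coe_one]
  have hcm := ((hc 0 0).mul (hc 1 1)).sub ((hc 0 1).mul (hc 1 0))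
  have hlim : ∀ {f : Matrix.SpecialLinearGroup (Fin 3) ℝ → ℝ}, ContinuousAt f 1 → f 1 = 0 →
      Filter.Tendsto f (nhds 1) (nhds 0) := fun hf h => h ▸ hf
  have e0 : ∀ᶠ g : Matrix.SpecialLinearGroup (Fin 3) ℝ in nhds 1, 0 < g.1 0 0 :=
    (hc 0 0).eventually (lt_mem_nhds (zero_lt_one.trans_eq h00.symm))
  have em : ∀ᶠ g : Matrix.SpecialLinearGroup (Fin 3) ℝ in nhds 1,
      0 < g.1 0 0 * g.1 1 1 - g.1 0 1 * g.1 1 0 :=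
    hcm.eventually (lt_mem_nhds (zero_lt_one.trans_eq hm1.symm))
  have h0ne := h00.trans_ne one_ne_zero
  have hmne := hm1.trans_ne one_ne_zero
  have t10 := (hneg 0).comp (hlim ((hc 1 0).div (hc 0 0) h0ne) (by simp))
  have t20 := (hneg 2).comp (hlim ((hc 2 0).div (hc 0 0) h0ne) (by simp))
  have t21 := (hneg 1).comp (hlim ((((hc 0 0).mul (hc 2 1)).sub
    ((hc 2 0).mul (hc 0 1))).div hcm hmne) (by simp))
  have tt := htor.comp (x := nhds 1) (f := fun g : Matrix.SpecialLinearGroup (Fin 3) ℝ =>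
    (Real.log (g.1 0 0), Real.log (g.1 0 0 * g.1 1 1 - g.1 0 1 * g.1 1 0)))
    ((hlim ((hc 0 0).log h0ne) (by simp)).prodMk_nhds (hlim (hcm.log hmne) (by simp)))
  have t12 := (hpos 1).comp (hlim ((((hc 0 0).mul (hc 1 2)).sub
    ((hc 1 0).mul (hc 0 2))).div hcm hmne) (by simp))
  have t02 := (hpos 2).comp (hlim ((hc 0 2).div (hc 0 0) h0ne) (by simp))
  have t01 := (hpos 0).comp (hlim ((hc 0 1).div (hc 0 0) h0ne) (by simp))
  have t := hF (hF (hF (hF (hF (hF t10 t20) t21) tt) t12) t02) t01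
  refine t.congr' ?_
  filter_upwards [e0, em] with g h0 hm
  conv_rhs => rw [xSL_mul_torSL_mul_xSL g h0 hm]
  simp only [map_mul]
  rfl

/-- Near the identity every automorphism is a product of small elements of the root subgroups, of
the torus and of the families `uAut` and `lAut`.  The filter `F` encodes smallness. -/
theorem nhds_one_le_of_generators {F : Filter automorphismGroup}
    (hF : ∀ {X : Type} {l : Filter X} {a b : X → automorphismGroup}, Filter.Tendsto a l F →
      Filter.Tendsto b l F → Filter.Tendsto (fun x => a x * b x) l F)
    (hpos : ∀ k, Filter.Tendsto (autPinning.pos k) (nhds 0) F)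
    (hneg : ∀ k, Filter.Tendsto (autPinning.neg k) (nhds 0) F)
    (htor : Filter.Tendsto autPinning.tor (nhds 0) F)
    (hu : Filter.Tendsto uAut (nhds 0) F) (hl : Filter.Tendsto lAut (nhds 0) F) : nhds 1 ≤ F := by
  have hs := tendsto_sAut_of_generators hF hpos hneg htor
  have hx : ContinuousAt (fun φ : automorphismGroup => φ.1.1 idem) 1 :=
    (continuous_aut_apply idem).continuousAt
  have hx1 : (1 : automorphismGroup).1.1 idem = (1, 0, 0, 0) := rfl
  have hyu : ContinuousAt (fun φ : automorphismGroup => (φ.1.1 idem).2.2.1) 1 := hx.snd.snd.fst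
  have hyv : ContinuousAt (fun φ : automorphismGroup =>
      -(φ.1.1 idem).1⁻¹ • (φ.1.1 idem).2.2.2) 1 :=
    (hx.fst.inv₀ (by rw [hx1]; exact one_ne_zero)).neg.smul hx.snd.snd.snd
  have hyu0 : Filter.Tendsto (fun φ : automorphismGroup => (φ.1.1 idem).2.2.1) (nhds 1) (nhds 0) :=
    hyu
  have hyv0 : Filter.Tendsto (fun φ : automorphismGroup =>
      -(φ.1.1 idem).1⁻¹ • (φ.1.1 idem).2.2.2) (nhds 1) (nhds 0) := by
    have := hyv.tendsto
    rwa [hx1, smul_zero] at this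
  set ψ : automorphismGroup → automorphismGroup := fun φ =>
    (lAut (-(φ.1.1 idem).1⁻¹ • (φ.1.1 idem).2.2.2) * uAut (φ.1.1 idem).2.2.1)⁻¹ * φ with hψ
  have hψ1 : Filter.Tendsto ψ (nhds 1) (nhds 1) := by
    have h1 := (continuous_lAut.tendsto 0).comp hyv0
    have h2 := (continuous_uAut.tendsto 0).comp hyu0
    have h3 := (h1.mul h2).inv.mul Filter.tendsto_id
    simp only [lAut_zero, uAut_zero, mul_one, inv_one] at h3
    exact h3
  classical
  set γ : automorphismGroup → Matrix.SpecialLinearGroup (Fin 3) ℝ := fun φ =>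
    if h : (uMatrix (ψ φ)).det = 1 then ⟨uMatrix (ψ φ), h⟩ else 1 with hγ
  have hγ1 : Filter.Tendsto γ (nhds 1) (nhds 1) := by
    have hA : Filter.Tendsto (fun φ => uMatrix (ψ φ)) (nhds 1) (nhds 1) := by
      have := (continuous_uMatrix.tendsto 1).comp hψ1
      rwa [uMatrix_one] at this
    have e : ∀ φ, (γ φ).1 = if (uMatrix (ψ φ)).det = 1 then uMatrix (ψ φ) else 1 := fun φ => by
      by_cases h : (uMatrix (ψ φ)).det = 1
      · rw [if_pos h]
        exact congrArg Subtype.val (dif_pos h)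
      · rw [if_neg h]
        exact congrArg Subtype.val (dif_neg h)
    refine tendsto_subtype_rng.2 ?_
    simp only [e]
    exact hA.if' tendsto_const_nhds
  refine Filter.tendsto_id'.1 ?_
  refine (hF (hF (hl.comp hyv0) (hu.comp hyu0)) (hs.comp hγ1)).congr' ?_
  have e1 : ∀ᶠ φ : automorphismGroup in nhds 1, 1 / 2 < (φ.1.1 idem).1 :=
    hx.fst.eventually (lt_mem_nhds (show (1 / 2 : ℝ) < (1 : ℝ) by norm_num))
  have e2 : ∀ᶠ φ : automorphismGroup in nhds 1, (φ.1.1 idem).2.1 < 1 / 2 :=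
    hx.snd.fst.eventually (gt_mem_nhds (show (0 : ℝ) < 1 / 2 by norm_num))
  filter_upwards [e1, e2] with φ h1 h2
  have hfix : (ψ φ).1.1 idem = idem :=
    lAut_mul_uAut_inv_apply φ (by linarith) (by linarith)
  obtain ⟨hd, h⟩ := eq_sAut_of_fix_idem (ψ φ) hfix
  have h3 : sAut (γ φ) = ψ φ :=
     (congrArg sAut (dif_pos hd)).trans h.symm
  simp only [Function.comp_apply, h3, hψ, mul_inv_cancel_left, id]

end SplitCayley

/-! ### Lifting the root subgroups to a covering group -/

namespace G2Pinning

variable {Γ : Type*} [Group Γ] [TopologicalSpace Γ] (P : G2Pinning Γ)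

theorem pos_zero (k : Fin 6) : P.pos k 0 = 1 := by
  have := P.pos_add k 0 0
  rwa [add_zero, left_eq_mul] at this

theorem neg_zero (k : Fin 6) : P.neg k 0 = 1 := by
  have := P.neg_add k 0 0
  rwa [add_zero, left_eq_mul] at this

theorem tor_zero : P.tor 0 = 1 := by
  have := P.tor_add 0 0
  rwa [add_zero, left_eq_mul] at this

end G2Pinning

namespace SplitCayley

variable {G : Type*} [Group G] [TopologicalSpace G]

/-- A homomorphism to `G₂₍₂₎` as a homomorphism to the group of automorphisms. -/
noncomputable def toAut (π : G →* G22) : G →* automorphismGroup :=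
  (Subgroup.connectedComponentOfOne automorphismGroup).subtype.comp π

theorem exists_lift {π : G →* G22} (hπ : IsCoveringMap π) {P : Type*}
    [NormedAddCommGroup P] [NormedSpace ℝ P]
    {f : P → automorphismGroup} (hf : Continuous f) (h0 : f 0 = 1) :
    ∃ F : P → G, Continuous F ∧ F 0 = 1 ∧ ∀ x, toAut π (F x) = f x := by
  have hmem : ∀ x, f x ∈ Subgroup.connectedComponentOfOne automorphismGroup := fun x =>
    (isPreconnected_range hf).subset_connectedComponent ⟨0, h0⟩ ⟨x, rfl⟩
  obtain ⟨F, ⟨hF0, hF⟩, -⟩ := hπ.existsUnique_continuousMap_lifts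
    (⟨fun x => (⟨f x, hmem x⟩ : G22), hf.subtype_mk _⟩ : C(P, G22)) 0 1
    (by rw [map_one]; exact Subtype.ext h0.symm)
  exact ⟨F, F.continuous, hF0, fun x => congrArg Subtype.val (congrFun hF x)⟩

theorem eqOn_of_toAut_eq {π : G →* G22} (hπ : IsCoveringMap π) {X : Type*}
    [TopologicalSpace X] {s : Set X} (hs : IsPreconnected s)
    {f g : X → G} (hf : ContinuousOn f s) (hg : ContinuousOn g s)
    (h : ∀ x ∈ s, toAut π (f x) = toAut π (g x)) {a : X} (ha : a ∈ s) (hfg : f a = g a) :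
    Set.EqOn f g s :=
  hπ.eqOn_of_comp_eqOn hs hf hg (fun x hx => Subtype.ext (h x hx)) ha hfg

theorem eq_of_toAut_eq {π : G →* G22} (hπ : IsCoveringMap π) {X : Type*}
    [TopologicalSpace X] [PreconnectedSpace X]
    {f g : X → G} (hf : Continuous f) (hg : Continuous g)
    (h : ∀ x, toAut π (f x) = toAut π (g x)) (a : X) (hfg : f a = g a) (x : X) : f x = g x :=
  eqOn_of_toAut_eq hπ isPreconnected_univ hf.continuousOn hg.continuousOn (fun x _ => h x)
    (Set.mem_univ a) hfg (Set.mem_univ x)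

/-- The root subgroups lift to a covering group, and the relations persist because the domains of
their parameters are connected. -/
theorem exists_lift_autPinning [IsTopologicalGroup G] {π : G →* G22} (hπ : IsCoveringMap π) :
    ∃ P : G2Pinning G,
    (∀ k t, toAut π (P.pos k t) = autPinning.pos k t) ∧
    (∀ k t, toAut π (P.neg k t) = autPinning.neg k t) ∧
    ∀ x, toAut π (P.tor x) = autPinning.tor x := by
  choose p hp hp0 hpl using fun k =>
    exists_lift hπ (autPinning.continuous_pos k) (autPinning.pos_zero k)
  choose n hn hn0 hnl using fun k =>
    exists_lift hπ (autPinning.continuous_neg k) (autPinning.neg_zero k)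
  obtain ⟨τ, hτ, hτ0, hτl⟩ := exists_lift hπ autPinning.continuous_tor autPinning.tor_zero
  refine ⟨{ pos := p, neg := n, tor := τ, continuous_pos := hp, continuous_neg := hn,
            continuous_tor := hτ, pos_add := ?_, neg_add := ?_, tor_add := ?_,
            tor_mul_pos := ?_, tor_mul_neg := ?_, pos_mul_neg := ?_ }, hpl, hnl, hτl⟩
  · intro k s t
    have hk := hp k
    exact eq_of_toAut_eq hπ (X := ℝ × ℝ) (f := fun x => p k (x.1 + x.2))
      (g := fun x => p k x.1 * p k x.2) (by fun_prop) (by fun_prop)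
      (fun x => by simp only [map_mul, hpl, autPinning.pos_add]) 0 (by simp [hp0]) (s, t)
  · intro k s t
    have hk := hn k
    exact eq_of_toAut_eq hπ (X := ℝ × ℝ) (f := fun x => n k (x.1 + x.2))
      (g := fun x => n k x.1 * n k x.2) (by fun_prop) (by fun_prop)
      (fun x => by simp only [map_mul, hnl, autPinning.neg_add]) 0 (by simp [hn0]) (s, t)
  · intro s t
    exact eq_of_toAut_eq hπ (X := (ℝ × ℝ) × ℝ × ℝ) (f := fun x => τ (x.1 + x.2))
      (g := fun x => τ x.1 * τ x.2) (by fun_prop) (by fun_prop)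
      (fun x => by simp only [map_mul, hτl, autPinning.tor_add]) 0 (by simp [hτ0]) (s, t)
  · intro k x t
    have hk := hp k
    exact eq_of_toAut_eq hπ (X := (ℝ × ℝ) × ℝ) (f := fun x => τ x.1 * p k x.2)
      (g := fun x => p k (Real.exp (g2Root₁ k * x.1.1 + g2Root₂ k * x.1.2) * x.2) * τ x.1)
      (by fun_prop) (by fun_prop)
      (fun x => by simp only [map_mul, hpl, hτl, autPinning.tor_mul_pos]) 0 (by simp [hp0, hτ0])
      (x, t)
  · intro k x t
    have hk := hn k
    exact eq_of_toAut_eq hπ (X := (ℝ × ℝ) × ℝ) (f := fun x => τ x.1 * n k x.2)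
      (g := fun x => n k (Real.exp (-(g2Root₁ k * x.1.1 + g2Root₂ k * x.1.2)) * x.2) * τ x.1)
      (by fun_prop) (by fun_prop)
      (fun x => by simp only [map_mul, hnl, hτl, autPinning.tor_mul_neg]) 0 (by simp [hn0, hτ0])
      (x, t)
  · intro k t s ht hs
    have hk := hp k
    have hk' := hn k
    have hball : ∀ x ∈ Metric.ball (0 : ℝ × ℝ) 1, |x.1| < 1 ∧ |x.2| < 1 := fun x hx => by
      rw [mem_ball_zero_iff, Prod.norm_def, max_lt_iff] at hx
      exact hx
    have hd : ∀ x ∈ Metric.ball (0 : ℝ × ℝ) 1, 1 + x.1 * x.2 ≠ 0 := fun x hx =>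
      (one_add_mul_pos (hball x hx).1 (hball x hx).2).ne'
    have h1 : ContinuousOn (fun x : ℝ × ℝ => 1 + x.1 * x.2) (Metric.ball 0 1) := by fun_prop
    have h2 := h1.log hd
    refine eqOn_of_toAut_eq hπ (X := ℝ × ℝ) (s := Metric.ball 0 1) (a := 0)
      (convex_ball _ _).isPreconnected (f := fun x => p k x.1 * n k x.2)
      (g := fun x => n k (x.2 / (1 + x.1 * x.2)) * τ (g2Coroot₁ k * Real.log (1 + x.1 * x.2),
        g2Coroot₂ k * Real.log (1 + x.1 * x.2)) * p k (x.1 / (1 + x.1 * x.2)))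
      (by fun_prop) (((hk'.comp_continuousOn (continuousOn_snd.div h1 hd)).mul
        (hτ.comp_continuousOn ((continuousOn_const.mul h2).prodMk (continuousOn_const.mul h2)))).mul
        (hk.comp_continuousOn (continuousOn_fst.div h1 hd)))
      (fun x hx => ?_) (Metric.mem_ball_self one_pos) ?_ (?_ : (t, s) ∈ Metric.ball (0 : ℝ × ℝ) 1)
    · simp only [map_mul, hpl, hnl, hτl]
      exact autPinning.pos_mul_neg k x.1 x.2 (hball x hx).1 (hball x hx).2
    · have := hτ0
      simp [hp0, hn0, Prod.zero_eq_mk] at this ⊢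
      exact this.symm
    · rw [mem_ball_zero_iff, Prod.norm_def, max_lt_iff]
      exact ⟨ht, hs⟩

/-- The filter of the small values that `toAut π` takes on a subgroup is closed under products. -/
theorem tendsto_map_toAut_mul [IsTopologicalGroup G] (π : G →* G22) (N : Subgroup G) {X : Type*}
    {l : Filter X}
    {a b : X → automorphismGroup}
    (ha : Filter.Tendsto a l (Filter.map (toAut π) (nhdsWithin 1 N)))
    (hb : Filter.Tendsto b l (Filter.map (toAut π) (nhdsWithin 1 N))) :
    Filter.Tendsto (fun x => a x * b x) l (Filter.map (toAut π) (nhdsWithin 1 N)) := by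
  intro S hS
  rw [Filter.mem_map, mem_nhdsWithin] at hS
  obtain ⟨U, hU, h1, hUS⟩ := hS
  obtain ⟨V, hV, hVU⟩ := exists_nhds_one_split (hU.mem_nhds h1)
  have hm : toAut π '' (V ∩ N) ∈ Filter.map (toAut π) (nhdsWithin 1 N) :=
    Filter.image_mem_map (Filter.inter_mem (nhdsWithin_le_nhds hV) self_mem_nhdsWithin)
  rw [Filter.mem_map']
  filter_upwards [ha hm, hb hm] with x hx hy
  obtain ⟨g, hg, hgx⟩ := hx
  obtain ⟨h, hh, hhx⟩ := hy
  rw [← hgx, ← hhx, ← map_mul]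
  exact hUS ⟨hVU g hg.1 h hh.1, N.mul_mem hg.2 hh.2⟩

/-- A family of automorphisms indexed by `ℝ³` is small near `0` in terms of the subgroup `N` if it
is so along the coordinate axes and if each of its members is conjugate to one on an axis by
elements of `N` that stay in a compact set. -/
theorem tendsto_map_toAut_of_conj [IsTopologicalGroup G] (π : G →* G22) (N : Subgroup G)
    {f : (Fin 3 → ℝ) → automorphismGroup}
    (h : ∀ i, ∃ α β τ : ℝ → G, Continuous α ∧ Continuous β ∧ Continuous τ ∧ (∀ c, α c ∈ N) ∧
      (∀ c, β c ∈ N) ∧ (∀ t, τ t ∈ N) ∧ τ 0 = 1 ∧ ∀ c c' t,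
      toAut π (α c * β c' * τ t * (α c * β c')⁻¹) = f (t • Pi.single i 1 +
        ((c * t) • Pi.single (i + 1) 1 + (c' * t) • Pi.single (i + 2) 1))) :
    Filter.Tendsto f (nhds 0) (Filter.map (toAut π) (nhdsWithin 1 N)) := by
  intro S hS
  rw [Filter.mem_map, mem_nhdsWithin] at hS
  obtain ⟨U, hU, h1, hUS⟩ := hS
  choose α β τ hα hβ hτ hαN hβN hτN hτ0 hf using h
  have key : ∀ i, ∀ᶠ t in nhds (0 : ℝ), ∀ y ∈ Set.Icc (-1 : ℝ) 1 ×ˢ Set.Icc (-1 : ℝ) 1,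
      α i y.1 * β i y.2 * τ i t * (α i y.1 * β i y.2)⁻¹ ∈ U := by
    intro i
    refine (isCompact_Icc.prod isCompact_Icc).eventually_forall_of_forall_eventually
      fun y _ => ?_
    have hc : Continuous fun z : ℝ × ℝ × ℝ =>
        α i z.2.1 * β i z.2.2 * τ i z.1 * (α i z.2.1 * β i z.2.2)⁻¹ := by
      have h2 := hα i
      have h3 := hβ i
      have h4 := hτ i
      fun_prop
    refine hc.continuousAt.eventually (hU.mem_nhds ?_)
    simpa [hτ0 i] using h1
  have key' : ∀ᶠ w : Fin 3 → ℝ in nhds 0, ∀ i, ∀ y ∈ Set.Icc (-1 : ℝ) 1 ×ˢ Set.Icc (-1 : ℝ) 1,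
      α i y.1 * β i y.2 * τ i (w i) * (α i y.1 * β i y.2)⁻¹ ∈ U :=
    Filter.eventually_all.2 fun i =>
      ((continuous_apply i : Continuous fun w : Fin 3 → ℝ => w i).tendsto' 0 0 rfl).eventually
        (key i)
  rw [Filter.mem_map']
  filter_upwards [key'] with w hw
  -- a coordinate of largest absolute value, so that the parameters of the conjugating elements
  -- stay in a compact set
  obtain ⟨i, hi⟩ := Finite.exists_max fun i => |w i|
  have hq : ∀ j, w j / w i ∈ Set.Icc (-1 : ℝ) 1 := fun j => by
    rw [Set.mem_Icc, ← abs_le, abs_div]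
    exact div_le_one_of_le₀ (hi j) (abs_nonneg _)
  have hm : ∀ j, w j / w i * w i = w j := fun j => by
    by_cases h0 : w i = 0
    · have := hi j
      rw [h0, abs_zero] at this
      rw [h0, mul_zero, abs_nonpos_iff.1 this]
    · exact div_mul_cancel₀ _ h0
  have e : w = w i • Pi.single i 1 + ((w (i + 1) / w i * w i) • Pi.single (i + 1) 1 +
      (w (i + 2) / w i * w i) • Pi.single (i + 2) 1) := by
    rw [hm, hm]
    funext l
    fin_cases i <;> fin_cases l <;> simp
  change f w ∈ S
  rw [e, ← hf i]
  exact hUS ⟨hw i (_, _) ⟨hq (i + 1), hq (i + 2)⟩,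
    N.mul_mem (N.mul_mem (N.mul_mem (hαN i _) (hβN i _)) (hτN i _))
      (N.inv_mem (N.mul_mem (hαN i _) (hβN i _)))⟩

theorem xSL_mulVec (i j : Fin 3) (h : i ≠ j) (c : ℝ) (w : Fin 3 → ℝ) :
    (xSL i j h c).1 *ᵥ w = w + (c * w j) • Pi.single i 1 := by
  change (1 + Matrix.single i j c) *ᵥ w = _
  rw [Matrix.add_mulVec, Matrix.one_mulVec]
  congr 1
  funext l
  fin_cases i <;> fin_cases j <;> fin_cases l <;>
    simp [Matrix.mulVec, dotProduct, Matrix.single_apply]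

theorem xSL_inv_transpose_mulVec (i j : Fin 3) (h : i ≠ j) (c : ℝ) (w : Fin 3 → ℝ) :
    ((xSL i j h c)⁻¹).1ᵀ *ᵥ w = w - (c * w i) • Pi.single j 1 := by
  have e : (xSL i j h c)⁻¹ = xSL i j h (-c) := by
    rw [inv_eq_iff_mul_eq_one, ← xSL_add, add_neg_cancel]
    exact Subtype.ext (Matrix.transvection_zero i j)
  have e' : (xSL i j h (-c)).1ᵀ = (xSL j i h.symm (-c)).1 := by
    change (1 + Matrix.single i j (-c))ᵀ = 1 + Matrix.single j i (-c)
    rw [Matrix.transpose_add, Matrix.transpose_one, Matrix.transpose_single]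
  rw [e, e', xSL_mulVec, neg_mul, neg_smul, sub_eq_add_neg]

theorem sAut_conj_uAut (g h : Matrix.SpecialLinearGroup (Fin 3) ℝ) (w : Fin 3 → ℝ) :
    sAut g * sAut h * uAut w * (sAut g * sAut h)⁻¹ = uAut (g.1 *ᵥ (h.1 *ᵥ w)) := by
  rw [mul_inv_eq_iff_eq_mul, mul_assoc, sAut_mul_uAut, ← mul_assoc, sAut_mul_uAut, mul_assoc]

theorem sAut_conj_lAut (g h : Matrix.SpecialLinearGroup (Fin 3) ℝ) (w : Fin 3 → ℝ) :
    sAut g * sAut h * lAut w * (sAut g * sAut h)⁻¹ =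
      lAut ((g⁻¹).1ᵀ *ᵥ ((h⁻¹).1ᵀ *ᵥ w)) := by
  rw [mul_inv_eq_iff_eq_mul, mul_assoc, sAut_mul_lAut, ← mul_assoc, sAut_mul_lAut, mul_assoc]

/-- The lifted root subgroups and the lifted torus generate a connected covering group. -/
theorem eq_top_of_pinning_mem [IsTopologicalGroup G] [ConnectedSpace G] {π : G →* G22}
    (hπ : IsCoveringMap π) (P : G2Pinning G)
    (hp : ∀ k t, toAut π (P.pos k t) = autPinning.pos k t)
    (hn : ∀ k t, toAut π (P.neg k t) = autPinning.neg k t)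
    (ht : ∀ x, toAut π (P.tor x) = autPinning.tor x) (N : Subgroup G)
    (hpN : ∀ k t, P.pos k t ∈ N) (hnN : ∀ k t, P.neg k t ∈ N) (htN : ∀ x, P.tor x ∈ N) :
    N = ⊤ := by
  have hsmall : ∀ {X : Type} [TopologicalSpace X] [Zero X] {f : X → G} {f' : X → automorphismGroup},
      Continuous f → f 0 = 1 → (∀ x, f x ∈ N) → (∀ x, toAut π (f x) = f' x) →
      Filter.Tendsto f' (nhds 0) (Filter.map (toAut π) (nhdsWithin 1 N)) := by
    intro X _ _ f f' hf h0 hN h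
    have h1 : Filter.Tendsto f (nhds 0) (nhdsWithin 1 N) :=
      tendsto_nhdsWithin_iff.2 ⟨h0 ▸ hf.tendsto 0, Filter.Eventually.of_forall hN⟩
    have h2 := Filter.tendsto_map.comp (f := f) (g := toAut π) h1
    exact h2.congr h
  have hx : ∀ (i j : Fin 3) (h : i ≠ j), ∃ ξ : ℝ → G, Continuous ξ ∧ (∀ c, ξ c ∈ N) ∧
      ∀ c, toAut π (ξ c) = sAut (xSL i j h c) := by
    intro i j h
    fin_cases i <;> fin_cases j
    · exact absurd rfl h
    · exact ⟨P.pos 0, P.continuous_pos 0, hpN 0, hp 0⟩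
    · exact ⟨P.pos 2, P.continuous_pos 2, hpN 2, hp 2⟩
    · exact ⟨P.neg 0, P.continuous_neg 0, hnN 0, hn 0⟩
    · exact absurd rfl h
    · exact ⟨P.pos 1, P.continuous_pos 1, hpN 1, hp 1⟩
    · exact ⟨P.neg 2, P.continuous_neg 2, hnN 2, hn 2⟩
    · exact ⟨P.neg 1, P.continuous_neg 1, hnN 1, hn 1⟩
    · exact absurd rfl h
  have hu : ∀ i : Fin 3, ∃ τ : ℝ → G, Continuous τ ∧ (∀ c, τ c ∈ N) ∧ τ 0 = 1 ∧
      ∀ c, toAut π (τ c) = uAut (c • Pi.single i 1) := by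
    intro i
    fin_cases i
    · exact ⟨P.pos 3, P.continuous_pos 3, hpN 3, P.pos_zero 3, hp 3⟩
    · exact ⟨P.pos 4, P.continuous_pos 4, hpN 4, P.pos_zero 4, hp 4⟩
    · exact ⟨P.neg 5, P.continuous_neg 5, hnN 5, P.neg_zero 5, hn 5⟩
  have hl : ∀ i : Fin 3, ∃ τ : ℝ → G, Continuous τ ∧ (∀ c, τ c ∈ N) ∧ τ 0 = 1 ∧
      ∀ c, toAut π (τ c) = lAut (c • Pi.single i 1) := by
    intro i
    fin_cases i
    · exact ⟨P.neg 3, P.continuous_neg 3, hnN 3, P.neg_zero 3, hn 3⟩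
    · exact ⟨P.neg 4, P.continuous_neg 4, hnN 4, P.neg_zero 4, hn 4⟩
    · exact ⟨P.pos 5, P.continuous_pos 5, hpN 5, P.pos_zero 5, hp 5⟩
  have hi1 : ∀ i : Fin 3, i + 1 ≠ i := by decide
  have hi2 : ∀ i : Fin 3, i + 2 ≠ i := by decide
  have huAut : Filter.Tendsto uAut (nhds 0) (Filter.map (toAut π) (nhdsWithin 1 N)) := by
    refine tendsto_map_toAut_of_conj π N fun i => ?_
    obtain ⟨α, hα, hαN, hαl⟩ := hx (i + 1) i (hi1 i)
    obtain ⟨β, hβ, hβN, hβl⟩ := hx (i + 2) i (hi2 i)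
    obtain ⟨τ, hτ, hτN, hτ0, hτl⟩ := hu i
    refine ⟨α, β, τ, hα, hβ, hτ, hαN, hβN, hτN, hτ0, fun c c' t => ?_⟩
    rw [map_mul, map_inv, map_mul, map_mul, hαl, hβl, hτl, sAut_conj_uAut, xSL_mulVec, xSL_mulVec]
    congr 1
    simp [(hi2 i).symm]
    abel
  have hlAut : Filter.Tendsto lAut (nhds 0) (Filter.map (toAut π) (nhdsWithin 1 N)) := by
    refine tendsto_map_toAut_of_conj π N fun i => ?_
    obtain ⟨α, hα, hαN, hαl⟩ := hx i (i + 1) (hi1 i).symm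
    obtain ⟨β, hβ, hβN, hβl⟩ := hx i (i + 2) (hi2 i).symm
    obtain ⟨τ, hτ, hτN, hτ0, hτl⟩ := hl i
    refine ⟨fun c => α (-c), fun c => β (-c), τ, hα.comp continuous_neg, hβ.comp continuous_neg, hτ,
      fun c => hαN _, fun c => hβN _, hτN, hτ0, fun c c' t => ?_⟩
    rw [map_mul, map_inv, map_mul, map_mul, hαl, hβl, hτl, sAut_conj_lAut,
      xSL_inv_transpose_mulVec, xSL_inv_transpose_mulVec]
    congr 1
    simp [(hi2 i).symm]
    abel
  have hpF : ∀ k, Filter.Tendsto (autPinning.pos k) (nhds 0)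
      (Filter.map (toAut π) (nhdsWithin 1 N)) := fun k =>
    hsmall (f := P.pos k) (P.continuous_pos k) (P.pos_zero k) (hpN k) (hp k)
  have hnF : ∀ k, Filter.Tendsto (autPinning.neg k) (nhds 0)
      (Filter.map (toAut π) (nhdsWithin 1 N)) := fun k =>
    hsmall (f := P.neg k) (P.continuous_neg k) (P.neg_zero k) (hnN k) (hn k)
  have htF : Filter.Tendsto autPinning.tor (nhds 0) (Filter.map (toAut π) (nhdsWithin 1 N)) :=
    hsmall (f := P.tor) P.continuous_tor P.tor_zero htN ht
  have hF := nhds_one_le_of_generators (F := Filter.map (toAut π) (nhdsWithin 1 N))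
    (fun ha hb => tendsto_map_toAut_mul π N ha hb)
    hpF hnF htF huAut hlAut
  have hcont : Continuous (toAut π) := continuous_subtype_val.comp hπ.continuous
  -- on a neighbourhood `V` of `1` the projection is injective, so that the lift in `N` of a small
  -- value is the element itself
  obtain ⟨V, hV, h1V, hinj⟩ := hπ.isLocalHomeomorph.isLocallyInjective 1
  have hVN : toAut π '' (V ∩ N) ∈ nhds (1 : automorphismGroup) :=
    hF (Filter.image_mem_map (Filter.inter_mem (nhdsWithin_le_nhds (hV.mem_nhds h1V))
      self_mem_nhdsWithin))
  have hN : (N : Set G) ∈ nhds (1 : G) := by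
    have h1 := hcont.tendsto 1
    rw [map_one] at h1
    filter_upwards [h1 hVN, hV.mem_nhds h1V] with g hg hgV
    obtain ⟨g', hg', e⟩ := hg
    rw [← hinj hg'.1 hgV (Subtype.ext e)]
    exact hg'.2
  have hopen := N.isOpen_of_mem_nhds hN
  exact SetLike.coe_injective
    (IsClopen.eq_univ ⟨N.isClosed_of_isOpen hopen, hopen⟩ ⟨1, N.one_mem⟩)

end SplitCayley

/-! ### Differentiation of one-parameter groups -/

section OneParameter

variable {A : Type*} [NormedRing A] [NormedAlgebra ℝ A]

/-- A continuous one-parameter group in a Banach algebra is differentiable: multiplication by the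
invertible element `∫₀ᵃ x`, with `a` small, turns it into a difference of primitives. -/
theorem hasDerivAt_of_map_add [CompleteSpace A] {x : ℝ → A} (hx : Continuous x) (h0 : x 0 = 1)
    (hadd : ∀ s t, x (s + t) = x s * x t) (t : ℝ) : HasDerivAt x (x t * deriv x 0) t := by
  have hΦ : ∀ t, HasDerivAt (fun u => ∫ s in (0 : ℝ)..u, x s) (x t) t := fun t =>
    intervalIntegral.integral_hasDerivAt_right (hx.intervalIntegrable _ _)
      (hx.stronglyMeasurableAtFilter _ _) hx.continuousAt
  obtain ⟨a, ha⟩ : ∃ a : ℝ, IsUnit (∫ s in (0 : ℝ)..a, x s) := by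
    have h1 := (hΦ 0).tendsto_slope_zero
    simp only [zero_add, intervalIntegral.integral_same, sub_zero, h0] at h1
    have h2 : ∀ᶠ a in nhdsWithin (0 : ℝ) {0}ᶜ, IsUnit (a⁻¹ • ∫ s in (0 : ℝ)..a, x s) :=
      h1.eventually (Units.isOpen.mem_nhds isUnit_one)
    obtain ⟨a, ha, ha0⟩ := (h2.and self_mem_nhdsWithin).exists
    rw [Set.mem_singleton_iff] at ha0
    refine ⟨a, ?_⟩
    have h3 := ha.smul (Units.mk0 a ha0)
    rwa [Units.smul_def, Units.val_mk0, smul_inv_smul₀ ha0] at h3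
  obtain ⟨u, hu⟩ := ha
  have hmul : ∀ t, x t * u = (∫ s in (0 : ℝ)..(t + a), x s) - ∫ s in (0 : ℝ)..t, x s := fun t => by
    have h1 := (ContinuousLinearMap.mul ℝ A (x t)).intervalIntegral_comp_comm
      (hx.intervalIntegrable (μ := MeasureTheory.volume) 0 a)
    simp only [ContinuousLinearMap.mul_apply'] at h1
    rw [hu, ← h1, intervalIntegral.integral_interval_sub_left
      (hx.intervalIntegrable _ _) (hx.intervalIntegrable _ _)]
    simp only [← hadd]
    rw [intervalIntegral.integral_comp_add_left, add_zero]
  have hx' : x = fun t => ((∫ s in (0 : ℝ)..(t + a), x s) - ∫ s in (0 : ℝ)..t, x s) * ↑u⁻¹ :=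
    funext fun t => by rw [← hmul, Units.mul_inv_cancel_right]
  have hdiff : DifferentiableAt ℝ x 0 := by
    rw [hx']
    have h1 : HasDerivAt (fun t => ∫ s in (0 : ℝ)..(t + a), x s) (x (0 + a)) 0 :=
      (hΦ (0 + a)).comp_add_const 0 a
    exact ((h1.sub (hΦ 0)).mul_const _).differentiableAt
  have h1 : HasDerivAt (fun s => x t * x (s - t)) (x t * deriv x 0) t := by
    have h2 : HasDerivAt x (deriv x 0) (t - t) := by
      rw [sub_self]; exact hdiff.hasDerivAt
    exact (h2.comp_sub_const t t).const_mul (x t)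
  refine h1.congr_of_eventuallyEq (Filter.Eventually.of_forall fun s => ?_)
  simp only [← hadd, add_sub_cancel]

theorem hasDerivAt_zero_of_map_add [CompleteSpace A] {x : ℝ → A} (hx : Continuous x) (h0 : x 0 = 1)
    (hadd : ∀ s t, x (s + t) = x s * x t) : HasDerivAt x (deriv x 0) 0 := by
  have := hasDerivAt_of_map_add hx h0 hadd 0
  rwa [h0, one_mul] at this

theorem eq_one_of_deriv_eq_zero [CompleteSpace A] {x : ℝ → A} (hx : Continuous x) (h0 : x 0 = 1)
    (hadd : ∀ s t, x (s + t) = x s * x t) (hd : deriv x 0 = 0) (t : ℝ) : x t = 1 := by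
  have h : ∀ t, HasDerivAt x 0 t := fun t => by
    simpa [hd] using hasDerivAt_of_map_add hx h0 hadd t
  rw [← h0]
  exact is_const_of_deriv_eq_zero (fun t => (h t).differentiableAt) (fun t => (h t).deriv) t 0

theorem Commute.deriv_right {x : ℝ → A} {z X : A} (hx : HasDerivAt x X 0)
    (h : ∀ t, Commute z (x t)) : Commute z X :=
  HasDerivAt.unique (f := fun t => z * x t) (hx.const_mul z)
    ((hx.mul_const z).congr_of_eventuallyEq (Filter.Eventually.of_forall h))

/-- The infinitesimal form of the action of a torus on a root subgroup. -/
theorem commutator_of_conj {h x : ℝ → A} {H X : A} {r : ℝ} (hh : HasDerivAt h H 0)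
    (hx : HasDerivAt x X 0) (h0 : h 0 = 1)
    (hrel : ∀ s t, h s * x t = x (Real.exp (r * s) * t) * h s) : H * X - X * H = r • X := by
  have h1 : ∀ s, h s * X = Real.exp (r * s) • (X * h s) := fun s => by
    have e1 : HasDerivAt (fun t => h s * x t) (h s * X) 0 := hx.const_mul _
    have hl : HasDerivAt (fun t : ℝ => Real.exp (r * s) * t) (Real.exp (r * s)) 0 := by
      simpa using (hasDerivAt_id (0 : ℝ)).const_mul (Real.exp (r * s))
    have hx' : HasDerivAt x X (Real.exp (r * s) * 0) := by rwa [mul_zero]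
    have e2 := (hx'.scomp (0 : ℝ) hl).mul_const (h s)
    rw [smul_mul_assoc] at e2
    exact e1.unique (e2.congr_of_eventuallyEq (Filter.Eventually.of_forall fun t => hrel s t))
  have e1 : HasDerivAt (fun s => h s * X) (H * X) 0 := hh.mul_const X
  have e2 : HasDerivAt (fun s : ℝ => Real.exp (r * s)) r 0 := by
    simpa using ((hasDerivAt_id (0 : ℝ)).const_mul r).exp
  have e3 := (e2.smul (hh.const_mul X)).congr_of_eventuallyEq
    (Filter.Eventually.of_forall h1 : (fun s => h s * X) =ᶠ[nhds 0] _)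
  have e4 := e1.unique e3
  rw [e4]
  simp [h0]

/-- The infinitesimal form of the relation between opposite root subgroups. -/
theorem commutator_of_pos_mul_neg {x y h : ℝ → A} {X Y H : A}
    (hx : ∀ t, HasDerivAt x (x t * X) t) (hy : HasDerivAt y Y 0) (hh : HasDerivAt h H 0)
    (x0 : x 0 = 1) (y0 : y 0 = 1) (h0 : h 0 = 1)
    (hrel : ∀ t s, |t| < 1 → |s| < 1 → x t * y s =
      y (s / (1 + t * s)) * h (Real.log (1 + t * s)) * x (t / (1 + t * s))) :
    X * Y - Y * X = H := by
  have h1 : ∀ t, |t| < 1 → x t * Y = Y * x t + t • (H * x t) - t ^ 2 • (x t * X) := by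
    intro t ht
    have e1 : HasDerivAt (fun s => x t * y s) (x t * Y) 0 := hy.const_mul _
    have d1 : HasDerivAt (fun s : ℝ => 1 + t * s) t 0 := by
      simpa using ((hasDerivAt_id (0 : ℝ)).const_mul t).const_add 1
    have hne : 1 + t * (0 : ℝ) ≠ 0 := by simp
    have d2 : HasDerivAt (fun s : ℝ => s / (1 + t * s)) 1 0 := by
      simpa using (hasDerivAt_id' (0 : ℝ)).fun_div d1 hne
    have d3 : HasDerivAt (fun s : ℝ => Real.log (1 + t * s)) t 0 := by
      simpa using d1.log hne
    have d4 : HasDerivAt (fun s : ℝ => t / (1 + t * s)) (-t ^ 2) 0 := by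
      simpa [pow_two] using (hasDerivAt_const (0 : ℝ) t).fun_div d1 hne
    have e2 : HasDerivAt (fun s => y (s / (1 + t * s))) Y 0 := by
      have hy' : HasDerivAt y Y (0 / (1 + t * 0)) := by simpa using hy
      have := hy'.scomp (0 : ℝ) d2
      rwa [one_smul] at this
    have e3 : HasDerivAt (fun s => h (Real.log (1 + t * s))) (t • H) 0 := by
      have hh' : HasDerivAt h H (Real.log (1 + t * 0)) := by simpa using hh
      exact hh'.scomp (0 : ℝ) d3
    have e4 : HasDerivAt (fun s => x (t / (1 + t * s))) (-t ^ 2 • (x t * X)) 0 := by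
      have hx' : HasDerivAt x (x t * X) (t / (1 + t * 0)) := by simpa using hx t
      exact hx'.scomp (0 : ℝ) d4
    have e5 := (e2.mul e3).mul e4
    have hev : (fun s => x t * y s) =ᶠ[nhds 0] fun s =>
        y (s / (1 + t * s)) * h (Real.log (1 + t * s)) * x (t / (1 + t * s)) := by
      have : ∀ᶠ s : ℝ in nhds 0, |s| < 1 :=
        continuous_abs.continuousAt.eventually (gt_mem_nhds (by simp))
      filter_upwards [this] with s hs using hrel t s ht hs
    have := e1.unique (e5.congr_of_eventuallyEq hev)
    simp [y0, h0] at this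
    rw [this, add_mul, smul_mul_assoc, sub_eq_add_neg]
  have e1 : HasDerivAt (fun t => x t * Y) (X * Y) 0 := by
    have := (hx 0).mul_const Y
    rwa [x0, one_mul] at this
  have hx0 : HasDerivAt x X 0 := by
    have := hx 0
    rwa [x0, one_mul] at this
  have e2 := ((hx0.const_mul Y).add ((hasDerivAt_id (0 : ℝ)).smul (hx0.const_mul H))).sub
    (((hasDerivAt_id (0 : ℝ)).pow 2).smul (hx0.mul_const X))
  have hev : (fun t => x t * Y) =ᶠ[nhds 0] fun t =>
      Y * x t + t • (H * x t) - t ^ 2 • (x t * X) := by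
    have : ∀ᶠ t : ℝ in nhds 0, |t| < 1 :=
      continuous_abs.continuousAt.eventually (gt_mem_nhds (by simp))
    filter_upwards [this] with t ht using h1 t ht
  have := e1.unique (e2.congr_of_eventuallyEq hev)
  rw [this]
  simp [x0]

end OneParameter

/-! ### The representation of the Lie algebra -/

namespace G2Pinning

variable {Γ : Type*} [Group Γ] [TopologicalSpace Γ] (P : G2Pinning Γ)

theorem tor_zero' : P.tor ((0 : ℝ), (0 : ℝ)) = 1 := P.tor_zero

theorem continuous_tor₁ : Continuous fun t : ℝ => P.tor (t, 0) :=
  P.continuous_tor.comp (by fun_prop)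

theorem continuous_tor₂ : Continuous fun t : ℝ => P.tor (0, t) :=
  P.continuous_tor.comp (by fun_prop)

theorem tor_eq (a b : ℝ) : P.tor (a, b) = P.tor (a, 0) * P.tor (0, b) := by
  rw [← P.tor_add, Prod.mk_add_mk, add_zero, zero_add]

theorem tor_eq' (a b : ℝ) : P.tor (a, b) = P.tor (0, b) * P.tor (a, 0) := by
  rw [← P.tor_add, Prod.mk_add_mk, add_zero, zero_add]

section Deriv

variable {A : Type*} [NormedRing A] [NormedAlgebra ℂ A] (Θ : Γ →* A)

/-- The operator by which the positive root vector of the root `k` acts. -/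
noncomputable def dPos (k : Fin 6) : A := deriv (fun t => Θ (P.pos k t)) 0

/-- The operator by which the negative root vector of the root `k` acts. -/
noncomputable def dNeg (k : Fin 6) : A := deriv (fun t => Θ (P.neg k t)) 0

/-- The operator by which the first basis vector of the torus acts. -/
noncomputable def dTor₁ : A := deriv (fun t : ℝ => Θ (P.tor (t, 0))) 0

/-- The operator by which the second basis vector of the torus acts. -/
noncomputable def dTor₂ : A := deriv (fun t : ℝ => Θ (P.tor (0, t))) 0

variable [CompleteSpace A] {Θ} (hΘ : Continuous Θ)
include hΘ

theorem hasDerivAt_pos (k : Fin 6) (t : ℝ) :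
    HasDerivAt (fun t => Θ (P.pos k t)) (Θ (P.pos k t) * P.dPos Θ k) t :=
  hasDerivAt_of_map_add (x := fun t => Θ (P.pos k t)) (hΘ.comp (P.continuous_pos k))
    (by simp [P.pos_zero]) (fun s t => by rw [P.pos_add, map_mul]) t

theorem hasDerivAt_neg (k : Fin 6) (t : ℝ) :
    HasDerivAt (fun t => Θ (P.neg k t)) (Θ (P.neg k t) * P.dNeg Θ k) t :=
  hasDerivAt_of_map_add (x := fun t => Θ (P.neg k t)) (hΘ.comp (P.continuous_neg k))
    (by simp [P.neg_zero]) (fun s t => by rw [P.neg_add, map_mul]) t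

theorem hasDerivAt_pos_zero (k : Fin 6) : HasDerivAt (fun t => Θ (P.pos k t)) (P.dPos Θ k) 0 := by
  simpa [P.pos_zero] using P.hasDerivAt_pos hΘ k 0

theorem hasDerivAt_neg_zero (k : Fin 6) : HasDerivAt (fun t => Θ (P.neg k t)) (P.dNeg Θ k) 0 := by
  simpa [P.neg_zero] using P.hasDerivAt_neg hΘ k 0

theorem hasDerivAt_tor₁ : HasDerivAt (fun t : ℝ => Θ (P.tor (t, 0))) (P.dTor₁ Θ) 0 :=
  hasDerivAt_zero_of_map_add (x := fun t : ℝ => Θ (P.tor (t, 0))) (hΘ.comp P.continuous_tor₁)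
    (by rw [P.tor_zero', map_one])
    (fun s t => by rw [← map_mul, ← P.tor_add, Prod.mk_add_mk, add_zero])

theorem hasDerivAt_tor₂ : HasDerivAt (fun t : ℝ => Θ (P.tor (0, t))) (P.dTor₂ Θ) 0 :=
  hasDerivAt_zero_of_map_add (x := fun t : ℝ => Θ (P.tor (0, t))) (hΘ.comp P.continuous_tor₂)
    (by rw [P.tor_zero', map_one])
    (fun s t => by rw [← map_mul, ← P.tor_add, Prod.mk_add_mk, add_zero])

theorem hasDerivAt_tor (m n : ℝ) :
    HasDerivAt (fun t : ℝ => Θ (P.tor (m * t, n * t))) (m • P.dTor₁ Θ + n • P.dTor₂ Θ) 0 := by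
  have hl : ∀ c : ℝ, HasDerivAt (fun t : ℝ => c * t) c 0 := fun c => by
    simpa using (hasDerivAt_id (0 : ℝ)).const_mul c
  have h1 : HasDerivAt (fun t : ℝ => Θ (P.tor (m * t, 0))) (m • P.dTor₁ Θ) 0 := by
    have h : HasDerivAt (fun t : ℝ => Θ (P.tor (t, 0))) (P.dTor₁ Θ) (m * 0) := by
      rw [mul_zero]
      exact P.hasDerivAt_tor₁ hΘ
    exact h.scomp (0 : ℝ) (hl m)
  have h2 : HasDerivAt (fun t : ℝ => Θ (P.tor (0, n * t))) (n • P.dTor₂ Θ) 0 := by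
    have h : HasDerivAt (fun t : ℝ => Θ (P.tor (0, t))) (P.dTor₂ Θ) (n * 0) := by
      rw [mul_zero]
      exact P.hasDerivAt_tor₂ hΘ
    exact h.scomp (0 : ℝ) (hl n)
  have h3 := h1.fun_mul h2
  simp only [mul_zero, ← map_mul, ← P.tor_eq] at h3
  rw [P.tor_zero', map_one, one_mul, mul_one] at h3
  exact h3

theorem dTor_comm : P.dTor₁ Θ * P.dTor₂ Θ = P.dTor₂ Θ * P.dTor₁ Θ :=
  Commute.deriv_right (P.hasDerivAt_tor₂ hΘ) fun t =>
    (Commute.deriv_right (P.hasDerivAt_tor₁ hΘ) fun s => by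
      rw [Commute, SemiconjBy, ← map_mul, ← map_mul, ← P.tor_eq, ← P.tor_eq']).symm

theorem dPos_dNeg (k : Fin 6) : P.dPos Θ k * P.dNeg Θ k - P.dNeg Θ k * P.dPos Θ k =
    (g2Coroot₁ k : ℂ) • P.dTor₁ Θ + (g2Coroot₂ k : ℂ) • P.dTor₂ Θ := by
  have h := commutator_of_pos_mul_neg (P.hasDerivAt_pos hΘ k) (P.hasDerivAt_neg_zero hΘ k)
    (P.hasDerivAt_tor hΘ (g2Coroot₁ k) (g2Coroot₂ k)) (by simp [P.pos_zero]) (by simp [P.neg_zero])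
    (by simp [← Prod.zero_eq_mk, P.tor_zero]) (fun t s ht hs => by
      rw [← map_mul, P.pos_mul_neg k t s ht hs, map_mul, map_mul])
  rw [h]
  module

theorem dTor₁_dPos (k : Fin 6) : P.dTor₁ Θ * P.dPos Θ k - P.dPos Θ k * P.dTor₁ Θ =
    (g2Root₁ k : ℂ) • P.dPos Θ k := by
  have h := commutator_of_conj (r := g2Root₁ k) (P.hasDerivAt_tor₁ hΘ) (P.hasDerivAt_pos_zero hΘ k)
    (by simp [← Prod.zero_eq_mk, P.tor_zero]) fun s t => by
      rw [← map_mul, P.tor_mul_pos, map_mul, mul_zero, add_zero]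
  rw [h]
  module

theorem dTor₂_dPos (k : Fin 6) : P.dTor₂ Θ * P.dPos Θ k - P.dPos Θ k * P.dTor₂ Θ =
    (g2Root₂ k : ℂ) • P.dPos Θ k := by
  have h := commutator_of_conj (r := g2Root₂ k) (P.hasDerivAt_tor₂ hΘ) (P.hasDerivAt_pos_zero hΘ k)
    (by simp [← Prod.zero_eq_mk, P.tor_zero]) fun s t => by
      rw [← map_mul, P.tor_mul_pos, map_mul, mul_zero, zero_add]
  rw [h]
  module

theorem dTor₁_dNeg (k : Fin 6) : P.dTor₁ Θ * P.dNeg Θ k - P.dNeg Θ k * P.dTor₁ Θ =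
    -(g2Root₁ k : ℂ) • P.dNeg Θ k := by
  have h := commutator_of_conj (r := -g2Root₁ k) (P.hasDerivAt_tor₁ hΘ)
    (P.hasDerivAt_neg_zero hΘ k) (by simp [← Prod.zero_eq_mk, P.tor_zero]) fun s t => by
      rw [← map_mul, P.tor_mul_neg, map_mul, mul_zero, add_zero, neg_mul]
  rw [h]
  module

theorem dTor₂_dNeg (k : Fin 6) : P.dTor₂ Θ * P.dNeg Θ k - P.dNeg Θ k * P.dTor₂ Θ =
    -(g2Root₂ k : ℂ) • P.dNeg Θ k := by
  have h := commutator_of_conj (r := -g2Root₂ k) (P.hasDerivAt_tor₂ hΘ)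
    (P.hasDerivAt_neg_zero hΘ k) (by simp [← Prod.zero_eq_mk, P.tor_zero]) fun s t => by
      rw [← map_mul, P.tor_mul_neg, map_mul, mul_zero, zero_add, neg_mul]
  rw [h]
  module

/-- The root subgroups and the torus act trivially if the Lie algebra does. -/
theorem map_eq_one_of_deriv_eq_zero (hE : ∀ k, P.dPos Θ k = 0) (hF : ∀ k, P.dNeg Θ k = 0)
    (h₁ : P.dTor₁ Θ = 0) (h₂ : P.dTor₂ Θ = 0) :
    (∀ k t, Θ (P.pos k t) = 1) ∧ (∀ k t, Θ (P.neg k t) = 1) ∧ ∀ x, Θ (P.tor x) = 1 := by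
  refine ⟨fun k => ?_, fun k => ?_, fun x => ?_⟩
  · exact eq_one_of_deriv_eq_zero (x := fun t => Θ (P.pos k t)) (hΘ.comp (P.continuous_pos k))
      (by simp [P.pos_zero]) (fun s t => by simp [P.pos_add]) (hE k)
  · exact eq_one_of_deriv_eq_zero (x := fun t => Θ (P.neg k t)) (hΘ.comp (P.continuous_neg k))
      (by simp [P.neg_zero]) (fun s t => by simp [P.neg_add]) (hF k)
  · have e1 := eq_one_of_deriv_eq_zero (x := fun t : ℝ => Θ (P.tor (t, 0)))
      (hΘ.comp P.continuous_tor₁) (by rw [P.tor_zero', map_one])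
      (fun s t => by rw [← map_mul, ← P.tor_add, Prod.mk_add_mk, add_zero]) h₁ x.1
    have e2 := eq_one_of_deriv_eq_zero (x := fun t : ℝ => Θ (P.tor (0, t)))
      (hΘ.comp P.continuous_tor₂) (by rw [P.tor_zero', map_one])
      (fun s t => by rw [← map_mul, ← P.tor_add, Prod.mk_add_mk, add_zero]) h₂ x.2
    rw [← Prod.mk.eta (p := x), P.tor_eq, map_mul, e1, e2, one_mul]

end Deriv

/-- The representation of the Lie algebra on `V` that is the derivative of a representation of the
group. -/
noncomputable def rep {V : Type*} [NormedAddCommGroup V] [NormedSpace ℂ V] [CompleteSpace V]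
    {Θ : Γ →* (V →L[ℂ] V)} (hΘ : Continuous Θ) : G2Rep V where
  E k := (P.dPos Θ k).toLinearMap
  F k := (P.dNeg Θ k).toLinearMap
  H₁ := (P.dTor₁ Θ).toLinearMap
  H₂ := (P.dTor₂ Θ).toLinearMap
  comm := congrArg ContinuousLinearMap.toLinearMap (P.dTor_comm hΘ)
  EF k := congrArg ContinuousLinearMap.toLinearMap (P.dPos_dNeg hΘ k)
  HE₁ k := congrArg ContinuousLinearMap.toLinearMap (P.dTor₁_dPos hΘ k)
  HE₂ k := congrArg ContinuousLinearMap.toLinearMap (P.dTor₂_dPos hΘ k)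
  HF₁ k := congrArg ContinuousLinearMap.toLinearMap (P.dTor₁_dNeg hΘ k)
  HF₂ k := congrArg ContinuousLinearMap.toLinearMap (P.dTor₂_dNeg hΘ k)

/-- Schur's lemma for a representation of the group of dimension seven in which some root subgroup
or the torus acts nontrivially. -/
theorem exists_eq_smul_of_commute {V : Type*} [NormedAddCommGroup V] [NormedSpace ℂ V]
    [FiniteDimensional ℂ V] [CompleteSpace V] (hV : Module.finrank ℂ V = 7)
    {Θ : Γ →* (V →L[ℂ] V)} (hΘ : Continuous Θ)
    (hne : ¬ ((∀ k t, Θ (P.pos k t) = 1) ∧ (∀ k t, Θ (P.neg k t) = 1) ∧ ∀ x, Θ (P.tor x) = 1))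
    {z : V →L[ℂ] V} (hz : ∀ g, Commute z (Θ g)) : ∃ c : ℂ, ∀ v, z v = c • v := by
  have hcomm : ∀ {y : V →L[ℂ] V}, Commute z y → Commute z.toLinearMap y.toLinearMap :=
    fun h => congrArg ContinuousLinearMap.toLinearMap h
  have hne' : ∃ k, ¬((P.rep hΘ).H k = 0 ∧ (P.rep hΘ).E k = 0 ∧ (P.rep hΘ).F k = 0) := by
    by_contra hcon
    have hall : ∀ k, (P.rep hΘ).H k = 0 ∧ (P.rep hΘ).E k = 0 ∧ (P.rep hΘ).F k = 0 := by
      simpa only [not_exists, not_not] using hcon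
    have h₁ : (P.rep hΘ).H₁ = 0 := by
      simpa [G2Rep.H, g2Coroot₁, g2Coroot₂] using (hall 0).1
    have h₂ : (P.rep hΘ).H₂ = 0 := by
      simpa [G2Rep.H, g2Coroot₁, g2Coroot₂] using (hall 1).1
    exact hne (P.map_eq_one_of_deriv_eq_zero hΘ
      (fun k => ContinuousLinearMap.coe_injective (hall k).2.1)
      (fun k => ContinuousLinearMap.coe_injective (hall k).2.2)
      (ContinuousLinearMap.coe_injective h₁) (ContinuousLinearMap.coe_injective h₂))
  obtain ⟨c, hc⟩ := (P.rep hΘ).exists_eq_smul_of_commute hV hne' z.toLinearMap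
    (fun k => hcomm (Commute.deriv_right (P.hasDerivAt_pos_zero hΘ k) fun t => hz _))
    (fun k => hcomm (Commute.deriv_right (P.hasDerivAt_neg_zero hΘ k) fun t => hz _))
    (hcomm (Commute.deriv_right (P.hasDerivAt_tor₁ hΘ) fun t => hz _))
    (hcomm (Commute.deriv_right (P.hasDerivAt_tor₂ hΘ) fun t => hz _))
  exact ⟨c, fun v => congrArg (fun f : Module.End ℂ V => f v) hc⟩

end G2Pinning

/-! ### Centralizers in the universal covering group -/

/-- The action of real matrices on `ℂ⁷`. -/
noncomputable def complexAction : Matrix (Fin 3 ⊕ Fin 4) (Fin 3 ⊕ Fin 4) ℝ →*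
    ((Fin 3 ⊕ Fin 4 → ℂ) →L[ℂ] (Fin 3 ⊕ Fin 4 → ℂ)) where
  toFun M := LinearMap.toContinuousLinearMap (Matrix.toLin' (M.map Complex.ofReal))
  map_one' := by
    ext1 v
    simp [Matrix.map_one]
  map_mul' M N := by
    refine ContinuousLinearMap.ext fun v => ?_
    have h : (M * N).map Complex.ofReal = M.map Complex.ofReal * N.map Complex.ofReal :=
      Matrix.map_mul (f := Complex.ofRealHom)
    simp [h]

theorem complexAction_apply (M : Matrix (Fin 3 ⊕ Fin 4) (Fin 3 ⊕ Fin 4) ℝ)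
    (v : Fin 3 ⊕ Fin 4 → ℂ) : complexAction M v = (M.map Complex.ofReal) *ᵥ v := by
  simp [complexAction]

theorem complexAction_single (M : Matrix (Fin 3 ⊕ Fin 4) (Fin 3 ⊕ Fin 4) ℝ)
    (i j : Fin 3 ⊕ Fin 4) : complexAction M (Pi.single j 1) i = M i j := by
  simp [complexAction_apply]

theorem complexAction_injective : Function.Injective complexAction := fun M N h => by
  ext i j
  have := complexAction_single M i j
  rw [h, complexAction_single] at this
  exact_mod_cast this.symm

theorem continuous_complexAction : Continuous complexAction := by
  refine continuous_clm_apply.2 fun v => ?_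
  simp only [complexAction_apply]
  exact (continuous_id.matrix_map Complex.continuous_ofReal).matrix_mulVec continuous_const

/-- A scalar matrix in `O(3,4)` is `1` or `-1`. -/
theorem eq_one_or_eq_neg_one_of_scalar {M : Matrix (Fin 3 ⊕ Fin 4) (Fin 3 ⊕ Fin 4) ℝ}
    (hM : M ∈ O34) {c : ℂ} (hc : ∀ v, complexAction M v = c • v) : M = 1 ∨ M = -1 := by
  have hij : ∀ i j, (M i j : ℂ) = if i = j then c else 0 := fun i j => by
    rw [← complexAction_single, hc]
    simp [Pi.single_apply]
  set r : ℝ := M (Sum.inl 0) (Sum.inl 0) with hr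
  have hcr : c = r := by rw [hr, hij, if_pos rfl]
  have hMr : M = r • (1 : Matrix (Fin 3 ⊕ Fin 4) (Fin 3 ⊕ Fin 4) ℝ) := by
    ext i j
    have := hij i j
    rw [hcr] at this
    rw [Matrix.smul_apply, Matrix.one_apply]
    split_ifs at this ⊢ with h
    · simpa using this
    · simpa using this
  have h2 : r * r = 1 := by
    have h3 := (mem_O34_iff M).1 hM (Pi.single (Sum.inl 0) 1) (Pi.single (Sum.inl 0) 1)
    rw [hMr, Matrix.smul_mulVec, Matrix.one_mulVec, map_smul, map_smul, LinearMap.smul_apply,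
      form34_single_single] at h3
    simpa [sgn34] using h3
  rcases mul_self_eq_one_iff.1 h2 with h | h
  · left; rw [hMr, h, one_smul]
  · right; rw [hMr, h, neg_one_smul]

/-- The matrices of `SO₀(3,4)` as a representation of its universal covering group. -/
noncomputable def coveringAction : UniversalCoveringGroup SO34Zero →*
    ((Fin 3 ⊕ Fin 4 → ℂ) →L[ℂ] (Fin 3 ⊕ Fin 4 → ℂ)) where
  toFun z := complexAction (so34Matrix (universalCoveringHom SO34Zero z))
  map_one' := by
    rw [map_one]
    exact map_one complexAction
  map_mul' z w := by
    rw [map_mul]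
    exact map_mul complexAction _ _

theorem continuous_coveringAction : Continuous coveringAction :=
  continuous_complexAction.comp
    (continuous_so34Matrix.comp (continuous_universalCoveringHom SO34Zero))

theorem ker_coveringAction {z : UniversalCoveringGroup SO34Zero} :
    coveringAction z = 1 ↔ z ∈ (universalCoveringHom SO34Zero).ker := by
  rw [MonoidHom.mem_ker, ← map_one complexAction]
  refine ⟨fun h => so34Matrix_injective (complexAction_injective h), fun h => ?_⟩
  change complexAction (so34Matrix (universalCoveringHom SO34Zero z)) = complexAction 1
  rw [h]
  rfl

/-- Only finitely many elements of the universal covering group act by scalars. -/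
theorem finite_setOf_coveringAction_scalar :
    {z : UniversalCoveringGroup SO34Zero | ∃ c : ℂ, ∀ v, coveringAction z v = c • v}.Finite := by
  have hT : {A : SO34Zero | so34Matrix A = 1 ∨ so34Matrix A = -1}.Finite :=
    Set.Finite.preimage (s := {1, -1}) so34Matrix_injective.injOn (Set.toFinite _)
  have hfib : ∀ A : SO34Zero, (universalCoveringHom SO34Zero ⁻¹' {A}).Finite := by
    intro A
    have hker : {z : UniversalCoveringGroup SO34Zero |
        z ∈ (universalCoveringHom SO34Zero).ker}.Finite :=
      Set.finite_coe_iff.1 finite_ker_universalCoveringHom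
    rcases (universalCoveringHom SO34Zero ⁻¹' {A}).eq_empty_or_nonempty with h | ⟨z, hz⟩
    · rw [h]; exact Set.finite_empty
    · refine (hker.image (z * ·)).subset fun w hw => ⟨z⁻¹ * w, ?_, mul_inv_cancel_left z w⟩
      rw [Set.mem_preimage, Set.mem_singleton_iff] at hz hw
      rw [Set.mem_ofPred_eq, MonoidHom.mem_ker, map_mul, map_inv, hz, hw, inv_mul_cancel]
  refine (hT.preimage' fun A _ => hfib A).subset ?_
  rintro z ⟨c, hc⟩
  exact eq_one_or_eq_neg_one_of_scalar
    (M := so34Matrix (universalCoveringHom SO34Zero z)) (universalCoveringHom SO34Zero z).1.2 hc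

/-- A homomorphism to the universal covering group that is trivial, after projection to
`SO₀(3,4)`, on the root subgroups and the torus is trivial: these one-parameter groups are
divisible and the kernel of the projection is finite. -/
theorem eq_one_of_coveringAction_eq_one {G : Type*} [Group G] [TopologicalSpace G]
    [IsTopologicalGroup G] [ConnectedSpace G] {π : G →* G22} (hπ : IsCoveringMap π)
    {P : G2Pinning G} (hp : ∀ k t, SplitCayley.toAut π (P.pos k t) = SplitCayley.autPinning.pos k t)
    (hn : ∀ k t, SplitCayley.toAut π (P.neg k t) = SplitCayley.autPinning.neg k t)
    (ht : ∀ x, SplitCayley.toAut π (P.tor x) = SplitCayley.autPinning.tor x)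
    (ρ : G →* UniversalCoveringGroup SO34Zero)
    (hpos : ∀ k t, coveringAction (ρ (P.pos k t)) = 1)
    (hneg : ∀ k t, coveringAction (ρ (P.neg k t)) = 1)
    (htor : ∀ x, coveringAction (ρ (P.tor x)) = 1) : ρ = 1 := by
  have hfin := finite_ker_universalCoveringHom
  set n := Nat.card (universalCoveringHom SO34Zero).ker with hn'
  have hn0 : n ≠ 0 := Nat.card_pos.ne'
  have hpow : ∀ z : UniversalCoveringGroup SO34Zero, coveringAction z = 1 → z ^ n = 1 := by
    intro z hz
    exact congrArg Subtype.val (pow_card_eq_one' (x := (⟨z, ker_coveringAction.1 hz⟩ :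
      (universalCoveringHom SO34Zero).ker)))
  have hdiv : ∀ {X : Type} [AddCommGroup X] [Module ℝ X] {x : X → G}, x 0 = 1 →
      (∀ s t, x (s + t) = x s * x t) → (∀ t, coveringAction (ρ (x t)) = 1) →
      ∀ t, x t ∈ ρ.ker := by
    intro X _ _ x h0 hadd hx t
    have hm : ∀ m : ℕ, ∀ t, x (m • t) = x t ^ m := by
      intro m t
      induction m with
      | zero => rw [zero_smul, h0, pow_zero]
      | succ m ih => rw [succ_nsmul, hadd, ih, pow_succ]
    have e : t = n • ((n : ℝ)⁻¹ • t) := by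
      rw [← Nat.cast_smul_eq_nsmul ℝ, smul_inv_smul₀ (Nat.cast_ne_zero.2 hn0)]
    rw [MonoidHom.mem_ker, e, hm, map_pow, hpow _ (hx _)]
  have htop := SplitCayley.eq_top_of_pinning_mem hπ P hp hn ht ρ.ker
    (fun k => hdiv (P.pos_zero k) (P.pos_add k) (hpos k))
    (fun k => hdiv (P.neg_zero k) (P.neg_add k) (hneg k))
    (hdiv P.tor_zero P.tor_add htor)
  exact MonoidHom.ext fun g => MonoidHom.mem_ker.1 (htop ▸ Subgroup.mem_top g)

theorem mainTheorem4
    (G : Type*) [Group G] [TopologicalSpace G] [IsTopologicalGroup G] [ConnectedSpace G]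
    (π : G →* G22) (hπ : IsCoveringMap π) (hπ_surj : Function.Surjective π)
    (ρ₁ : G →* UniversalCoveringGroup SO34Zero) (hρ₁ : Continuous ρ₁) (hρ₁_nontriv : ρ₁ ≠ 1) :
    (Subgroup.centralizer (Set.range ρ₁) : Set (UniversalCoveringGroup SO34Zero)).Finite := by
  obtain ⟨P, hp, hn, ht⟩ := SplitCayley.exists_lift_autPinning hπ
  refine finite_setOf_coveringAction_scalar.subset fun z hz => ?_
  refine P.exists_eq_smul_of_commute (by simp) (Θ := coveringAction.comp ρ₁)
    (continuous_coveringAction.comp hρ₁) ?_ (z := coveringAction z) fun g => ?_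
  · rintro ⟨h1, h2, h3⟩
    exact hρ₁_nontriv (eq_one_of_coveringAction_eq_one hπ hp hn ht ρ₁ h1 h2 h3)
  · have := Subgroup.mem_centralizer_iff.1 hz (ρ₁ g) ⟨g, rfl⟩
    rw [Commute, SemiconjBy, MonoidHom.comp_apply, ← map_mul, ← map_mul, this]
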